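/- Let $\mathbb F$ be a field of characteristic $\neq 2,3$, let $V=\mathbb F^2$ be the natural module of $\mathbf{SL}_2$, with the skew-symmetric form $(u\mid v)=u_0v_1-u_1v_0$ (unique up to a nonzero scalar), and put $\gamma_{u,v}(w)=(u\mid w)v+(v\mid w)u$. For a group scheme $\mathbf S$ with Lie algebra $\mathfrak s$, an $\mathbf S$-structure on a Lie algebra $\mathcal L$ over $\mathbb F$ is a homomorphism $\Phi:\mathbf S\to\mathbf{Aut}(\mathcal L)$ of group-valued functors on commutative $\mathbb F$-algebras; it is inner if there is an injective Lie algebra homomorphism $\iota:\mathfrak s\to\mathcal L$ with $\mathrm{ad}\circ\iota=\mathrm d\Phi$. An $\mathbf{SL}_2$-structure is short if $\mathcal L$ is a direct sum of copies of the adjoint, the natural and the trivial module; then $\mathcal L=(\mathfrak{sl}(V)\otimes\mathcal J)\oplus(V\otimes\mathcal T)\oplus\mathcal D$. An $(\mathbf{SL}_2\times\mathbf{SL}_2)$-structure is short if $\mathcal L$ is a direct sum of copies of the adjoint modules of the two factors, the natural modules $V_1,V_0$ of the first and second factor, the module $V_1\otimes V_0$, and the trivial module. **Coordinates.** If $\Psi$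 is an inner short $\mathbf{SL}_2$-structure on $\mathcal L$ with a decomposition as above, then $\iota(f)=f\otimes 1$ for a unique $1\in\mathcal J$, and the bracket of $\mathcal L$ has the form $$[f\otimes a,g\otimes b]=[f,g]\otimes a\cdot b+2\,\mathrm{tr}(fg)D_{a,b},\qquad [f\otimes a,u\otimes x]=f(u)\otimes a\bullet x,$$ $$[u\otimes x,v\otimes y]=\gamma_{u,v}\otimes\langle x\mid y\rangle+(u\mid v)d_{x,y},\qquad [d,f\otimes a]=f\otimes d(a),\qquad [d,u\otimes x]=u\otimes d(x),$$ with $D_{a,b},d_{x,y}\in\mathcal D$. With these operations and $\{x,y,z\}=\frac12(-d_{x,y}(z)+\langle x\mid y\rangle\bullet z)$, the pair $(\mathcal J,\mathcal T)$ is a $J$-ternary algebra: $\mathcal J$ is a unital Jordan algebra, $\mathcal T$ is a unital special Jordan module, $\langle\cdot\mid\cdot\rangle$ is skew-symmetric, and, for $a\in\mathcal J$ and $x,y,z,w,v\in\mathcal T$, $a\cdot\langle x\mid y\rangle=\frac12(\langle a\bullet x\mid y\rangle+\langle x\mid a\bullet y\rangle)$; $a\bullet\{x,y,z\}=\{a\bullet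 x,y,z\}-\{x,a\bullet y,z\}+\{x,y,a\bullet z\}$; $\{x,y,z\}=\{z,y,x\}-\langle x\mid z\rangle\bullet y$; $\{x,y,z\}=\{y,x,z\}+\langle x\mid y\rangle\bullet z$; $\langle\{x,y,z\}\mid w\rangle+\langle z\mid\{x,y,w\}\rangle=\langle x\mid\langle z\mid w\rangle\bullet y\rangle$; $\{x,y,\{z,w,v\}\}=\{\{x,y,z\},w,v\}+\{z,\{y,x,w\},v\}+\{z,w,\{x,y,v\}\}$. **From structures to idempotents.** Let $\Phi$ be an $(\mathbf{SL}_2\times\mathbf{SL}_2)$-structure on $\mathcal L$ and let $\Delta$ be the diagonal embedding of $\mathbf{SL}_2$. If $\Phi$ is inner through $\iota$, then $\Phi\circ\Delta$ is inner through $X\mapsto\iota(X,X)$; if $\Phi$ is short, then so is $\Phi\circ\Delta$. If $\Phi$ is inner through $\iota$ and $\Phi\circ\Delta$ is short, with decomposition $\mathcal L=(\mathfrak{sl}(V)\otimes\mathcal J)\oplus(V\otimes\mathcal T)\oplus\mathcal D$, then $\mathcal J$ contains an idempotent $e=e^{\cdot 2}\neq 0,1$ such that $\iota(f_1,f_0)=f_1\otimes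 e+f_0\otimes(1-e)$ for all $f_1,f_0\in\mathfrak{sl}(V)$; in particular the image of $\iota$ is $(\mathfrak{sl}(V)\otimes e)\oplus(\mathfrak{sl}(V)\otimes(1-e))$. **From idempotents to structures.** Let $\Psi$ be an inner short $\mathbf{SL}_2$-structure on $\mathcal L$ with $\mathcal L=(\mathfrak{sl}(V)\otimes\mathcal J)\oplus(V\otimes\mathcal T)\oplus\mathcal D$, and let $e=e^{\cdot 2}\neq 0,1$ be an idempotent of $\mathcal J$. Put $\mathcal J_i=\{a\in\mathcal J: e\cdot a=ia\}$ for $i=1,\frac12,0$ and $\mathcal T_i=\{x\in\mathcal T: e\bullet x=ix\}$ for $i=1,0$. Then $\mathcal J=\mathcal J_1\oplus\mathcal J_{\frac12}\oplus\mathcal J_0$, $\mathcal T=\mathcal T_1\oplus\mathcal T_0$, and there is a short $(\mathbf{SL}_2\times\mathbf{SL}_2)$-structure $\Phi$ on $\mathcal L$ with $\Phi\circ\Delta=\Psi$, inner through $(f_1,f_0)\mapsto f_1\otimes e+f_0\otimes(1-e)$, whose isotypic decomposition is $$\mathcal L=(\mathfrak{sl}(V)\otimes\mathcal J_1)\oplus(\mathfrak{sl}(V)\otimes\mathcal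 J_0)\oplus\bigl((\mathfrak{sl}(V)\otimes\mathcal J_{\frac12})\oplus D_{e,\mathcal J_{\frac12}}\bigr)\oplus(V\otimes\mathcal T_1)\oplus(V\otimes\mathcal T_0)\oplus\mathcal S,$$ the six summands being the isotypic components of type: adjoint of the first factor, adjoint of the second factor, $V_1\otimes V_0$, $V_1$, $V_0$, trivial. Moreover: - for $0\ne a\in\mathcal J_1$ (resp. $0\neq a\in\mathcal J_0$), $\mathfrak{sl}(V)\otimes a$ is a copy of the adjoint module of the first (resp. second) factor; - for $0\ne a\in\mathcal J_{\frac12}$, $(\mathfrak{sl}(V)\otimes a)\oplus\mathbb F D_{e,a}$ is a copy of $V_1\otimes V_0$; - for $0\ne x\in\mathcal T_1$ (resp. $0\neq x\in\mathcal T_0$), $V\otimes x$ is a copy of $V_1$ (resp. $V_0$); - $\mathcal S$ is the subspace of elements fixed by $\mathbf{SL}_2\times\mathbf{SL}_2$, and the subspace of elements fixed by $\mathbf{SL}_2$ under $\Psi=\Phi\circ\Delta$ is $\mathcal D=\mathcal S\oplus D_{e,\mathcal J_{\frac12}}$. -/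

import Mathlib

open scoped TensorProduct

noncomputable section

universe u v w

namespace ShortSL2

/-! ### Group functors, representations and `S`-structures -/

/-- A group-valued functor on commutative `F`-algebras. -/
structure GroupFunctor (F : Type u) [Field F] where
  pts : ∀ (R : Type u) [CommRing R] [Algebra F R], Type u
  grp : ∀ (R : Type u) [CommRing R] [Algebra F R], Group (pts R)
  map : ∀ {R S : Type u} [CommRing R] [Algebra F R] [CommRing S] [Algebra F S],
    (R →ₐ[F] S) → pts R →* pts S
  map_id : ∀ (R : Type u) [CommRing R] [Algebra F R] (g : pts R), map (AlgHom.id F R) g = g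
  map_comp : ∀ {R S T : Type u} [CommRing R] [Algebra F R] [CommRing S] [Algebra F S]
    [CommRing T] [Algebra F T] (φ : R →ₐ[F] S) (ψ : S →ₐ[F] T) (g : pts R),
    map (ψ.comp φ) g = map ψ (map φ g)

attribute [instance] GroupFunctor.grp

/-- The group scheme `SL₂` over `F`, as a functor of points. -/
abbrev SL2 (F : Type u) [Field F] : GroupFunctor F where
  pts R _ _ := Matrix.SpecialLinearGroup (Fin 2) R
  grp _ _ _ := inferInstance
  map φ := Matrix.SpecialLinearGroup.map (φ : _ →+* _)
  map_id _ _ _ _ := by ext; rfl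
  map_comp _ _ _ := by ext; rfl

/-- The product of two group functors. -/
abbrev GroupFunctor.prod {F : Type u} [Field F] (G H : GroupFunctor F) : GroupFunctor F where
  pts R _ _ := G.pts R × H.pts R
  grp _ _ _ := inferInstance
  map φ := (G.map φ).prodMap (H.map φ)
  map_id R _ _ g := Prod.ext (G.map_id R g.1) (H.map_id R g.2)
  map_comp φ ψ g := Prod.ext (G.map_comp φ ψ g.1) (H.map_comp φ ψ g.2)

/-- A linear representation of the group functor `G` on the vector space `M`: `R`-linear actions
of `G(R)` on `R ⊗ M`, natural in the commutative `F`-algebra `R`. -/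
structure GroupRep {F : Type u} [Field F] (G : GroupFunctor F)
    (M : Type v) [AddCommGroup M] [Module F M] where
  act : ∀ (R : Type u) [CommRing R] [Algebra F R], G.pts R →* Module.End R (R ⊗[F] M)
  natural : ∀ {R S : Type u} [CommRing R] [Algebra F R] [CommRing S] [Algebra F S]
    (φ : R →ₐ[F] S) (g : G.pts R) (x : R ⊗[F] M),
    act S (G.map φ g) (φ.toLinearMap.rTensor M x) = φ.toLinearMap.rTensor M (act R g x)

/-- A `G`-structure on the Lie algebra `L`: a homomorphism of group functors from `G` to the
automorphism group functor `R ↦ Aut_R (R ⊗ L)` of `L`. -/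
structure GStructure {F : Type u} [Field F] (G : GroupFunctor F)
    (L : Type v) [LieRing L] [LieAlgebra F L] extends GroupRep G L where
  map_lie : ∀ (R : Type u) [CommRing R] [Algebra F R] (g : G.pts R) (x y : R ⊗[F] L),
    act R g ⁅x, y⁆ = ⁅act R g x, act R g y⁆

section General

variable {F : Type u} [Field F] {G H : GroupFunctor F}
variable {M : Type v} [AddCommGroup M] [Module F M] {N : Type w} [AddCommGroup N] [Module F N]

/-- The linear map `φ : M → N` is a homomorphism of `G`-modules. -/
def Equivariant (σ : GroupRep G M) (ρ : GroupRep G N) (φ : M →ₗ[F] N) : Prop :=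
  ∀ (R : Type u) [CommRing R] [Algebra F R] (g : G.pts R) (x : R ⊗[F] M),
    ρ.act R g (φ.baseChange R x) = φ.baseChange R (σ.act R g x)

/-- The subspace `W` is a submodule of `ρ` isomorphic to `σ`. -/
def IsCopy (σ : GroupRep G M) (ρ : GroupRep G N) (W : Submodule F N) : Prop :=
  ∃ φ : M →ₗ[F] N, Equivariant σ ρ φ ∧ Function.Injective φ ∧ LinearMap.range φ = W

/-- The isotypic component of `ρ` of type `σ` (`σ` irreducible): the sum of the images of all
homomorphisms from `σ` to `ρ`. -/
def isotypic (σ : GroupRep G M) (ρ : GroupRep G N) : Submodule F N :=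
  ⨆ φ : {φ : M →ₗ[F] N // Equivariant σ ρ φ}, LinearMap.range φ.1

/-- The subspace of elements fixed by the group functor `G`. -/
def GroupRep.fixed (ρ : GroupRep G M) : Submodule F M where
  carrier := {m | ∀ (R : Type u) [CommRing R] [Algebra F R] (g : G.pts R),
    ρ.act R g (1 ⊗ₜ m) = 1 ⊗ₜ m}
  zero_mem' := by intro R _ _ g; simp
  add_mem' := by intro a b ha hb R _ _ g; simp [TensorProduct.tmul_add, ha R g, hb R g]
  smul_mem' := by
    intro c a ha R _ _ g
    rw [← TensorProduct.smul_tmul, Algebra.smul_def, mul_one, ← mul_one (algebraMap F R c),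
      ← smul_eq_mul, ← TensorProduct.smul_tmul', map_smul, ha R g]

/-- A representation of `G`, seen as a representation of `G × H` through the first projection. -/
def GroupRep.viaFst (ρ : GroupRep G M) : GroupRep (G.prod H) M where
  act R _ _ := (ρ.act R).comp (MonoidHom.fst (G.pts R) (H.pts R))
  natural φ g x := ρ.natural φ g.1 x

/-- A representation of `G`, seen as a representation of `H × G` through the second projection. -/
def GroupRep.viaSnd (ρ : GroupRep G M) : GroupRep (H.prod G) M where
  act R _ _ := (ρ.act R).comp (MonoidHom.snd (H.pts R) (G.pts R))
  natural φ g x := ρ.natural φ g.2 x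

/-- The tensor product of two representations. -/
def GroupRep.tensor (ρ : GroupRep G M) (σ : GroupRep G N) : GroupRep G (M ⊗[F] N) where
  act R _ _ :=
    { toFun := fun g =>
        (TensorProduct.AlgebraTensorModule.distribBaseChange F R M N).symm.toLinearMap ∘ₗ
          TensorProduct.map (ρ.act R g) (σ.act R g) ∘ₗ
          (TensorProduct.AlgebraTensorModule.distribBaseChange F R M N).toLinearMap
      map_one' := by
        ext; simp
      map_mul' := by
        intro g h
        ext; simp [TensorProduct.map_mul] }
  natural {R S} _ _ _ _ φ g x := by
    have key : ∀ (y : R ⊗[F] M) (z : R ⊗[F] N),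
        (TensorProduct.AlgebraTensorModule.distribBaseChange F S M N).symm
          (φ.toLinearMap.rTensor M y ⊗ₜ φ.toLinearMap.rTensor N z) =
        φ.toLinearMap.rTensor (M ⊗[F] N)
          ((TensorProduct.AlgebraTensorModule.distribBaseChange F R M N).symm (y ⊗ₜ z)) := by
      intro y z
      induction y with
      | zero => simp
      | add a b ha hb => simp [TensorProduct.add_tmul, ha, hb]
      | tmul r m =>
        induction z with
        | zero => simp
        | add a b ha hb => rw [map_add, TensorProduct.tmul_add, TensorProduct.tmul_add, map_add, map_add, map_add, ha, hb]
        | tmul s n => simp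
    induction x with
    | zero => simp
    | add a b ha hb => simp only [map_add, ha, hb]
    | tmul r y =>
      induction y with
      | zero => simp
      | add a b ha hb => simp only [TensorProduct.tmul_add, map_add, ha, hb]
      | tmul m n =>
        have h1 := ρ.natural φ g (r ⊗ₜ m)
        have h2 := σ.natural φ g (1 ⊗ₜ n)
        simp only [LinearMap.rTensor_tmul, AlgHom.toLinearMap_apply, map_one] at h1 h2
        simp only [LinearMap.rTensor_tmul, AlgHom.toLinearMap_apply, MonoidHom.coe_mk,
          OneHom.coe_mk, LinearMap.comp_apply, LinearEquiv.coe_coe,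
          TensorProduct.AlgebraTensorModule.distribBaseChange_tmul, TensorProduct.map_tmul, h1, h2]
        exact key _ _

end General

/-! ### The standard modules for `SL₂` -/

/-- The Lie algebra `𝔰𝔩₂` of trace zero `2 × 2` matrices. -/
def sl2 (F : Type u) [Field F] : Type u := LieAlgebra.SpecialLinear.sl (Fin 2) F

instance (F : Type u) [Field F] : LieRing (sl2 F) :=
  inferInstanceAs (LieRing (LieAlgebra.SpecialLinear.sl (Fin 2) F))

instance (F : Type u) [Field F] : LieAlgebra F (sl2 F) :=
  inferInstanceAs (LieAlgebra F (LieAlgebra.SpecialLinear.sl (Fin 2) F))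

/-- The matrix underlying an element of `𝔰𝔩₂`. -/
def sl2.val {F : Type u} [Field F] : sl2 F →ₗ[F] Matrix (Fin 2) (Fin 2) F where
  toFun X := Subtype.val X
  map_add' _ _ := rfl
  map_smul' _ _ := rfl

theorem sl2.ext {F : Type u} [Field F] {X Y : sl2 F} (h : X.val = Y.val) : X = Y :=
  Subtype.ext h

theorem sl2.val_trace {F : Type u} [Field F] (X : sl2 F) : X.val.trace = 0 := X.2

theorem sl2.val_lie {F : Type u} [Field F] (X Y : sl2 F) :
    (⁅X, Y⁆ : sl2 F).val = X.val * Y.val - Y.val * X.val := rfl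

/-- The natural two-dimensional space. -/
abbrev nat2 (F : Type u) : Type u := Fin 2 → F

section Standard

variable (F : Type u) [Field F]

/-- A trace zero matrix as an element of `𝔰𝔩₂`. -/
def sl2.mk {F : Type u} [Field F] (X : Matrix (Fin 2) (Fin 2) F) (h : X.trace = 0) : sl2 F :=
  ⟨X, h⟩

@[simp] theorem sl2.val_mk {F : Type u} [Field F] (X : Matrix (Fin 2) (Fin 2) F)
    (h : X.trace = 0) : (sl2.mk X h).val = X := rfl

def sl2.elE : sl2 F := sl2.mk !![0, 1; 0, 0] (by simp [Matrix.trace_fin_two])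
def sl2.elF : sl2 F := sl2.mk !![0, 0; 1, 0] (by simp [Matrix.trace_fin_two])
def sl2.elH : sl2 F := sl2.mk !![1, 0; 0, -1] (by simp [Matrix.trace_fin_two])

/-- The entry of a trace zero matrix at a given place. -/
def sl2.entry (i j : Fin 2) : sl2 F →ₗ[F] F where
  toFun X := X.val i j
  map_add' _ _ := rfl
  map_smul' _ _ := rfl

/-- The embedding of `R ⊗ 𝔰𝔩₂(F)` in the `2 × 2` matrices over `R`, `r ⊗ X ↦ r X`; its image
is `𝔰𝔩₂(R)`. -/
def sl2.toMatrix (R : Type u) [CommRing R] [Algebra F R] :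
    R ⊗[F] sl2 F →ₗ[R] Matrix (Fin 2) (Fin 2) R :=
  LinearMap.liftBaseChange R
    { toFun := fun X => X.val.map (algebraMap F R)
      map_add' := by intro X Y; ext; simp
      map_smul' := by intro c X; ext i j; simp [Algebra.smul_def c (_ : R)] }

/-- The inverse of `sl2.toMatrix` on trace zero matrices. -/
def sl2.ofMatrix (R : Type u) [CommRing R] [Algebra F R] :
    Matrix (Fin 2) (Fin 2) R →ₗ[R] R ⊗[F] sl2 F where
  toFun X := X 0 1 ⊗ₜ sl2.elE F + X 1 0 ⊗ₜ sl2.elF F + X 0 0 ⊗ₜ sl2.elH F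
  map_add' X Y := by simp only [Matrix.add_apply, TensorProduct.add_tmul]; abel
  map_smul' c X := by
    simp only [Matrix.smul_apply, RingHom.id_apply, smul_add, TensorProduct.smul_tmul']

theorem sl2.toMatrix_trace (R : Type u) [CommRing R] [Algebra F R] (x : R ⊗[F] sl2 F) :
    (sl2.toMatrix F R x).trace = 0 := by
  induction x with
  | zero => simp
  | add a b ha hb => simp [ha, hb]
  | tmul r X =>
    have hX := X.val_trace
    rw [Matrix.trace_fin_two] at hX
    simp [sl2.toMatrix, Matrix.trace_fin_two, ← map_add, hX]

theorem sl2.toMatrix_ofMatrix (R : Type u) [CommRing R] [Algebra F R]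
    (X : Matrix (Fin 2) (Fin 2) R) (hX : X.trace = 0) :
    sl2.toMatrix F R (sl2.ofMatrix F R X) = X := by
  rw [Matrix.trace_fin_two] at hX
  have h : X 1 1 = - X 0 0 := by linear_combination hX
  ext i j
  fin_cases i <;> fin_cases j <;>
    simp [sl2.toMatrix, sl2.ofMatrix, sl2.elE, sl2.elF, sl2.elH, h]

theorem sl2.ofMatrix_toMatrix (R : Type u) [CommRing R] [Algebra F R] (x : R ⊗[F] sl2 F) :
    sl2.ofMatrix F R (sl2.toMatrix F R x) = x := by
  induction x with
  | zero => simp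
  | add a b ha hb => simp [ha, hb]
  | tmul r X =>
    have hX := X.val_trace
    rw [Matrix.trace_fin_two] at hX
    have h : X.val 1 1 = - X.val 0 0 := by linear_combination hX
    have e : X = X.val 0 1 • sl2.elE F + X.val 1 0 • sl2.elF F + X.val 0 0 • sl2.elH F := by
      apply sl2.ext
      ext i j
      fin_cases i <;> fin_cases j <;> simp [sl2.elE, sl2.elF, sl2.elH, h]
    conv_rhs => rw [e]
    simp only [sl2.toMatrix, sl2.ofMatrix, LinearMap.coe_mk, AddHom.coe_mk,
      LinearMap.liftBaseChange_tmul, Matrix.smul_apply, Matrix.map_apply, TensorProduct.tmul_add,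
      TensorProduct.tmul_smul, TensorProduct.smul_tmul', Algebra.smul_def (_ : F) r, smul_eq_mul,
      mul_comm]

theorem sl2.trace_conj (R : Type u) [CommRing R] [Algebra F R]
    (g : Matrix.SpecialLinearGroup (Fin 2) R) (x : R ⊗[F] sl2 F) :
    ((g : Matrix (Fin 2) (Fin 2) R) * (sl2.toMatrix F R x *
      ((g⁻¹ : Matrix.SpecialLinearGroup (Fin 2) R) : Matrix (Fin 2) (Fin 2) R))).trace = 0 := by
  rw [Matrix.trace_mul_comm, Matrix.mul_assoc, ← Matrix.SpecialLinearGroup.coe_mul,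
    inv_mul_cancel, Matrix.SpecialLinearGroup.coe_one, Matrix.mul_one, sl2.toMatrix_trace]

/-- The action of `SL₂(R)` on `R ⊗ 𝔰𝔩₂(F) = 𝔰𝔩₂(R)` by conjugation. -/
def adjAct (R : Type u) [CommRing R] [Algebra F R] :
    Matrix.SpecialLinearGroup (Fin 2) R →* Module.End R (R ⊗[F] sl2 F) where
  toFun g :=
    sl2.ofMatrix F R ∘ₗ LinearMap.mulLeft R (g : Matrix (Fin 2) (Fin 2) R) ∘ₗ
      LinearMap.mulRight R ((g⁻¹ : Matrix.SpecialLinearGroup (Fin 2) R) :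
        Matrix (Fin 2) (Fin 2) R) ∘ₗ sl2.toMatrix F R
  map_one' := by
    refine LinearMap.ext fun x => ?_
    simp [sl2.ofMatrix_toMatrix]
  map_mul' g h := by
    refine LinearMap.ext fun x => ?_
    simp only [LinearMap.comp_apply, LinearMap.mulLeft_apply, LinearMap.mulRight_apply,
      Module.End.mul_apply]
    rw [sl2.toMatrix_ofMatrix F R _ (sl2.trace_conj F R h x), mul_inv_rev,
      Matrix.SpecialLinearGroup.coe_mul, Matrix.SpecialLinearGroup.coe_mul]
    simp only [Matrix.mul_assoc]

theorem toMatrix_adjAct (R : Type u) [CommRing R] [Algebra F R]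
    (g : Matrix.SpecialLinearGroup (Fin 2) R) (x : R ⊗[F] sl2 F) :
    sl2.toMatrix F R (adjAct F R g x) =
      (g : Matrix (Fin 2) (Fin 2) R) * (sl2.toMatrix F R x *
        ((g⁻¹ : Matrix.SpecialLinearGroup (Fin 2) R) : Matrix (Fin 2) (Fin 2) R)) :=
  sl2.toMatrix_ofMatrix F R _ (sl2.trace_conj F R g x)

theorem sl2.toMatrix_map {R S : Type u} [CommRing R] [Algebra F R] [CommRing S] [Algebra F S]
    (φ : R →ₐ[F] S) (y : R ⊗[F] sl2 F) :
    sl2.toMatrix F S (φ.toLinearMap.rTensor _ y) = (sl2.toMatrix F R y).map φ := by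
  induction y with
  | zero => ext; simp
  | add a b ha hb => rw [map_add, map_add, ha, hb, map_add]; ext; simp
  | tmul r X => ext; simp [sl2.toMatrix]

theorem adjAct_natural {R S : Type u} [CommRing R] [Algebra F R] [CommRing S] [Algebra F S]
    (φ : R →ₐ[F] S) (g : Matrix.SpecialLinearGroup (Fin 2) R) (x : R ⊗[F] sl2 F) :
    adjAct F S (Matrix.SpecialLinearGroup.map (φ : R →+* S) g) (φ.toLinearMap.rTensor _ x) =
      φ.toLinearMap.rTensor _ (adjAct F R g x) := by
  rw [← sl2.ofMatrix_toMatrix F S (φ.toLinearMap.rTensor _ (adjAct F R g x)),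
    ← sl2.ofMatrix_toMatrix F S (adjAct F S _ _), sl2.toMatrix_map, toMatrix_adjAct,
    toMatrix_adjAct, sl2.toMatrix_map, ← map_inv, Matrix.map_mul, Matrix.map_mul]
  rfl

/-- The adjoint representation of `SL₂` on `𝔰𝔩₂`. -/
def adjRep : GroupRep (SL2 F) (sl2 F) where
  act R _ _ := adjAct F R
  natural φ g x := adjAct_natural F φ g x

/-- The action of `SL₂(R)` on `R ⊗ F² = R²`. -/
def natAct (R : Type u) [CommRing R] [Algebra F R] :
    Matrix.SpecialLinearGroup (Fin 2) R →* Module.End R (R ⊗[F] nat2 F) where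
  toFun g :=
    (TensorProduct.piScalarRight F R R (Fin 2)).symm.toLinearMap ∘ₗ
      Matrix.toLin' (g : Matrix (Fin 2) (Fin 2) R) ∘ₗ
      (TensorProduct.piScalarRight F R R (Fin 2)).toLinearMap
  map_one' := by
    refine LinearMap.ext fun x => ?_
    rw [Matrix.SpecialLinearGroup.coe_one, Matrix.toLin'_one]
    exact (TensorProduct.piScalarRight F R R (Fin 2)).symm_apply_apply x
  map_mul' g h := by
    refine LinearMap.ext fun x => ?_
    rw [Matrix.SpecialLinearGroup.coe_mul, Matrix.toLin'_mul]
    simp only [LinearMap.comp_apply, Module.End.mul_apply, LinearEquiv.coe_coe,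
      LinearEquiv.apply_symm_apply]

theorem piScalarRight_natAct (R : Type u) [CommRing R] [Algebra F R]
    (g : Matrix.SpecialLinearGroup (Fin 2) R) (x : R ⊗[F] nat2 F) :
    TensorProduct.piScalarRight F R R (Fin 2) (natAct F R g x) =
      (g : Matrix (Fin 2) (Fin 2) R).mulVec (TensorProduct.piScalarRight F R R (Fin 2) x) :=
  (TensorProduct.piScalarRight F R R (Fin 2)).apply_symm_apply _

theorem piScalarRight_map {R S : Type u} [CommRing R] [Algebra F R] [CommRing S] [Algebra F S]
    (φ : R →ₐ[F] S) (y : R ⊗[F] nat2 F) :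
    TensorProduct.piScalarRight F S S (Fin 2) (φ.toLinearMap.rTensor _ y) =
      φ ∘ TensorProduct.piScalarRight F R R (Fin 2) y := by
  induction y with
  | zero => ext; simp
  | add a b ha hb => rw [map_add, map_add, ha, hb, map_add]; ext; simp
  | tmul r X => ext; simp [TensorProduct.piScalarRight_apply]

theorem natAct_natural {R S : Type u} [CommRing R] [Algebra F R] [CommRing S] [Algebra F S]
    (φ : R →ₐ[F] S) (g : Matrix.SpecialLinearGroup (Fin 2) R) (x : R ⊗[F] nat2 F) :
    natAct F S (Matrix.SpecialLinearGroup.map (φ : R →+* S) g) (φ.toLinearMap.rTensor _ x) =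
      φ.toLinearMap.rTensor _ (natAct F R g x) := by
  apply (TensorProduct.piScalarRight F S S (Fin 2)).injective
  rw [piScalarRight_map, piScalarRight_natAct, piScalarRight_natAct, piScalarRight_map]
  ext i
  exact (RingHom.map_mulVec (φ : R →+* S) _ _ i).symm

/-- The natural representation of `SL₂` on the two-dimensional space. -/
def natRep : GroupRep (SL2 F) (nat2 F) where
  act R _ _ := natAct F R
  natural φ g x := natAct_natural F φ g x

/-- `SL₂ × SL₂`. -/
abbrev SL2SL2 : GroupFunctor F := (SL2 F).prod (SL2 F)

/-- The adjoint module of the first factor of `SL₂ × SL₂`. -/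
def adjRep₁ : GroupRep (SL2SL2 F) (sl2 F) := (adjRep F).viaFst
/-- The adjoint module of the second factor of `SL₂ × SL₂`. -/
def adjRep₀ : GroupRep (SL2SL2 F) (sl2 F) := (adjRep F).viaSnd
/-- The natural module of the first factor of `SL₂ × SL₂`. -/
def natRep₁ : GroupRep (SL2SL2 F) (nat2 F) := (natRep F).viaFst
/-- The natural module of the second factor of `SL₂ × SL₂`. -/
def natRep₀ : GroupRep (SL2SL2 F) (nat2 F) := (natRep F).viaSnd
/-- The tensor product of the natural modules of the two factors of `SL₂ × SL₂`. -/
def natRep₁₀ : GroupRep (SL2SL2 F) (nat2 F ⊗[F] nat2 F) := (natRep₁ F).tensor (natRep₀ F)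

/-- The point `1 + ε X` of `SL₂(F[ε])`, for `X` in the Lie algebra `𝔰𝔩₂` of `SL₂`. -/
def epsPoint {F : Type u} [Field F] (X : sl2 F) :
    Matrix.SpecialLinearGroup (Fin 2) (DualNumber F) :=
  ⟨1 + X.val.map TrivSqZeroExt.inr, by
    have hX := X.val_trace
    rw [Matrix.trace_fin_two] at hX
    have h : X.val 1 1 = - X.val 0 0 := by linear_combination hX
    rw [Matrix.det_fin_two]
    apply TrivSqZeroExt.ext <;> simp [h]⟩

end Standard

/-! ### Inner and short structures -/

section Structures

variable {F : Type u} [Field F] {L : Type v} [LieRing L] [LieAlgebra F L]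

/-- For `t ∈ G(R)` and a linear functional `ev` on `R`, the map `l ↦ (ev ⊗ id) (t · (1 ⊗ l))`. -/
def GStructure.coefficient {G : GroupFunctor F} (Φ : GStructure G L) (R : Type u) [CommRing R]
    [Algebra F R] (ev : R →ₗ[F] F) (t : G.pts R) : L →ₗ[F] L :=
  (TensorProduct.lid F L).toLinearMap ∘ₗ LinearMap.rTensor L ev ∘ₗ
    (Φ.act R t).restrictScalars F ∘ₗ TensorProduct.mk F R L 1

/-- The differential of a `G`-structure at the tangent vector given by a point `t` of `G(F[ε])`
(lying over the identity): the coefficient of `ε` in `t · (1 ⊗ l)`, that is,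
`t · (1 ⊗ l) = 1 ⊗ l + ε ⊗ (differential t l)`. -/
def GStructure.differential {G : GroupFunctor F} (Φ : GStructure G L) (t : G.pts (DualNumber F)) :
    L →ₗ[F] L :=
  Φ.coefficient (DualNumber F) (TrivSqZeroExt.sndHom F F) t

/-- The `SL₂`-structure `Ψ` is inner, through the monomorphism `ι : 𝔰𝔩₂ → L`:
`ad ∘ ι = dΨ`. -/
def IsInnerSL2 (Ψ : GStructure (SL2 F) L) (ι : sl2 F →ₗ⁅F⁆ L) : Prop :=
  Function.Injective ι ∧ ∀ (X : sl2 F) (l : L), ⁅ι X, l⁆ = Ψ.differential (epsPoint X) l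

/-- The `(SL₂ × SL₂)`-structure `Φ` is inner, through the monomorphism
`ι : 𝔰𝔩₂ × 𝔰𝔩₂ → L`: `ad ∘ ι = dΦ`. -/
def IsInnerSL2SL2 (Φ : GStructure (SL2SL2 F) L) (ι : sl2 F × sl2 F →ₗ⁅F⁆ L) : Prop :=
  Function.Injective ι ∧ ∀ (X : sl2 F × sl2 F) (l : L),
    ⁅ι X, l⁆ = Φ.differential (epsPoint X.1, epsPoint X.2) l

/-- The restriction `Φ ∘ Δ` of an `(SL₂ × SL₂)`-structure to the diagonal. -/
def GStructure.diag (Φ : GStructure (SL2SL2 F) L) : GStructure (SL2 F) L where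
  act R _ _ := (Φ.act R).comp
    ((MonoidHom.id ((SL2 F).pts R)).prod (MonoidHom.id ((SL2 F).pts R)))
  natural φ g x := Φ.natural φ (g, g) x
  map_lie R _ _ g x y := Φ.map_lie R (g, g) x y

/-- The diagonal embedding `𝔰𝔩₂ → 𝔰𝔩₂ × 𝔰𝔩₂`. -/
def diagLie (F : Type u) [Field F] : sl2 F →ₗ⁅F⁆ sl2 F × sl2 F where
  toFun X := (X, X)
  map_add' _ _ := rfl
  map_smul' _ _ := rfl
  map_lie' := rfl

/-- A decomposition `L = (𝔰𝔩(V) ⊗ J) ⊕ (V ⊗ T) ⊕ D` of `L`, as a module for `SL₂` through `Ψ`,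
into copies of the adjoint, the natural and the trivial module. -/
structure ShortDecomposition (Ψ : GStructure (SL2 F) L) (J T D : Type*)
    [AddCommGroup J] [Module F J] [AddCommGroup T] [Module F T] [AddCommGroup D] [Module F D] where
  equiv : ((sl2 F ⊗[F] J) × (nat2 F ⊗[F] T) × D) ≃ₗ[F] L
  adj_equivariant : ∀ a : J, Equivariant (adjRep F) Ψ.toGroupRep
    (equiv.toLinearMap ∘ₗ LinearMap.inl F _ _ ∘ₗ (TensorProduct.mk F (sl2 F) J).flip a)
  nat_equivariant : ∀ x : T, Equivariant (natRep F) Ψ.toGroupRep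
    (equiv.toLinearMap ∘ₗ LinearMap.inr F _ _ ∘ₗ LinearMap.inl F _ _ ∘ₗ
      (TensorProduct.mk F (nat2 F) T).flip x)
  triv_fixed : ∀ d : D, equiv (0, 0, d) ∈ Ψ.fixed

/-- The `SL₂`-structure `Ψ` is short. -/
def IsShortSL2 (Ψ : GStructure (SL2 F) L) : Prop :=
  ∃ (J T D : Type v) (_ : AddCommGroup J) (_ : Module F J) (_ : AddCommGroup T) (_ : Module F T)
    (_ : AddCommGroup D) (_ : Module F D), Nonempty (ShortDecomposition Ψ J T D)

/-- A decomposition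
`L = (𝔰𝔩(V₁) ⊗ J₁) ⊕ (𝔰𝔩(V₀) ⊗ J₀) ⊕ ((V₁ ⊗ V₀) ⊗ Jh) ⊕ (V₁ ⊗ T₁) ⊕ (V₀ ⊗ T₀) ⊕ S` of `L`, as a
module for `SL₂ × SL₂` through `Φ`. -/
structure ShortDecomposition₂ (Φ : GStructure (SL2SL2 F) L) (J₁ J₀ Jh T₁ T₀ S : Type*)
    [AddCommGroup J₁] [Module F J₁] [AddCommGroup J₀] [Module F J₀]
    [AddCommGroup Jh] [Module F Jh] [AddCommGroup T₁] [Module F T₁]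
    [AddCommGroup T₀] [Module F T₀] [AddCommGroup S] [Module F S] where
  equiv : ((sl2 F ⊗[F] J₁) × (sl2 F ⊗[F] J₀) × ((nat2 F ⊗[F] nat2 F) ⊗[F] Jh) ×
    (nat2 F ⊗[F] T₁) × (nat2 F ⊗[F] T₀) × S) ≃ₗ[F] L
  adj₁_equivariant : ∀ a : J₁, Equivariant (adjRep₁ F) Φ.toGroupRep
    (equiv.toLinearMap ∘ₗ LinearMap.inl F _ _ ∘ₗ (TensorProduct.mk F (sl2 F) J₁).flip a)
  adj₀_equivariant : ∀ a : J₀, Equivariant (adjRep₀ F) Φ.toGroupRep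
    (equiv.toLinearMap ∘ₗ LinearMap.inr F _ _ ∘ₗ LinearMap.inl F _ _ ∘ₗ
      (TensorProduct.mk F (sl2 F) J₀).flip a)
  nat₁₀_equivariant : ∀ a : Jh, Equivariant (natRep₁₀ F) Φ.toGroupRep
    (equiv.toLinearMap ∘ₗ LinearMap.inr F _ _ ∘ₗ LinearMap.inr F _ _ ∘ₗ LinearMap.inl F _ _ ∘ₗ
      (TensorProduct.mk F (nat2 F ⊗[F] nat2 F) Jh).flip a)
  nat₁_equivariant : ∀ x : T₁, Equivariant (natRep₁ F) Φ.toGroupRep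
    (equiv.toLinearMap ∘ₗ LinearMap.inr F _ _ ∘ₗ LinearMap.inr F _ _ ∘ₗ LinearMap.inr F _ _ ∘ₗ
      LinearMap.inl F _ _ ∘ₗ (TensorProduct.mk F (nat2 F) T₁).flip x)
  nat₀_equivariant : ∀ x : T₀, Equivariant (natRep₀ F) Φ.toGroupRep
    (equiv.toLinearMap ∘ₗ LinearMap.inr F _ _ ∘ₗ LinearMap.inr F _ _ ∘ₗ LinearMap.inr F _ _ ∘ₗ
      LinearMap.inr F _ _ ∘ₗ LinearMap.inl F _ _ ∘ₗ (TensorProduct.mk F (nat2 F) T₀).flip x)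
  triv_fixed : ∀ s : S, equiv (0, 0, 0, 0, 0, s) ∈ Φ.fixed

/-- The `(SL₂ × SL₂)`-structure `Φ` is short. -/
def IsShortSL2SL2 (Φ : GStructure (SL2SL2 F) L) : Prop :=
  ∃ (J₁ J₀ Jh T₁ T₀ S : Type v) (_ : AddCommGroup J₁) (_ : Module F J₁)
    (_ : AddCommGroup J₀) (_ : Module F J₀) (_ : AddCommGroup Jh) (_ : Module F Jh)
    (_ : AddCommGroup T₁) (_ : Module F T₁) (_ : AddCommGroup T₀) (_ : Module F T₀)
    (_ : AddCommGroup S) (_ : Module F S),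
    Nonempty (ShortDecomposition₂ Φ J₁ J₀ Jh T₁ T₀ S)

end Structures

/-! ### `J`-ternary algebras -/

/-- `(J, T)` is a `J`-ternary algebra: `J` is a unital Jordan algebra with product `mul` and unit
`one`, `T` is a unital special Jordan module for `J` with action `bul`, `ang : T × T → J` is
skew-symmetric, and the axioms relating these and the triple product `trip` of `T` hold. -/
structure IsJTernary {F : Type*} [Field F] {J T : Type*} [AddCommGroup J] [Module F J]
    [AddCommGroup T] [Module F T] (mul : J →ₗ[F] J →ₗ[F] J) (one : J) (bul : J →ₗ[F] T →ₗ[F] T)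
    (ang : T →ₗ[F] T →ₗ[F] J) (trip : T →ₗ[F] T →ₗ[F] T →ₗ[F] T) : Prop where
  mul_comm : ∀ a b, mul a b = mul b a
  one_mul : ∀ a, mul one a = a
  jordan : ∀ a b, mul (mul a b) (mul a a) = mul a (mul b (mul a a))
  one_bul : ∀ x, bul one x = x
  special : ∀ a b x, bul (mul a b) x = (2⁻¹ : F) • (bul a (bul b x) + bul b (bul a x))
  ang_skew : ∀ x y, ang x y = -ang y x
  jt1 : ∀ a x y, mul a (ang x y) = (2⁻¹ : F) • (ang (bul a x) y + ang x (bul a y))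
  jt2 : ∀ a x y z, bul a (trip x y z) =
    trip (bul a x) y z - trip x (bul a y) z + trip x y (bul a z)
  jt3 : ∀ x y z, trip x y z = trip z y x - bul (ang x z) y
  jt4 : ∀ x y z, trip x y z = trip y x z + bul (ang x y) z
  jt5 : ∀ x y z w, ang (trip x y z) w + ang z (trip x y w) = ang x (bul (ang z w) y)
  jt6 : ∀ x y z w v, trip x y (trip z w v) =
    trip (trip x y z) w v + trip z (trip y x w) v + trip z w (trip x y v)

/-! ### The coordinate maps of a short `SL₂`-structure -/

/-- The fixed skew-symmetric form `(u | v) = u₀ v₁ - u₁ v₀` on the natural module. -/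
def form {F : Type u} [Field F] (u v : nat2 F) : F := u 0 * v 1 - u 1 * v 0

/-- `γ_{u,v} ∈ 𝔰𝔩(V)`, the map `w ↦ (u | w) v + (v | w) u`. -/
def gam {F : Type u} [Field F] (u v : nat2 F) : sl2 F :=
  sl2.mk (Matrix.vecMulVec v ![-u 1, u 0] + Matrix.vecMulVec u ![-v 1, v 0]) (by
    simp [Matrix.trace_fin_two]; ring)

theorem gam_mulVec {F : Type u} [Field F] (u v z : nat2 F) :
    (gam u v).val.mulVec z = form u z • v + form v z • u := by
  ext i
  fin_cases i <;>
    simp [gam, form, Matrix.mulVec, dotProduct,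
      Fin.sum_univ_two] <;> ring

namespace ShortDecomposition

variable {F : Type u} [Field F] {L : Type v} [LieRing L] [LieAlgebra F L]
variable {Ψ : GStructure (SL2 F) L} {J T D : Type*}
  [AddCommGroup J] [Module F J] [AddCommGroup T] [Module F T] [AddCommGroup D] [Module F D]

/-- `f, a ↦ f ⊗ a`, as an element of `L`. -/
def adj (dec : ShortDecomposition Ψ J T D) : sl2 F →ₗ[F] J →ₗ[F] L :=
  (TensorProduct.mk F (sl2 F) J).compr₂ (dec.equiv.toLinearMap ∘ₗ LinearMap.inl F _ _)

/-- `u, x ↦ u ⊗ x`, as an element of `L`. -/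
def nat (dec : ShortDecomposition Ψ J T D) : nat2 F →ₗ[F] T →ₗ[F] L :=
  (TensorProduct.mk F (nat2 F) T).compr₂
    (dec.equiv.toLinearMap ∘ₗ LinearMap.inr F _ _ ∘ₗ LinearMap.inl F _ _)

/-- The inclusion of `D` in `L`. -/
def triv (dec : ShortDecomposition Ψ J T D) : D →ₗ[F] L :=
  dec.equiv.toLinearMap ∘ₗ LinearMap.inr F _ _ ∘ₗ LinearMap.inr F _ _

/-- The coordinate in `J`: the `𝔰𝔩(V) ⊗ J` component of an element of `L` is
`H ⊗ projJ + (an element of E ⊗ J + F ⊗ J)`. -/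
def projJ (dec : ShortDecomposition Ψ J T D) : L →ₗ[F] J :=
  (TensorProduct.lid F J).toLinearMap ∘ₗ LinearMap.rTensor J (sl2.entry F 0 0) ∘ₗ
    LinearMap.fst F _ _ ∘ₗ dec.equiv.symm.toLinearMap

/-- The coordinate in `T`: the `V ⊗ T` component of an element of `L` is
`e₀ ⊗ projT + (an element of e₁ ⊗ T)`. -/
def projT (dec : ShortDecomposition Ψ J T D) : L →ₗ[F] T :=
  (TensorProduct.lid F T).toLinearMap ∘ₗ LinearMap.rTensor T (LinearMap.proj 0) ∘ₗ
    LinearMap.fst F _ _ ∘ₗ LinearMap.snd F _ _ ∘ₗ dec.equiv.symm.toLinearMap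

/-- The component in `D`. -/
def projD (dec : ShortDecomposition Ψ J T D) : L →ₗ[F] D :=
  LinearMap.snd F _ _ ∘ₗ LinearMap.snd F _ _ ∘ₗ dec.equiv.symm.toLinearMap

/-- The distinguished element `1 ∈ J`, read off from `ι(f) = f ⊗ 1` at `f = H`. -/
def one (dec : ShortDecomposition Ψ J T D) (ι : sl2 F →ₗ⁅F⁆ L) : J := dec.projJ (ι (sl2.elH F))

/-- The product `a · b` of `J`, read off from
`[f ⊗ a, g ⊗ b] = [f, g] ⊗ (a · b) + 2 tr(fg) D_{a,b}` at `f = E`, `g = F`. -/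
def mul (dec : ShortDecomposition Ψ J T D) : J →ₗ[F] J →ₗ[F] J :=
  LinearMap.mk₂ F (fun a b => dec.projJ ⁅dec.adj (sl2.elE F) a, dec.adj (sl2.elF F) b⁆)
    (by simp) (by simp) (by simp) (by simp)

/-- The element `D_{a,b}` of `D`, read off from
`[f ⊗ a, g ⊗ b] = [f, g] ⊗ (a · b) + 2 tr(fg) D_{a,b}` at `f = E`, `g = F`. -/
def dJ (dec : ShortDecomposition Ψ J T D) : J →ₗ[F] J →ₗ[F] D :=
  LinearMap.mk₂ F
    (fun a b => (2⁻¹ : F) • dec.projD ⁅dec.adj (sl2.elE F) a, dec.adj (sl2.elF F) b⁆)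
    (by intros; simp only [map_add, add_lie, smul_add])
    (by intros; simp only [map_smul, smul_lie, smul_comm (2⁻¹ : F)])
    (by intros; simp only [map_add, lie_add, smul_add])
    (by intros; simp only [map_smul, lie_smul, smul_comm (2⁻¹ : F)])

/-- The action `a • x` of `J` on `T`, read off from `[f ⊗ a, u ⊗ x] = f(u) ⊗ (a • x)` at `f = H`,
`u = e₀`. -/
def bul (dec : ShortDecomposition Ψ J T D) : J →ₗ[F] T →ₗ[F] T :=
  LinearMap.mk₂ F (fun a x => dec.projT ⁅dec.adj (sl2.elH F) a, dec.nat (Pi.single 0 1) x⁆)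
    (by simp) (by simp) (by simp) (by simp)

/-- The map `⟨x | y⟩`, read off from
`[u ⊗ x, v ⊗ y] = γ_{u,v} ⊗ ⟨x | y⟩ + (u | v) d_{x,y}` at `u = e₀`, `v = e₁`, where `γ_{u,v} = -H`
and `(u | v) = 1`. -/
def ang (dec : ShortDecomposition Ψ J T D) : T →ₗ[F] T →ₗ[F] J :=
  LinearMap.mk₂ F
    (fun x y => -dec.projJ ⁅dec.nat (Pi.single 0 1) x, dec.nat (Pi.single 1 1) y⁆)
    (by intros; simp; abel) (by simp) (by intros; simp; abel) (by simp)

/-- The element `d_{x,y}` of `D`, read off from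
`[u ⊗ x, v ⊗ y] = γ_{u,v} ⊗ ⟨x | y⟩ + (u | v) d_{x,y}` at `u = e₀`, `v = e₁`. -/
def dT (dec : ShortDecomposition Ψ J T D) : T →ₗ[F] T →ₗ[F] D :=
  LinearMap.mk₂ F (fun x y => dec.projD ⁅dec.nat (Pi.single 0 1) x, dec.nat (Pi.single 1 1) y⁆)
    (by simp) (by simp) (by simp) (by simp)

/-- The action of `D` on `J`, read off from `[d, f ⊗ a] = f ⊗ d(a)` at `f = H`. -/
def actJ (dec : ShortDecomposition Ψ J T D) : D →ₗ[F] J →ₗ[F] J :=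
  LinearMap.mk₂ F (fun d a => dec.projJ ⁅dec.triv d, dec.adj (sl2.elH F) a⁆)
    (by simp) (by simp) (by simp) (by simp)

/-- The action of `D` on `T`, read off from `[d, u ⊗ x] = u ⊗ d(x)` at `u = e₀`. -/
def actT (dec : ShortDecomposition Ψ J T D) : D →ₗ[F] T →ₗ[F] T :=
  LinearMap.mk₂ F (fun d x => dec.projT ⁅dec.triv d, dec.nat (Pi.single 0 1) x⁆)
    (by simp) (by simp) (by simp) (by simp)

/-- The triple product `{x, y, z} = ½ (-d_{x,y}(z) + ⟨x | y⟩ • z)` of `T`. -/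
def trip (dec : ShortDecomposition Ψ J T D) : T →ₗ[F] T →ₗ[F] T →ₗ[F] T :=
  LinearMap.mk₂ F
    (fun x y => (2⁻¹ : F) • (-dec.actT (dec.dT x y) + dec.bul (dec.ang x y)))
    (by intros; simp only [map_add, LinearMap.add_apply, ← smul_add]; congr 1; abel)
    (by
      intros
      simp only [map_smul, LinearMap.smul_apply, smul_comm _ (2⁻¹ : F), smul_add, smul_neg])
    (by intros; simp only [map_add, ← smul_add]; congr 1; abel)
    (by intros; simp only [map_smul, smul_comm _ (2⁻¹ : F), smul_add, smul_neg])

/-- The maps `mul`, `dJ`, `bul`, `ang`, `dT`, `actJ`, `actT`, `one` describe `ι` and the bracket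
of `L`, and `(J, T)` is a `J`-ternary algebra. -/
structure IsCoordinatization (dec : ShortDecomposition Ψ J T D) (ι : sl2 F →ₗ⁅F⁆ L) : Prop where
  inner : ∀ f, ι f = dec.adj f (dec.one ι)
  adj_adj : ∀ f g a b, ⁅dec.adj f a, dec.adj g b⁆ =
    dec.adj ⁅f, g⁆ (dec.mul a b) + dec.triv ((2 * (f.val * g.val).trace) • dec.dJ a b)
  adj_nat : ∀ f a u x, ⁅dec.adj f a, dec.nat u x⁆ = dec.nat (f.val.mulVec u) (dec.bul a x)
  nat_nat : ∀ u x v y, ⁅dec.nat u x, dec.nat v y⁆ =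
    dec.adj (gam u v) (dec.ang x y) + dec.triv (form u v • dec.dT x y)
  triv_adj : ∀ d f a, ⁅dec.triv d, dec.adj f a⁆ = dec.adj f (dec.actJ d a)
  triv_nat : ∀ d u x, ⁅dec.triv d, dec.nat u x⁆ = dec.nat u (dec.actT d x)
  jternary : IsJTernary dec.mul (dec.one ι) dec.bul dec.ang dec.trip

/-- The subspace `𝔰𝔩(V) ⊗ A` of `L`, for a subspace `A` of `J`. -/
def adjSub (dec : ShortDecomposition Ψ J T D) (A : Submodule F J) : Submodule F L :=
  Submodule.map₂ dec.adj ⊤ A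

/-- The subspace `V ⊗ X` of `L`, for a subspace `X` of `T`. -/
def natSub (dec : ShortDecomposition Ψ J T D) (X : Submodule F T) : Submodule F L :=
  Submodule.map₂ dec.nat ⊤ X

/-- The subspace `D_{e,A}` of `L`, for `e ∈ J` and a subspace `A` of `J`. -/
def derSub (dec : ShortDecomposition Ψ J T D) (e : J) (A : Submodule F J) : Submodule F L :=
  A.map (dec.triv ∘ₗ dec.dJ e)

/-- The Peirce component `{a ∈ J | e · a = c a}`. -/
def peirceJ (dec : ShortDecomposition Ψ J T D) (e : J) (c : F) : Submodule F J :=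
  LinearMap.ker (dec.mul e - c • LinearMap.id)

/-- The component `{x ∈ T | e • x = c x}`. -/
def peirceT (dec : ShortDecomposition Ψ J T D) (e : J) (c : F) : Submodule F T :=
  LinearMap.ker (dec.bul e - c • LinearMap.id)

end ShortDecomposition

end ShortSL2

end

open ShortSL2

universe u v w

set_option linter.unusedSimpArgs false

noncomputable section

namespace ShortSL2

/-! ### Equivariant maps and exponential actions -/

section General

variable {F : Type u} [Field F] {G H : GroupFunctor F}
variable {M : Type v} [AddCommGroup M] [Module F M] {N : Type w} [AddCommGroup N] [Module F N]

/-! Group actions are handled through 𝔰𝔩₂. A point `1 + r X` of `SL₂(R)` has determinant one, which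
forces `r² X² = 0`; so on the adjoint module, the natural modules and `V₁ ⊗ V₀` it acts as the
exponential of `r X` cut off after degree two (`expAct_adj`, `expAct_nat`, `expAct_nat₁₀`). Over the
dual numbers this shows that `ad ∘ ι` acts on every summand of a decomposition by the standard
action of 𝔰𝔩₂. Over arbitrary `R` it makes elementary matrices act as exponentials of inner
derivations.

Coordinates: `H` has the weights `2, 1, 0, -1, -2`, which are pairwise distinct since 2 and 3 are
invertible. The bracket of two weight vectors therefore lies in a known summand, and applying `E`
and `F` to one such bracket yields all others of the same kind. The axioms of a `J`-ternary algebra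
are then components of Jacobi identities on triples of pure elements. The Jordan identity comes from
the vanishing of the cyclic sum of `D_{a·b,c}`: it gives `3 D_{a²,a} = 0`, and `D_{a²,a}` acts on
`J` as the commutator of the multiplications by `a²` and `a`.

From structures to idempotents: `f ↦ ι(f, 0)` commutes with the diagonal 𝔰𝔩₂, so it has the form `f
↦ f ⊗ e`, and `[E, F] = H` in the first factor reads `e · e = e`.

From idempotents to structures: the cyclic identity gives `D_{e,a} = 2 D_{e,e·a}`, and evaluating it
at `e` gives the Peirce polynomial. A derivation sends `e` into `J_{1/2}`, and `4 D_{e,a}(e) = -a`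
there, so `D` is the sum of the annihilator of `e` and `D_{e,J_{1/2}}`. For `a ∈ J_{1/2}` the map `u
⊗ v ↦ γ_{u,v} ⊗ a - 4 (u|v) D_{e,a}` intertwines the two copies of 𝔰𝔩₂ (`lie_splitMap_sqMap`). Hence
`L` is a sum of the six kinds of modules and a representation of `SL₂ × SL₂` can be transported to
it (`splitRep`).

The remaining point is that this representation preserves the bracket. Elementary matrices act by
exponentials of derivations of cube zero, which are automorphisms (`mem_lieStabilizer_of_expAct`).
An arbitrary point becomes a product of elementary matrices after inverting either entry of its
first row; these entries are coprime, so naturality reduces the general case to the two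
localizations (`map_lie_of_elementary`). The isotypic components are found by differentiating an
arbitrary equivariant map: the diagonal 𝔰𝔩₂ determines its shape, and brackets with the first factor
place its multiplicity vector in the correct Peirce component. -/

theorem equivariant_of_one_tmul {σ : GroupRep G M} {ρ : GroupRep G N} {φ : M →ₗ[F] N}
    (h : ∀ (R : Type u) [CommRing R] [Algebra F R] (g : G.pts R) (m : M),
      ρ.act R g (1 ⊗ₜ φ m) = φ.baseChange R (σ.act R g (1 ⊗ₜ m))) : Equivariant σ ρ φ := by
  intro R _ _ g x
  induction x with
  | zero => simp
  | add a b ha hb => simp only [map_add, ha, hb]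
  | tmul r m =>
    have e : (r ⊗ₜ[F] m : R ⊗[F] M) = r • (1 ⊗ₜ m) := by simp [TensorProduct.smul_tmul']
    rw [e, map_smul, map_smul, map_smul, map_smul, LinearMap.baseChange_tmul, h]

theorem Equivariant.one_tmul {σ : GroupRep G M} {ρ : GroupRep G N} {φ : M →ₗ[F] N}
    (h : Equivariant σ ρ φ) (R : Type u) [CommRing R] [Algebra F R] (g : G.pts R) (m : M) :
    ρ.act R g (1 ⊗ₜ φ m) = φ.baseChange R (σ.act R g (1 ⊗ₜ m)) := by
  rw [← h, LinearMap.baseChange_tmul]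

theorem Equivariant.comp {P : Type*} [AddCommGroup P] [Module F P] {σ : GroupRep G M}
    {ρ : GroupRep G N} {τ : GroupRep G P} {ψ : N →ₗ[F] P} {φ : M →ₗ[F] N}
    (hψ : Equivariant ρ τ ψ) (hφ : Equivariant σ ρ φ) : Equivariant σ τ (ψ ∘ₗ φ) := by
  intro R _ _ g x
  rw [LinearMap.baseChange_comp, LinearMap.comp_apply, LinearMap.comp_apply, hψ, hφ]

theorem Equivariant.add {σ : GroupRep G M} {ρ : GroupRep G N} {φ ψ : M →ₗ[F] N}
    (hφ : Equivariant σ ρ φ) (hψ : Equivariant σ ρ ψ) : Equivariant σ ρ (φ + ψ) := by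
  intro R _ _ g x
  simp only [LinearMap.baseChange_add, LinearMap.add_apply, map_add, hφ R g, hψ R g]

theorem GroupRep.ext_one_tmul {ρ ρ' : GroupRep G M}
    (h : ∀ (R : Type u) [CommRing R] [Algebra F R] (g : G.pts R) (m : M),
      ρ.act R g (1 ⊗ₜ m) = ρ'.act R g (1 ⊗ₜ m)) : ρ = ρ' := by
  have : @GroupRep.act _ _ _ _ _ _ ρ = @GroupRep.act _ _ _ _ _ _ ρ' := by
    funext R _ _
    refine MonoidHom.ext fun g => TensorProduct.AlgebraTensorModule.curry_injective ?_
    refine LinearMap.ext_ring (LinearMap.ext fun m => ?_)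
    exact h R g m
  cases ρ; cases ρ'; congr

/-- The point `g` acts as `exp (r ⊗ d)`, where terms of degree three and more vanish. -/
def ExpAct (σ : GroupRep G M) (R : Type u) [CommRing R] [Algebra F R] (g : G.pts R) (r : R)
    (d : M →ₗ[F] M) : Prop :=
  ∀ m, σ.act R g (1 ⊗ₜ m) = 1 ⊗ₜ m + r ⊗ₜ d m + (r ^ 2) ⊗ₜ ((2⁻¹ : F) • d (d m))

theorem Equivariant.map_mem_fixed {σ : GroupRep G M} {ρ : GroupRep G N} {φ : M →ₗ[F] N}
    (h : Equivariant σ ρ φ) {m : M} (hm : m ∈ σ.fixed) : φ m ∈ ρ.fixed := by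
  intro R _ _ g
  rw [h.one_tmul, hm R g, LinearMap.baseChange_tmul]

theorem Equivariant.expAct_apply {σ : GroupRep G M} {ρ : GroupRep G N} {φ : M →ₗ[F] N}
    (h : Equivariant σ ρ φ) {R : Type u} [CommRing R] [Algebra F R] {g : G.pts R} {r : R}
    {d : M →ₗ[F] M} (hd : ExpAct σ R g r d) (m : M) :
    ρ.act R g (1 ⊗ₜ φ m) = 1 ⊗ₜ φ m + r ⊗ₜ φ (d m) + (r ^ 2) ⊗ₜ ((2⁻¹ : F) • φ (d (d m))) := by
  rw [h.one_tmul, hd m]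
  simp

end General

/-! ### Differentials computed from exponential expansions -/

section Differential

variable {F : Type u} [Field F] {G : GroupFunctor F} {L : Type v} [LieRing L] [LieAlgebra F L]
  {M : Type w} [AddCommGroup M] [Module F M]

/-- Over the dual numbers `eps ^ 2 = 0`, so the quadratic term of an expansion is invisible and `b`
may be anything. This is the form in which `ExpAct` supplies the expansion. -/
theorem GStructure.differential_eq (Φ : GStructure G L) {t : G.pts (DualNumber F)} {l a b : L}
    (h : Φ.act (DualNumber F) t (1 ⊗ₜ l) =
      1 ⊗ₜ l + DualNumber.eps ⊗ₜ a + (DualNumber.eps ^ 2) ⊗ₜ b) :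
    Φ.differential t l = a := by
  have : Φ.differential t l = TensorProduct.lid F L (LinearMap.rTensor L
      (TrivSqZeroExt.sndHom F F) (Φ.act (DualNumber F) t (1 ⊗ₜ l))) := rfl
  rw [this, h]
  simp [pow_two]

theorem GStructure.differential_apply (Φ : GStructure G L) {σ : GroupRep G M} {φ : M →ₗ[F] L}
    (h : Equivariant σ Φ.toGroupRep φ) {t : G.pts (DualNumber F)} {d : M →ₗ[F] M}
    (hd : ExpAct σ (DualNumber F) t DualNumber.eps d) (m : M) :
    Φ.differential t (φ m) = φ (d m) :=
  Φ.differential_eq (h.expAct_apply hd m)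

theorem GStructure.differential_fixed (Φ : GStructure G L) {l : L} (hl : l ∈ Φ.fixed)
    (t : G.pts (DualNumber F)) : Φ.differential t l = 0 :=
  Φ.differential_eq (b := 0) (by rw [hl]; simp)

end Differential

/-! ### Points `1 + r X` acting on the standard modules -/

section Standard

variable {F : Type u} [Field F]

theorem sl2.val_one_one (X : sl2 F) : X.val 1 1 = -X.val 0 0 := by
  have := X.val_trace
  rw [Matrix.trace_fin_two] at this
  linear_combination this

/-- The points `1 + r X` of `SL₂(R)`. -/
def IsOneAdd (X : sl2 F) {R : Type u} [CommRing R] [Algebra F R] (r : R)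
    (g : Matrix.SpecialLinearGroup (Fin 2) R) : Prop :=
  (g : Matrix (Fin 2) (Fin 2) R) = 1 + r • X.val.map (algebraMap F R)

theorem isOneAdd_epsPoint (X : sl2 F) : IsOneAdd X DualNumber.eps (epsPoint X) := by
  unfold IsOneAdd epsPoint
  ext i j <;> simp [TrivSqZeroExt.algebraMap_eq_inl]

theorem isOneAdd_zero {R : Type u} [CommRing R] [Algebra F R] (r : R) :
    IsOneAdd (0 : sl2 F) r (1 : Matrix.SpecialLinearGroup (Fin 2) R) := by
  unfold IsOneAdd
  ext i j
  simp

/-- `ad X` on `𝔰𝔩₂`. -/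
def sl2.adL (X : sl2 F) : sl2 F →ₗ[F] sl2 F := (LieAlgebra.ad F (sl2 F) X : _)

@[simp] theorem sl2.adL_apply (X Y : sl2 F) : sl2.adL X Y = ⁅X, Y⁆ := rfl

/-- For a trace zero matrix `det (1 + r X) = 1 + r² det X`, so determinant one forces `r² det X =
0`. The entry expression is `-det X`, and `X² = -det X` is scalar: in effect `r² X² = 0`. -/
theorem isOneAdd_sq {X : sl2 F} {R : Type u} [CommRing R] [Algebra F R] {r : R}
    {g : Matrix.SpecialLinearGroup (Fin 2) R} (hg : IsOneAdd X r g) :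
    r ^ 2 * (algebraMap F R (X.val 0 0 * X.val 0 0 + X.val 0 1 * X.val 1 0)) = 0 := by
  have h := g.det_coe
  rw [hg, Matrix.det_fin_two] at h
  simp [X.val_one_one] at h
  simp only [map_add, map_mul]
  linear_combination -h

/-- Conjugation sends `Y` to `(1 + rX) Y (1 - rX) = Y + r [X, Y] - r² XYX`, while `½ [X, [X, Y]] =
X² Y - XYX` because `X²` is scalar. The two agree by `r² X² = 0`. -/
theorem expAct_adj (h2 : (2 : F) ≠ 0) {X : sl2 F} {R : Type u} [CommRing R] [Algebra F R] {r : R}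
    {g : Matrix.SpecialLinearGroup (Fin 2) R} (hg : IsOneAdd X r g) :
    ExpAct (adjRep F) R g r X.adL := by
  intro Y
  have hs := isOneAdd_sq hg
  have h2' : algebraMap F R 2⁻¹ * 2 = 1 := by
    rw [← map_ofNat (algebraMap F R) 2, ← map_mul, inv_mul_cancel₀ h2, map_one]
  rw [← sl2.ofMatrix_toMatrix F R (1 ⊗ₜ Y + _ + _),
    ← sl2.ofMatrix_toMatrix F R ((adjRep F).act R g _)]
  congr 1
  change sl2.toMatrix F R (adjAct F R g _) = _
  rw [toMatrix_adjAct, Matrix.SpecialLinearGroup.coe_inv, hg, Matrix.adjugate_fin_two]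
  simp only [map_add, map_mul] at hs
  ext i j
  fin_cases i <;> fin_cases j <;>
    simp [sl2.toMatrix, sl2.val_lie, Matrix.mul_apply, Fin.sum_univ_two, X.val_one_one,
      Y.val_one_one]
  -- The entries become independent variables of a polynomial identity; `h2'` clears the factor `½`
  -- and `hs` is `r² X² = 0`.
  all_goals
    rw [Algebra.smul_def (A := R) (2⁻¹ : F)]
    generalize algebraMap F R 2⁻¹ = h at *
    generalize algebraMap F R (X.val 0 0) = a at *
    generalize algebraMap F R (X.val 0 1) = b at *
    generalize algebraMap F R (X.val 1 0) = c at *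
    generalize algebraMap F R (Y.val 0 0) = a' at *
    generalize algebraMap F R (Y.val 0 1) = b' at *
    generalize algebraMap F R (Y.val 1 0) = c' at *
  · linear_combination (-(r ^ 2) * (2 * (a * a + b * c) * a' -
      (2 * a * a' + b * c' + c * b') * a)) * h2' - a' * hs
  · linear_combination (-(r ^ 2) * (2 * (a * a + b * c) * b' -
      (2 * a * a' + b * c' + c * b') * b)) * h2' - b' * hs
  · linear_combination (-(r ^ 2) * (2 * (a * a + b * c) * c' -
      (2 * a * a' + b * c' + c * b') * c)) * h2' - c' * hs
  · linear_combination ((r ^ 2) * (2 * (a * a + b * c) * a' -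
      (2 * a * a' + b * c' + c * b') * a)) * h2' + a' * hs

theorem piScalarRight_one_tmul (R : Type u) [CommRing R] [Algebra F R] (r : R) (u : nat2 F) :
    TensorProduct.piScalarRight F R R (Fin 2) (r ⊗ₜ u) = fun i => r * algebraMap F R (u i) := by
  ext i
  simp [TensorProduct.piScalarRight_apply, Algebra.smul_def, mul_comm]

/-- The action of `𝔰𝔩₂` on the natural module. -/
def sl2.natL (X : sl2 F) : nat2 F →ₗ[F] nat2 F := X.val.mulVecLin

@[simp] theorem sl2.natL_apply (X : sl2 F) (u : nat2 F) : X.natL u = X.val.mulVec u := rfl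

/-- Cayley–Hamilton in trace zero. The scalar is the one annihilated by `r²` in `isOneAdd_sq`. -/
theorem natL_natL (X : sl2 F) (u : nat2 F) :
    X.natL (X.natL u) = (X.val 0 0 * X.val 0 0 + X.val 0 1 * X.val 1 0) • u := by
  ext i
  fin_cases i <;> simp [Matrix.mulVec, dotProduct, Fin.sum_univ_two, X.val_one_one] <;> ring

theorem natAct_one_tmul {X : sl2 F} {R : Type u} [CommRing R] [Algebra F R] {r : R}
    {g : Matrix.SpecialLinearGroup (Fin 2) R} (hg : IsOneAdd X r g) (u : nat2 F) :
    natAct F R g (1 ⊗ₜ u) = 1 ⊗ₜ u + r ⊗ₜ X.natL u := by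
  apply (TensorProduct.piScalarRight F R R (Fin 2)).injective
  rw [piScalarRight_natAct, map_add]
  simp only [piScalarRight_one_tmul]
  rw [hg]
  ext i
  fin_cases i <;> simp [Matrix.mulVec, dotProduct, Fin.sum_univ_two] <;> ring

/-- On the natural module the action is already affine in `r`; the quadratic term demanded by
`ExpAct` vanishes since `r² X² = 0`. -/
theorem expAct_nat {X : sl2 F} {R : Type u} [CommRing R] [Algebra F R] {r : R}
    {g : Matrix.SpecialLinearGroup (Fin 2) R} (hg : IsOneAdd X r g) :
    ExpAct (natRep F) R g r X.natL := by
  intro u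
  have hs := isOneAdd_sq hg
  rw [natL_natL, smul_comm, ← TensorProduct.smul_tmul, Algebra.smul_def, mul_comm, hs,
    TensorProduct.zero_tmul, add_zero]
  exact natAct_one_tmul hg u

/-- The action of `𝔰𝔩₂ × 𝔰𝔩₂` on the tensor product of the natural modules. -/
def natL₂ (X : sl2 F × sl2 F) : nat2 F ⊗[F] nat2 F →ₗ[F] nat2 F ⊗[F] nat2 F :=
  LinearMap.rTensor _ X.1.natL + LinearMap.lTensor _ X.2.natL

@[simp] theorem natL₂_tmul (X : sl2 F × sl2 F) (u v : nat2 F) :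
    natL₂ X (u ⊗ₜ v) = X.1.natL u ⊗ₜ v + u ⊗ₜ X.2.natL v := rfl

theorem tensor_act_one_tmul {G : GroupFunctor F} {M : Type v} [AddCommGroup M] [Module F M]
    {N : Type w} [AddCommGroup N] [Module F N] (ρ : GroupRep G M) (σ : GroupRep G N)
    (R : Type u) [CommRing R] [Algebra F R] (g : G.pts R) (m : M) (n : N) :
    (ρ.tensor σ).act R g (1 ⊗ₜ (m ⊗ₜ n)) =
      (TensorProduct.AlgebraTensorModule.distribBaseChange F R M N).symm
        (ρ.act R g (1 ⊗ₜ m) ⊗ₜ σ.act R g (1 ⊗ₜ n)) := by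
  simp [GroupRep.tensor]

/-- The product `(1 + rX₁) ⊗ (1 + rX₀)` has quadratic term `r² X₁ ⊗ X₀`. Half the square of `X₁ ⊗ 1
+ 1 ⊗ X₀` is `X₁ ⊗ X₀` plus multiples of the scalars `X₁²` and `X₀²`, which `r²` kills. -/
theorem expAct_nat₁₀ (h2 : (2 : F) ≠ 0) {X : sl2 F × sl2 F} {R : Type u} [CommRing R]
    [Algebra F R] {r : R} {g : (SL2SL2 F).pts R} (h₁ : IsOneAdd X.1 r g.1)
    (h₀ : IsOneAdd X.2 r g.2) : ExpAct (natRep₁₀ F) R g r (natL₂ X) := by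
  intro z
  induction z with
  | zero => simp
  | add a b ha hb =>
    simp only [TensorProduct.tmul_add, map_add, ha, hb, smul_add]; abel
  | tmul u v =>
    unfold natRep₁₀
    rw [tensor_act_one_tmul]
    change (TensorProduct.AlgebraTensorModule.distribBaseChange F R (nat2 F) (nat2 F)).symm
      (natAct F R g.1 (1 ⊗ₜ u) ⊗ₜ natAct F R g.2 (1 ⊗ₜ v)) = _
    rw [natAct_one_tmul h₁, natAct_one_tmul h₀]
    have e : (2⁻¹ : F) • natL₂ X (natL₂ X (u ⊗ₜ v)) = X.1.natL u ⊗ₜ X.2.natL v +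
        (2⁻¹ * (X.1.val 0 0 * X.1.val 0 0 + X.1.val 0 1 * X.1.val 1 0)) • u ⊗ₜ v +
        (2⁻¹ * (X.2.val 0 0 * X.2.val 0 0 + X.2.val 0 1 * X.2.val 1 0)) • u ⊗ₜ v := by
      simp only [natL₂_tmul, map_add, natL_natL]
      rw [← TensorProduct.smul_tmul', TensorProduct.tmul_smul]
      match_scalars <;> field_simp <;> ring
    have s₁ := isOneAdd_sq h₁
    have s₀ := isOneAdd_sq h₀
    have hD : ∀ (a b : R) (m n : nat2 F),
        (TensorProduct.AlgebraTensorModule.distribBaseChange F R (nat2 F) (nat2 F)).symm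
          ((a ⊗ₜ m) ⊗ₜ (b ⊗ₜ n)) = (a * b) ⊗ₜ (m ⊗ₜ n) := by
      intro a b m n
      simp
    have hz : ∀ c : F, r ^ 2 * algebraMap F R c = 0 →
        (r ^ 2) ⊗ₜ[F] ((2⁻¹ * c) • u ⊗ₜ[F] v) = 0 := by
      intro c hc
      rw [mul_smul, smul_comm, ← TensorProduct.smul_tmul, Algebra.smul_def, mul_comm, hc,
        TensorProduct.zero_tmul]
    have e' : (r ^ 2) ⊗ₜ[F] ((2⁻¹ : F) • natL₂ X (natL₂ X (u ⊗ₜ v))) =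
        (r ^ 2) ⊗ₜ[F] (X.1.natL u ⊗ₜ X.2.natL v) := by
      rw [e, TensorProduct.tmul_add, TensorProduct.tmul_add, hz _ s₁, hz _ s₀, add_zero, add_zero]
    rw [e', TensorProduct.tmul_add, TensorProduct.add_tmul, TensorProduct.add_tmul]
    rw [LinearEquiv.map_add, LinearEquiv.map_add, LinearEquiv.map_add, hD, hD, hD, hD, natL₂_tmul,
      TensorProduct.tmul_add, one_mul, one_mul, mul_one, pow_two]
    abel

end Standard

/-! ### Multiplication tables of 𝔰𝔩₂ and of the natural module -/

section Brackets

variable {F : Type u} [Field F]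

theorem sl2.lie_H_E : ⁅sl2.elH F, sl2.elE F⁆ = (2 : F) • sl2.elE F := by
  apply sl2.ext; ext i j
  fin_cases i <;> fin_cases j <;>
    simp [sl2.val_lie, sl2.elE, sl2.elH]
  ring

theorem sl2.lie_H_F : ⁅sl2.elH F, sl2.elF F⁆ = (-2 : F) • sl2.elF F := by
  apply sl2.ext; ext i j
  fin_cases i <;> fin_cases j <;>
    simp [sl2.val_lie, sl2.elF, sl2.elH]
  ring

theorem sl2.lie_E_F : ⁅sl2.elE F, sl2.elF F⁆ = sl2.elH F := by
  apply sl2.ext; ext i j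
  fin_cases i <;> fin_cases j <;>
    simp [sl2.val_lie, sl2.elF, sl2.elE, sl2.elH]

theorem sl2.lie_E_H : ⁅sl2.elE F, sl2.elH F⁆ = (-2 : F) • sl2.elE F := by
  rw [← lie_skew, sl2.lie_H_E, neg_smul]

theorem sl2.lie_F_H : ⁅sl2.elF F, sl2.elH F⁆ = (2 : F) • sl2.elF F := by
  rw [← lie_skew, sl2.lie_H_F, neg_smul, neg_neg]

theorem sl2.lie_F_E : ⁅sl2.elF F, sl2.elE F⁆ = (-1 : F) • sl2.elH F := by
  rw [← lie_skew, sl2.lie_E_F, neg_one_smul]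

theorem sl2.eq_combination (X : sl2 F) :
    X = X.val 0 1 • sl2.elE F + X.val 0 0 • sl2.elH F + X.val 1 0 • sl2.elF F := by
  apply sl2.ext; ext i j
  fin_cases i <;> fin_cases j <;> simp [sl2.elF, sl2.elE, sl2.elH, X.val_one_one]

variable (F) in
/-- The first basis vector of the natural module. -/
def vec0 : nat2 F := Pi.single 0 1

variable (F) in
/-- The second basis vector of the natural module. -/
def vec1 : nat2 F := Pi.single 1 1

theorem nat2_eq_combination (u : nat2 F) : u = u 0 • vec0 F + u 1 • vec1 F := by
  ext i; fin_cases i <;> simp [vec0, vec1]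

@[simp] theorem vec0_zero : vec0 F 0 = 1 := by simp [vec0]
@[simp] theorem vec0_one : vec0 F 1 = 0 := by simp [vec0]
@[simp] theorem vec1_zero : vec1 F 0 = 0 := by simp [vec1]
@[simp] theorem vec1_one : vec1 F 1 = 1 := by simp [vec1]

theorem natL_H_vec0 : (sl2.elH F).natL (vec0 F) = vec0 F := by
  ext i; fin_cases i <;> simp [sl2.elH, vec0]
theorem natL_H_vec1 : (sl2.elH F).natL (vec1 F) = (-1 : F) • vec1 F := by
  ext i; fin_cases i <;> simp [sl2.elH, vec1]
theorem natL_E_vec0 : (sl2.elE F).natL (vec0 F) = 0 := by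
  ext i; fin_cases i <;> simp [sl2.elE, vec0]
theorem natL_E_vec1 : (sl2.elE F).natL (vec1 F) = vec0 F := by
  ext i; fin_cases i <;> simp [sl2.elE, vec0, vec1]
theorem natL_F_vec0 : (sl2.elF F).natL (vec0 F) = vec1 F := by
  ext i; fin_cases i <;> simp [sl2.elF, vec0, vec1]
theorem natL_F_vec1 : (sl2.elF F).natL (vec1 F) = 0 := by
  ext i; fin_cases i <;> simp [sl2.elF, vec1]

end Brackets

namespace ShortDecomposition

variable {F : Type u} [Field F] {L : Type v} [LieRing L] [LieAlgebra F L]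
variable {Ψ : GStructure (SL2 F) L} {J T D : Type*}
  [AddCommGroup J] [Module F J] [AddCommGroup T] [Module F T] [AddCommGroup D] [Module F D]
  (dec : ShortDecomposition Ψ J T D)

/-! ### Coordinates of elements -/

/-- The coordinate in `J` at the matrix entry `(i, j)`. -/
def coordJ (i j : Fin 2) : L →ₗ[F] J :=
  (TensorProduct.lid F J).toLinearMap ∘ₗ LinearMap.rTensor J (sl2.entry F i j) ∘ₗ
    LinearMap.fst F _ _ ∘ₗ dec.equiv.symm.toLinearMap

/-- The coordinate in `T` at the entry `i`. -/
def coordT (i : Fin 2) : L →ₗ[F] T :=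
  (TensorProduct.lid F T).toLinearMap ∘ₗ LinearMap.rTensor T (LinearMap.proj i) ∘ₗ
    LinearMap.fst F _ _ ∘ₗ LinearMap.snd F _ _ ∘ₗ dec.equiv.symm.toLinearMap

theorem projJ_eq : dec.projJ = dec.coordJ 0 0 := rfl

theorem adj_apply (f : sl2 F) (a : J) : dec.adj f a = dec.equiv (f ⊗ₜ a, 0, 0) := rfl
theorem nat_apply (u : nat2 F) (x : T) : dec.nat u x = dec.equiv (0, u ⊗ₜ x, 0) := rfl
theorem triv_apply (d : D) : dec.triv d = dec.equiv (0, 0, d) := rfl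

@[simp] theorem coordJ_adj (i j : Fin 2) (f : sl2 F) (a : J) :
    dec.coordJ i j (dec.adj f a) = f.val i j • a := by
  simp [coordJ, adj_apply]
  rfl
@[simp] theorem coordJ_nat (i j : Fin 2) (u : nat2 F) (x : T) :
    dec.coordJ i j (dec.nat u x) = 0 := by
  simp [coordJ, nat_apply]
@[simp] theorem coordJ_triv (i j : Fin 2) (d : D) : dec.coordJ i j (dec.triv d) = 0 := by
  simp [coordJ, triv_apply]
@[simp] theorem coordT_adj (i : Fin 2) (f : sl2 F) (a : J) :
    dec.coordT i (dec.adj f a) = 0 := by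
  simp [coordT, adj_apply]
@[simp] theorem coordT_nat (i : Fin 2) (u : nat2 F) (x : T) :
    dec.coordT i (dec.nat u x) = u i • x := by
  simp [coordT, nat_apply]
@[simp] theorem coordT_triv (i : Fin 2) (d : D) : dec.coordT i (dec.triv d) = 0 := by
  simp [coordT, triv_apply]
@[simp] theorem projD_adj (f : sl2 F) (a : J) : dec.projD (dec.adj f a) = 0 := by
  simp [projD, adj_apply]
@[simp] theorem projD_nat (u : nat2 F) (x : T) : dec.projD (dec.nat u x) = 0 := by
  simp [projD, nat_apply]
@[simp] theorem projD_triv (d : D) : dec.projD (dec.triv d) = d := by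
  simp [projD, triv_apply]

theorem adj_eq_combination (f : sl2 F) (a : J) : dec.adj f a =
    f.val 0 1 • dec.adj (sl2.elE F) a + f.val 0 0 • dec.adj (sl2.elH F) a +
      f.val 1 0 • dec.adj (sl2.elF F) a := by
  conv_lhs => rw [f.eq_combination]
  simp

theorem nat_eq_combination (u : nat2 F) (x : T) : dec.nat u x =
    u 0 • dec.nat (vec0 F) x + u 1 • dec.nat (vec1 F) x := by
  conv_lhs => rw [nat2_eq_combination u]
  simp

/-- Elements of `L` are spanned by the three kinds of pure elements. -/
theorem induction_on {p : L → Prop} (l : L) (hadd : ∀ l l', p l → p l' → p (l + l'))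
    (hadj : ∀ f a, p (dec.adj f a)) (hnat : ∀ u x, p (dec.nat u x))
    (htriv : ∀ d, p (dec.triv d)) : p l := by
  obtain ⟨⟨y, z, d⟩, rfl⟩ := dec.equiv.surjective l
  have e : dec.equiv (y, z, d) = dec.equiv (y, 0, 0) + dec.equiv (0, z, 0) +
      dec.equiv (0, 0, d) := by
    rw [← map_add, ← map_add]; simp
  rw [e]
  clear e
  refine hadd _ _ (hadd _ _ ?_ ?_) (htriv d)
  · induction y with
    | zero =>  have := htriv 0; rwa [triv_apply] at this
    | tmul f a => exact hadj f a
    | add y y' h h' =>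
      have : dec.equiv (y + y', 0, 0) = dec.equiv (y, 0, 0) + dec.equiv (y', 0, 0) := by
        rw [← map_add]; simp
      rw [this]; exact hadd _ _ h h'
  · induction z with
    | zero =>  have := htriv 0; rwa [triv_apply] at this
    | tmul f a => exact hnat f a
    | add y y' h h' =>
      have : dec.equiv (0, y + y', 0) = dec.equiv (0, y, 0) + dec.equiv (0, y', 0) := by
        rw [← map_add]; simp
      rw [this]; exact hadd _ _ h h'

theorem eq_coords (l : L) : l = dec.adj (sl2.elE F) (dec.coordJ 0 1 l) +
    dec.adj (sl2.elH F) (dec.coordJ 0 0 l) + dec.adj (sl2.elF F) (dec.coordJ 1 0 l) +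
    dec.nat (vec0 F) (dec.coordT 0 l) + dec.nat (vec1 F) (dec.coordT 1 l) +
    dec.triv (dec.projD l) := by
  induction l using dec.induction_on with
  | hadd l l' h h' =>
    conv_lhs => rw [h, h']
    simp only [map_add]; abel
  | hadj f a => simpa using dec.adj_eq_combination f a
  | hnat u x => simpa using dec.nat_eq_combination u x
  | htriv d => simp

/-! ### The action of `𝔰𝔩₂` -/

variable {ι : sl2 F →ₗ⁅F⁆ L}

theorem adj_flip_equivariant (a : J) :
    Equivariant (adjRep F) Ψ.toGroupRep (dec.adj.flip a) := dec.adj_equivariant a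

theorem nat_flip_equivariant (x : T) :
    Equivariant (natRep F) Ψ.toGroupRep (dec.nat.flip x) := dec.nat_equivariant x

/-- An equivariant embedding intertwines differentials, and innerness identifies the differential of
`Ψ` with `ad ∘ ι`. The same argument gives `lie_nat` and `lie_triv`. -/
theorem lie_adj (h2 : (2 : F) ≠ 0) (hι : IsInnerSL2 Ψ ι) (X f : sl2 F) (a : J) :
    ⁅ι X, dec.adj f a⁆ = dec.adj ⁅X, f⁆ a := by
  rw [hι.2]
  exact Ψ.differential_apply (dec.adj_flip_equivariant a) (expAct_adj h2 (isOneAdd_epsPoint X)) f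

theorem lie_nat (hι : IsInnerSL2 Ψ ι) (X : sl2 F) (u : nat2 F) (x : T) :
    ⁅ι X, dec.nat u x⁆ = dec.nat (X.natL u) x := by
  rw [hι.2]
  exact Ψ.differential_apply (dec.nat_flip_equivariant x) (expAct_nat (isOneAdd_epsPoint X)) u

theorem lie_triv (hι : IsInnerSL2 Ψ ι) (X : sl2 F) (d : D) : ⁅ι X, dec.triv d⁆ = 0 := by
  rw [hι.2]
  exact Ψ.differential_fixed (dec.triv_fixed d) _

variable (h2 : (2 : F) ≠ 0) (h3 : (3 : F) ≠ 0) (hι : IsInnerSL2 Ψ ι)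

include h2 hι

theorem lie_H (l : L) : ⁅ι (sl2.elH F), l⁆ =
    (2 : F) • dec.adj (sl2.elE F) (dec.coordJ 0 1 l) +
    (-2 : F) • dec.adj (sl2.elF F) (dec.coordJ 1 0 l) +
    dec.nat (vec0 F) (dec.coordT 0 l) + (-1 : F) • dec.nat (vec1 F) (dec.coordT 1 l) := by
  conv_lhs => rw [dec.eq_coords l]
  simp only [lie_add, dec.lie_adj h2 hι, dec.lie_nat hι, dec.lie_triv hι, sl2.lie_H_E, sl2.lie_H_F,
    lie_self, natL_H_vec0, natL_H_vec1, map_smul, map_zero, LinearMap.smul_apply,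
    LinearMap.zero_apply, add_zero]

/-- The six coordinates have weights `2, 0, -2, 1, -1, 0` for `ι(H)`, so an eigenvector of weight
`k` has each coordinate annihilated by the difference between its weight and `k`. For weight 0 the
relevant differences are `±1` and `±2`; weights `±1` and `2` also involve 3, which is where
characteristic 3 is excluded. -/
theorem weight_coords {k : F} {l : L} (h : ⁅ι (sl2.elH F), l⁆ = k • l) :
    (2 - k) • dec.coordJ 0 1 l = 0 ∧ k • dec.coordJ 0 0 l = 0 ∧ (2 + k) • dec.coordJ 1 0 l = 0 ∧
    (1 - k) • dec.coordT 0 l = 0 ∧ (1 + k) • dec.coordT 1 l = 0 ∧ k • dec.projD l = 0 := by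
  rw [dec.lie_H h2 hι] at h
  refine ⟨?_, ?_, ?_, ?_, ?_, ?_⟩
  · have := congrArg (dec.coordJ 0 1) h
    simp [sl2.elE, sl2.elF] at this
    rw [sub_smul, this, sub_self]
  · have := congrArg (dec.coordJ 0 0) h
    simp [sl2.elE, sl2.elF] at this
    simp [this]
  · have := congrArg (dec.coordJ 1 0) h
    simp [sl2.elE, sl2.elF] at this
    rw [add_smul, ← this]; simp
  · have := congrArg (dec.coordT 0) h
    simp at this
    rw [sub_smul, ← this]; simp
  · have := congrArg (dec.coordT 1) h
    simp at this
    rw [add_smul, ← this]; simp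
  · have := congrArg dec.projD h
    simp at this
    simp [this]

theorem eq_of_weight_zero {l : L} (h : ⁅ι (sl2.elH F), l⁆ = 0) :
    l = dec.adj (sl2.elH F) (dec.coordJ 0 0 l) + dec.triv (dec.projD l) := by
  obtain ⟨h₁, -, h₃, h₄, h₅, -⟩ := dec.weight_coords h2 hι (k := 0) (l := l) (by simpa using h)
  simp [h2] at h₁ h₃ h₄ h₅
  conv_lhs => rw [dec.eq_coords l]
  simp [h₁, h₃, h₄, h₅]

include h3

theorem eq_of_weight_one {l : L} (h : ⁅ι (sl2.elH F), l⁆ = l) :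
    l = dec.nat (vec0 F) (dec.coordT 0 l) := by
  obtain ⟨h₁, h₂, h₃, -, h₅, h₆⟩ := dec.weight_coords h2 hι (k := 1) (l := l) (by simpa using h)
  norm_num [h2, h3] at h₁ h₂ h₃ h₅ h₆
  conv_lhs => rw [dec.eq_coords l]
  simp [h₁, h₂, h₃, h₅, h₆]

theorem eq_of_weight_neg_one {l : L} (h : ⁅ι (sl2.elH F), l⁆ = -l) :
    l = dec.nat (vec1 F) (dec.coordT 1 l) := by
  obtain ⟨h₁, h₂, h₃, h₄, -, h₆⟩ := dec.weight_coords h2 hι (k := -1) (l := l) (by simpa using h)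
  norm_num [h2, h3] at h₁ h₂ h₃ h₄ h₆
  conv_lhs => rw [dec.eq_coords l]
  simp [h₁, h₂, h₃, h₄, h₆]

theorem eq_of_weight_two {l : L} (h : ⁅ι (sl2.elH F), l⁆ = (2 : F) • l) :
    l = dec.adj (sl2.elE F) (dec.coordJ 0 1 l) := by
  obtain ⟨-, h₂, h₃, h₄, h₅, h₆⟩ := dec.weight_coords h2 hι (k := 2) (l := l) h
  have h4 : (4 : F) ≠ 0 := by
    rw [show (4 : F) = 2 * 2 by norm_num]; exact mul_ne_zero h2 h2
  norm_num [h2, h3, h4] at h₂ h₃ h₄ h₅ h₆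
  conv_lhs => rw [dec.eq_coords l]
  simp [h₂, h₃, h₄, h₅, h₆]

end ShortDecomposition

namespace ShortDecomposition

variable {F : Type u} [Field F] {L : Type v} [LieRing L] [LieAlgebra F L]
variable {Ψ : GStructure (SL2 F) L} {J T D : Type*}
  [AddCommGroup J] [Module F J] [AddCommGroup T] [Module F T] [AddCommGroup D] [Module F D]
  (dec : ShortDecomposition Ψ J T D) {ι : sl2 F →ₗ⁅F⁆ L}
  (h2 : (2 : F) ≠ 0) (h3 : (3 : F) ≠ 0) (hι : IsInnerSL2 Ψ ι)

/-! ### The bracket in coordinates -/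

include h2 h3 hι in
/-- Homomorphisms of `𝔰𝔩₂`-modules from the adjoint module to `L`. -/
theorem eq_adj_of_lie_hom (κ : sl2 F →ₗ[F] L) (hκ : ∀ X Y, ⁅ι X, κ Y⁆ = κ ⁅X, Y⁆) (f : sl2 F) :
    κ f = dec.adj f (dec.coordJ 0 0 (κ (sl2.elH F))) := by
  -- The image of `E` is a vector of weight 2, hence `E ⊗ a`; lowering it twice determines the
  -- images of `H` and `F`.
  have hE := dec.eq_of_weight_two h2 h3 hι (l := κ (sl2.elE F)) (by
    rw [hκ, sl2.lie_H_E, map_smul])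
  set a := dec.coordJ 0 1 (κ (sl2.elE F)) with ha
  have hH : κ (sl2.elH F) = dec.adj (sl2.elH F) a := by
    have := hκ (sl2.elF F) (sl2.elE F)
    rw [hE, dec.lie_adj h2 hι, sl2.lie_F_E] at this
    simpa using this.symm
  have hF : κ (sl2.elF F) = dec.adj (sl2.elF F) a := by
    have := hκ (sl2.elF F) (sl2.elH F)
    rw [hH, dec.lie_adj h2 hι, sl2.lie_F_H, map_smul, map_smul, LinearMap.smul_apply] at this
    exact (smul_right_injective L h2 this).symm
  have h1 : dec.coordJ 0 0 (κ (sl2.elH F)) = a := by rw [hH]; simp [sl2.elH]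
  rw [h1]
  conv_lhs => rw [f.eq_combination]
  conv_rhs => rw [f.eq_combination]
  simp [hE, hH, hF]

include h2 h3 hι

theorem inner_eq (f : sl2 F) : ι f = dec.adj f (dec.one ι) :=
  dec.eq_adj_of_lie_hom h2 h3 hι (ι : sl2 F →ₗ[F] L) (fun X Y => (ι.map_lie X Y).symm) f

omit h3 in
-- The weights 2 and -2 add up to 0, so only the `H ⊗ J` and `D` components survive, and `mul` and
-- `dJ` are by definition these components. The factor 2 undoes the `½` in `dJ`.
theorem lie_adj_E_adj_F (a b : J) : ⁅dec.adj (sl2.elE F) a, dec.adj (sl2.elF F) b⁆ =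
    dec.adj (sl2.elH F) (dec.mul a b) + (2 : F) • dec.triv (dec.dJ a b) := by
  have := dec.eq_of_weight_zero h2 hι (l := ⁅dec.adj (sl2.elE F) a, dec.adj (sl2.elF F) b⁆) (by
    rw [leibniz_lie, dec.lie_adj h2 hι, dec.lie_adj h2 hι, sl2.lie_H_E, sl2.lie_H_F]
    simp)
  rw [this]
  congr 1
  simp [dJ, h2]

omit h3 in
-- All brackets follow from `[E ⊗ a, F ⊗ b]` because `ad ι(E)` and `ad ι(F)` are derivations that
-- move one tensor factor at a time. For example `F` applied to `[E ⊗ a, H ⊗ b]` gives `2 [E ⊗ a, F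
-- ⊗ b] - [H ⊗ a, H ⊗ b]`.
theorem lie_adj_adj_table (a b : J) :
    ⁅dec.adj (sl2.elE F) a, dec.adj (sl2.elE F) b⁆ = 0 ∧
    ⁅dec.adj (sl2.elE F) a, dec.adj (sl2.elH F) b⁆ = (-2 : F) • dec.adj (sl2.elE F) (dec.mul a b) ∧
    ⁅dec.adj (sl2.elH F) a, dec.adj (sl2.elE F) b⁆ = (2 : F) • dec.adj (sl2.elE F) (dec.mul a b) ∧
    ⁅dec.adj (sl2.elH F) a, dec.adj (sl2.elH F) b⁆ = (4 : F) • dec.triv (dec.dJ a b) ∧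
    ⁅dec.adj (sl2.elH F) a, dec.adj (sl2.elF F) b⁆ = (-2 : F) • dec.adj (sl2.elF F) (dec.mul a b) ∧
    ⁅dec.adj (sl2.elF F) a, dec.adj (sl2.elE F) b⁆ =
      (-1 : F) • dec.adj (sl2.elH F) (dec.mul a b) + (2 : F) • dec.triv (dec.dJ a b) ∧
    ⁅dec.adj (sl2.elF F) a, dec.adj (sl2.elH F) b⁆ = (2 : F) • dec.adj (sl2.elF F) (dec.mul a b) ∧
    ⁅dec.adj (sl2.elF F) a, dec.adj (sl2.elF F) b⁆ = 0 := by
  have hEF := dec.lie_adj_E_adj_F h2 hι a b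
  have lE := dec.lie_adj h2 hι (sl2.elE F)
  have lF := dec.lie_adj h2 hι (sl2.elF F)
  have tE := dec.lie_triv hι (sl2.elE F)
  have tF := dec.lie_triv hι (sl2.elF F)
  have hEH : ⁅dec.adj (sl2.elE F) a, dec.adj (sl2.elH F) b⁆ =
      (-2 : F) • dec.adj (sl2.elE F) (dec.mul a b) := by
    have := congrArg (⁅ι (sl2.elE F), ·⁆) hEF
    simp only [leibniz_lie (ι _), lE, lie_self, sl2.lie_E_F, sl2.lie_E_H, lie_add, lie_smul, tE,
      map_zero, LinearMap.zero_apply, zero_lie, map_smul, LinearMap.smul_apply, smul_zero] at this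
    linear_combination (norm := module) this
  have hHF : ⁅dec.adj (sl2.elH F) a, dec.adj (sl2.elF F) b⁆ =
      (-2 : F) • dec.adj (sl2.elF F) (dec.mul a b) := by
    have := congrArg (⁅ι (sl2.elF F), ·⁆) hEF
    simp only [leibniz_lie (ι _), lF, lie_self, sl2.lie_F_E, sl2.lie_F_H, lie_add, lie_smul, tF,
      map_zero, LinearMap.zero_apply, zero_lie, map_smul, LinearMap.smul_apply, smul_zero,
      smul_lie, lie_zero] at this
    linear_combination (norm := module) -this
  have hEE : ⁅dec.adj (sl2.elE F) a, dec.adj (sl2.elE F) b⁆ = 0 := by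
    have := congrArg (⁅ι (sl2.elE F), ·⁆) hEH
    simp only [leibniz_lie (ι _), lE, lie_self, sl2.lie_E_H, lie_add, lie_smul,
      map_zero, LinearMap.zero_apply, zero_lie, map_smul, LinearMap.smul_apply, smul_zero,
      smul_lie, lie_zero, zero_add] at this
    exact (smul_eq_zero.mp this).resolve_left (neg_ne_zero.mpr h2)
  have hFF : ⁅dec.adj (sl2.elF F) a, dec.adj (sl2.elF F) b⁆ = 0 := by
    have := congrArg (⁅ι (sl2.elF F), ·⁆) hHF
    simp only [leibniz_lie (ι _), lF, lie_self, sl2.lie_F_H, lie_add, lie_smul,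
      map_zero, LinearMap.zero_apply, zero_lie, map_smul, LinearMap.smul_apply, smul_zero,
      smul_lie, lie_zero, add_zero] at this
    exact (smul_eq_zero.mp this).resolve_left h2
  have hHH : ⁅dec.adj (sl2.elH F) a, dec.adj (sl2.elH F) b⁆ = (4 : F) • dec.triv (dec.dJ a b) := by
    have := congrArg (⁅ι (sl2.elF F), ·⁆) hEH
    simp only [leibniz_lie (ι _), lF, lie_self, sl2.lie_F_H, sl2.lie_F_E, lie_add, lie_smul,
      map_zero, LinearMap.zero_apply, zero_lie, map_smul, LinearMap.smul_apply, smul_zero,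
      smul_lie, lie_zero, hEF] at this
    linear_combination (norm := module) -this
  have hHE : ⁅dec.adj (sl2.elH F) a, dec.adj (sl2.elE F) b⁆ =
      (2 : F) • dec.adj (sl2.elE F) (dec.mul a b) := by
    have := congrArg (⁅ι (sl2.elE F), ·⁆) hHH
    simp only [leibniz_lie (ι _), lE, lie_self, sl2.lie_E_H, lie_add, lie_smul, tE,
      map_zero, LinearMap.zero_apply, zero_lie, map_smul, LinearMap.smul_apply, smul_zero,
      smul_lie, lie_zero, hEH, ← smul_add] at this
    have := (smul_eq_zero.mp this).resolve_left (neg_ne_zero.mpr h2)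
    linear_combination (norm := module) this
  have hFE : ⁅dec.adj (sl2.elF F) a, dec.adj (sl2.elE F) b⁆ =
      (-1 : F) • dec.adj (sl2.elH F) (dec.mul a b) + (2 : F) • dec.triv (dec.dJ a b) := by
    have := congrArg (⁅ι (sl2.elF F), ·⁆) hHE
    simp only [leibniz_lie (ι _), lF, lie_self, sl2.lie_F_H, sl2.lie_F_E, lie_add, lie_smul,
      map_zero, LinearMap.zero_apply, zero_lie, map_smul, LinearMap.smul_apply, smul_zero,
      smul_lie, lie_zero, hHH] at this
    apply smul_right_injective L h2
    simp only
    linear_combination (norm := module) this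
  have hFH : ⁅dec.adj (sl2.elF F) a, dec.adj (sl2.elH F) b⁆ =
      (2 : F) • dec.adj (sl2.elF F) (dec.mul a b) := by
    have := congrArg (⁅ι (sl2.elF F), ·⁆) hHH
    simp only [leibniz_lie (ι _), lF, lie_self, sl2.lie_F_H, lie_add, lie_smul, tF,
      map_zero, LinearMap.zero_apply, zero_lie, map_smul, LinearMap.smul_apply, smul_zero,
      smul_lie, lie_zero, hHF, ← smul_add] at this
    have := (smul_eq_zero.mp this).resolve_left h2
    linear_combination (norm := module) this
  exact ⟨hEE, hEH, hHE, hHH, hHF, hFE, hFH, hFF⟩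

omit h3 in
theorem lie_adj_adj (f g : sl2 F) (a b : J) : ⁅dec.adj f a, dec.adj g b⁆ =
    dec.adj ⁅f, g⁆ (dec.mul a b) + dec.triv ((2 * (f.val * g.val).trace) • dec.dJ a b) := by
  obtain ⟨hEE, hEH, hHE, hHH, hHF, hFE, hFH, hFF⟩ := dec.lie_adj_adj_table h2 hι a b
  have hEF := dec.lie_adj_E_adj_F h2 hι a b
  rw [dec.adj_eq_combination f, dec.adj_eq_combination g, dec.adj_eq_combination ⁅f, g⁆]
  simp only [add_lie, lie_add, smul_lie, lie_smul, hEE, hEH, hHE, hHH, hHF, hFE, hFH, hFF, hEF,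
    map_smul, sl2.val_lie, Matrix.trace_fin_two, Matrix.sub_apply, Matrix.mul_apply,
    Fin.sum_univ_two, f.val_one_one, g.val_one_one]
  module

theorem lie_adj_H_nat_vec0 (a : J) (x : T) :
    ⁅dec.adj (sl2.elH F) a, dec.nat (vec0 F) x⁆ = dec.nat (vec0 F) (dec.bul a x) :=
  dec.eq_of_weight_one h2 h3 hι (by
    rw [leibniz_lie, dec.lie_adj h2 hι, dec.lie_nat hι, lie_self, natL_H_vec0]; simp)

theorem lie_adj_nat (f : sl2 F) (a : J) (u : nat2 F) (x : T) :
    ⁅dec.adj f a, dec.nat u x⁆ = dec.nat (f.val.mulVec u) (dec.bul a x) := by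
  have hH0 := dec.lie_adj_H_nat_vec0 h2 h3 hι a x
  have lE := dec.lie_adj h2 hι (sl2.elE F)
  have lF := dec.lie_adj h2 hι (sl2.elF F)
  have nE := dec.lie_nat hι (sl2.elE F)
  have nF := dec.lie_nat hι (sl2.elF F)
  have hE0 : ⁅dec.adj (sl2.elE F) a, dec.nat (vec0 F) x⁆ = 0 := by
    have := congrArg (⁅ι (sl2.elE F), ·⁆) hH0
    simp only [leibniz_lie (ι _), lE, nE, sl2.lie_E_H, natL_E_vec0,
      map_zero, LinearMap.zero_apply, map_smul, LinearMap.smul_apply,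
      smul_lie, lie_zero, add_zero] at this
    exact (smul_eq_zero.mp this).resolve_left (neg_ne_zero.mpr h2)
  have hF0 : ⁅dec.adj (sl2.elF F) a, dec.nat (vec0 F) x⁆ = dec.nat (vec1 F) (dec.bul a x) := by
    have h := dec.eq_of_weight_neg_one h2 h3 hι
      (l := ⁅dec.adj (sl2.elF F) a, dec.nat (vec0 F) x⁆) (by
        rw [leibniz_lie, dec.lie_adj h2 hι, dec.lie_nat hι, sl2.lie_H_F, natL_H_vec0]
        simp only [map_smul, LinearMap.smul_apply, smul_lie]
        module)
    -- The weight only shows that the bracket is `e₁ ⊗ y` for some `y`; raising with `E` identifies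
    -- `y` with `a • x`.
    have := congrArg (⁅ι (sl2.elE F), ·⁆) h
    simp only [leibniz_lie (ι _), lE, nE, sl2.lie_E_F, natL_E_vec0, natL_E_vec1,
      map_zero, LinearMap.zero_apply, lie_zero, add_zero, hH0] at this
    have := congrArg (dec.coordT 0) this
    simp only [coordT_nat, vec0_zero, one_smul] at this
    rw [h, ← this]
  have hH1 : ⁅dec.adj (sl2.elH F) a, dec.nat (vec1 F) x⁆ =
      (-1 : F) • dec.nat (vec1 F) (dec.bul a x) := by
    have := congrArg (⁅ι (sl2.elF F), ·⁆) hH0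
    simp only [leibniz_lie (ι _), lF, nF, sl2.lie_F_H, natL_F_vec0, map_smul,
      LinearMap.smul_apply, smul_lie, hF0] at this
    linear_combination (norm := module) this
  have hF1 : ⁅dec.adj (sl2.elF F) a, dec.nat (vec1 F) x⁆ = 0 := by
    have := congrArg (⁅ι (sl2.elF F), ·⁆) hF0
    simpa only [leibniz_lie (ι _), lF, nF, lie_self, natL_F_vec0, natL_F_vec1, map_zero,
      LinearMap.zero_apply, zero_lie, zero_add] using this
  have hE1 : ⁅dec.adj (sl2.elE F) a, dec.nat (vec1 F) x⁆ = dec.nat (vec0 F) (dec.bul a x) := by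
    have := congrArg (⁅ι (sl2.elE F), ·⁆) hH1
    simp only [leibniz_lie (ι _), lE, nE, sl2.lie_E_H, natL_E_vec1, map_smul,
      LinearMap.smul_apply, smul_lie, hH0, lie_smul] at this
    apply smul_right_injective L h2
    simp only
    linear_combination (norm := module) -this
  rw [dec.adj_eq_combination f, dec.nat_eq_combination u, dec.nat_eq_combination (f.val.mulVec u)]
  simp only [add_lie, lie_add, smul_lie, lie_smul, hH0, hH1, hE0, hE1, hF0, hF1, Matrix.mulVec,
    dotProduct, Fin.sum_univ_two, f.val_one_one]
  module

omit h3 in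
theorem lie_nat_nat (u : nat2 F) (x : T) (v : nat2 F) (y : T) : ⁅dec.nat u x, dec.nat v y⁆ =
    dec.adj (gam u v) (dec.ang x y) + dec.triv (form u v • dec.dT x y) := by
  have nE := dec.lie_nat hι (sl2.elE F)
  have nF := dec.lie_nat hι (sl2.elF F)
  have lE := dec.lie_adj h2 hι (sl2.elE F)
  have lF := dec.lie_adj h2 hι (sl2.elF F)
  have tE := dec.lie_triv hι (sl2.elE F)
  have tF := dec.lie_triv hι (sl2.elF F)
  have h01 : ⁅dec.nat (vec0 F) x, dec.nat (vec1 F) y⁆ =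
      (-1 : F) • dec.adj (sl2.elH F) (dec.ang x y) + dec.triv (dec.dT x y) := by
    rw [dec.eq_of_weight_zero h2 hι (l := ⁅dec.nat (vec0 F) x, dec.nat (vec1 F) y⁆) (by
      rw [leibniz_lie, dec.lie_nat hι, dec.lie_nat hι, natL_H_vec0, natL_H_vec1, map_smul,
        LinearMap.smul_apply, lie_smul]
      module)]
    congr 1
    simp only [ang, vec0, vec1, LinearMap.mk₂_apply, map_neg, projJ_eq]
    module
  have h00 : ⁅dec.nat (vec0 F) x, dec.nat (vec0 F) y⁆ =
      (2 : F) • dec.adj (sl2.elE F) (dec.ang x y) := by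
    have := congrArg (⁅ι (sl2.elE F), ·⁆) h01
    simp only [leibniz_lie (ι _), lE, nE, tE, sl2.lie_E_H, natL_E_vec0, natL_E_vec1, map_smul,
      map_zero, LinearMap.zero_apply, zero_lie, lie_add,
      LinearMap.smul_apply, lie_smul] at this
    linear_combination (norm := module) this
  have h11 : ⁅dec.nat (vec1 F) x, dec.nat (vec1 F) y⁆ =
      (-2 : F) • dec.adj (sl2.elF F) (dec.ang x y) := by
    have := congrArg (⁅ι (sl2.elF F), ·⁆) h01
    simp only [leibniz_lie (ι _), lF, nF, tF, sl2.lie_F_H, natL_F_vec0, natL_F_vec1, map_smul,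
      map_zero, LinearMap.zero_apply, lie_zero, lie_add,
      LinearMap.smul_apply, lie_smul] at this
    linear_combination (norm := module) this
  have h10 : ⁅dec.nat (vec1 F) x, dec.nat (vec0 F) y⁆ =
      (-1 : F) • dec.adj (sl2.elH F) (dec.ang x y) - dec.triv (dec.dT x y) := by
    have := congrArg (⁅ι (sl2.elF F), ·⁆) h00
    simp only [leibniz_lie (ι _), lF, nF, sl2.lie_F_E, natL_F_vec0, map_smul,
      LinearMap.smul_apply, lie_smul, h01] at this
    linear_combination (norm := module) this
  rw [dec.nat_eq_combination u, dec.nat_eq_combination v, dec.adj_eq_combination (gam u v)]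
  simp only [add_lie, lie_add, smul_lie, lie_smul, h00, h01, h10, h11, form, gam, map_smul,
    sl2.val_mk, Matrix.add_apply, Matrix.vecMulVec_apply, Matrix.cons_val_zero,
    Matrix.cons_val_one]
  module

omit h3 in
-- Bracketing with `d` commutes with `ι(𝔰𝔩₂)`. The weight zero vector `[d, H ⊗ a]` might still have
-- a component in `D`; applying `E` kills it, and lowering back from `E ⊗ d(a)` shows that it was
-- zero.
theorem lie_triv_adj (d : D) (f : sl2 F) (a : J) :
    ⁅dec.triv d, dec.adj f a⁆ = dec.adj f (dec.actJ d a) := by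
  have tl : ∀ X, ⁅dec.triv d, ι X⁆ = 0 := fun X => by
    rw [← lie_skew, dec.lie_triv hι, neg_zero]
  have tX : ∀ (X : sl2 F) (l : L), ⁅ι X, ⁅dec.triv d, l⁆⁆ = ⁅dec.triv d, ⁅ι X, l⁆⁆ := fun X l => by
    rw [leibniz_lie, dec.lie_triv hι, zero_lie, zero_add]
  have h := dec.eq_of_weight_zero h2 hι (l := ⁅dec.triv d, dec.adj (sl2.elH F) a⁆) (by
    rw [tX, dec.lie_adj h2 hι, lie_self]; simp)
  rw [show dec.coordJ 0 0 ⁅dec.triv d, dec.adj (sl2.elH F) a⁆ = dec.actJ d a from rfl] at h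
  have hE : ⁅dec.triv d, dec.adj (sl2.elE F) a⁆ = dec.adj (sl2.elE F) (dec.actJ d a) := by
    have := congrArg (⁅ι (sl2.elE F), ·⁆) h
    simp only [tX, dec.lie_adj h2 hι, sl2.lie_E_H, lie_add, dec.lie_triv hι, map_smul,
      LinearMap.smul_apply, lie_smul, add_zero] at this
    exact smul_right_injective L (neg_ne_zero.mpr h2) this
  have hF : ⁅dec.triv d, dec.adj (sl2.elF F) a⁆ = dec.adj (sl2.elF F) (dec.actJ d a) := by
    have := congrArg (⁅ι (sl2.elF F), ·⁆) h
    simp only [tX, dec.lie_adj h2 hι, sl2.lie_F_H, lie_add, dec.lie_triv hι, map_smul,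
      LinearMap.smul_apply, lie_smul, add_zero] at this
    exact smul_right_injective L h2 this
  have hH : ⁅dec.triv d, dec.adj (sl2.elH F) a⁆ = dec.adj (sl2.elH F) (dec.actJ d a) := by
    have := congrArg (⁅ι (sl2.elF F), ·⁆) hE
    simp only [tX, dec.lie_adj h2 hι, sl2.lie_F_E, map_smul,
      LinearMap.smul_apply, lie_smul] at this
    exact smul_right_injective L (neg_ne_zero.mpr one_ne_zero) this
  rw [dec.adj_eq_combination f, dec.adj_eq_combination f (dec.actJ d a)]
  simp only [lie_add, lie_smul, hE, hF, hH]

theorem lie_triv_nat (d : D) (u : nat2 F) (x : T) :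
    ⁅dec.triv d, dec.nat u x⁆ = dec.nat u (dec.actT d x) := by
  have tX : ∀ (X : sl2 F) (l : L), ⁅ι X, ⁅dec.triv d, l⁆⁆ = ⁅dec.triv d, ⁅ι X, l⁆⁆ := fun X l => by
    rw [leibniz_lie, dec.lie_triv hι, zero_lie, zero_add]
  have h0 : ⁅dec.triv d, dec.nat (vec0 F) x⁆ = dec.nat (vec0 F) (dec.actT d x) :=
    dec.eq_of_weight_one h2 h3 hι (by rw [tX, dec.lie_nat hι, natL_H_vec0])
  have h1 : ⁅dec.triv d, dec.nat (vec1 F) x⁆ = dec.nat (vec1 F) (dec.actT d x) := by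
    have := congrArg (⁅ι (sl2.elF F), ·⁆) h0
    simpa only [tX, dec.lie_nat hι, natL_F_vec0] using this
  rw [dec.nat_eq_combination u, dec.nat_eq_combination u (dec.actT d x)]
  simp only [lie_add, lie_smul, h0, h1]

end ShortDecomposition

namespace ShortDecomposition

variable {F : Type u} [Field F] {L : Type v} [LieRing L] [LieAlgebra F L]
variable {Ψ : GStructure (SL2 F) L} {J T D : Type*}
  [AddCommGroup J] [Module F J] [AddCommGroup T] [Module F T] [AddCommGroup D] [Module F D]
  (dec : ShortDecomposition Ψ J T D) {ι : sl2 F →ₗ⁅F⁆ L}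
  (h2 : (2 : F) ≠ 0) (h3 : (3 : F) ≠ 0) (hι : IsInnerSL2 Ψ ι)

/-! ### Injectivity of the coordinates -/

theorem adj_injective {f : sl2 F} (hf : f ≠ 0) : Function.Injective (dec.adj f) := by
  rw [injective_iff_map_eq_zero]
  intro a ha
  by_contra h0
  apply hf
  have h : ∀ i j, f.val i j = 0 := fun i j => by
    have := congrArg (dec.coordJ i j) ha
    rw [coordJ_adj, map_zero] at this
    exact (smul_eq_zero.mp this).resolve_right h0
  rw [f.eq_combination]
  simp [h]

theorem nat_injective {u : nat2 F} (hu : u ≠ 0) : Function.Injective (dec.nat u) := by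
  rw [injective_iff_map_eq_zero]
  intro a ha
  by_contra h0
  apply hu
  ext i
  have := congrArg (dec.coordT i) ha
  rw [coordT_nat, map_zero] at this
  exact (smul_eq_zero.mp this).resolve_right h0

theorem triv_injective : Function.Injective dec.triv :=
  Function.LeftInverse.injective (g := dec.projD) dec.projD_triv

theorem elE_ne_zero : sl2.elE F ≠ 0 := fun h => by
  have := congrArg (fun X => sl2.val X 0 1) h
  simp [sl2.elE] at this

theorem vec0_ne_zero : vec0 F ≠ 0 := fun h => by
  have := congrFun h 0
  simp at this

include h2 h3 hι

/-! ### Identities for the coordinate maps -/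

omit h3 in
-- The brackets of `L` and of 𝔰𝔩₂ are both skew, so the product is symmetric. Since `tr(fg)` is
-- symmetric, the same comparison makes `dJ` skew in `dJ_skew`.
theorem mul_comm' (a b : J) : dec.mul a b = dec.mul b a := by
  have h := (dec.lie_adj_adj_table h2 hι a b).2.1
  have h' := (dec.lie_adj_adj_table h2 hι b a).2.2.1
  rw [← lie_skew, h'] at h
  have : (2 : F) • dec.adj (sl2.elE F) (dec.mul b a) =
      (2 : F) • dec.adj (sl2.elE F) (dec.mul a b) := by
    linear_combination (norm := module) -h
  exact (dec.adj_injective elE_ne_zero (smul_right_injective L h2 this)).symm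

theorem one_mul' (a : J) : dec.mul (dec.one ι) a = a := by
  have h := (dec.lie_adj_adj_table h2 hι (dec.one ι) a).2.2.1
  rw [← dec.inner_eq h2 h3 hι, dec.lie_adj h2 hι, sl2.lie_H_E, map_smul, LinearMap.smul_apply] at h
  exact (dec.adj_injective elE_ne_zero (smul_right_injective L h2 h)).symm

theorem dJ_one (a : J) : dec.dJ (dec.one ι) a = 0 := by
  have h := (dec.lie_adj_adj_table h2 hι (dec.one ι) a).2.2.2.1
  rw [← dec.inner_eq h2 h3 hι, dec.lie_adj h2 hι, lie_self, map_zero, LinearMap.zero_apply] at h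
  have h4 : (4 : F) ≠ 0 := by
    rw [show (4 : F) = 2 * 2 by norm_num]; exact mul_ne_zero h2 h2
  have := (smul_eq_zero.mp h.symm).resolve_left h4
  exact dec.triv_injective (by rw [this, map_zero])

omit h3 in
theorem dJ_skew (a b : J) : dec.dJ a b = -dec.dJ b a := by
  have h := (dec.lie_adj_adj_table h2 hι a b).2.2.2.1
  have h' := (dec.lie_adj_adj_table h2 hι b a).2.2.2.1
  rw [← lie_skew, h'] at h
  have h4 : (4 : F) ≠ 0 := by
    rw [show (4 : F) = 2 * 2 by norm_num]; exact mul_ne_zero h2 h2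
  rw [← smul_neg, ← map_neg] at h
  exact (dec.triv_injective (smul_right_injective L h4 h)).symm

omit h3 in
/-- `D_{a,b}` acts on `J` as the commutator of the multiplications by `a` and `b`. -/
theorem actJ_dJ (a b c : J) : dec.actJ (dec.dJ a b) c =
    dec.mul a (dec.mul b c) - dec.mul b (dec.mul a c) := by
  have h := leibniz_lie (dec.adj (sl2.elH F) a) (dec.adj (sl2.elH F) b) (dec.adj (sl2.elE F) c)
  simp only [(dec.lie_adj_adj_table h2 hι _ _).2.2.1, (dec.lie_adj_adj_table h2 hι _ _).2.2.2.1,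
    lie_smul, smul_lie, dec.lie_triv_adj h2 hι] at h
  have h := congrArg (dec.coordJ 0 1) h
  simp [sl2.elE] at h
  have h4 : (4 : F) ≠ 0 := by
    rw [show (4 : F) = 2 * 2 by norm_num]; exact mul_ne_zero h2 h2
  apply smul_right_injective J h4
  simp only
  linear_combination (norm := module) -h

omit h3 in
-- This is the `D`-component of the Jacobi identity for `E ⊗ a`, `F ⊗ b`, `H ⊗ c`. It is the source
-- of the Jordan identity and of the whole Peirce calculus below.
theorem dJ_cyclic (a b c : J) :
    dec.dJ (dec.mul a b) c + dec.dJ (dec.mul b c) a + dec.dJ (dec.mul c a) b = 0 := by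
  have h := leibniz_lie (dec.adj (sl2.elE F) a) (dec.adj (sl2.elF F) b) (dec.adj (sl2.elH F) c)
  have h := congrArg dec.projD h
  simp only [dec.lie_adj_adj h2 hι, lie_add, add_lie, dec.lie_triv_adj h2 hι, map_add, projD_adj,
    projD_triv, sl2.lie_F_H, sl2.lie_E_H, sl2.lie_E_F, map_smul, LinearMap.smul_apply, lie_smul,
    smul_lie] at h
  simp only [← lie_skew _ (dec.triv _), dec.lie_triv_adj h2 hι, map_neg, projD_adj] at h
  simp [sl2.elE, sl2.elF, sl2.elH, Matrix.trace_fin_two] at h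
  rw [dec.dJ_skew h2 hι a, dec.dJ_skew h2 hι b, dec.mul_comm' h2 hι a c] at h
  have h4 : (4 : F) ≠ 0 := by
    rw [show (4 : F) = 2 * 2 by norm_num]; exact mul_ne_zero h2 h2
  apply smul_right_injective D h4
  simp only [smul_zero]
  linear_combination (norm := module) -h

/-- Three equal arguments in `dJ_cyclic` give `3 D_{a²,a} = 0`, hence `D_{a²,a} = 0`; by `actJ_dJ`
the multiplications by `a²` and by `a` commute. -/
theorem jordan (a b : J) : dec.mul (dec.mul a b) (dec.mul a a) =
    dec.mul a (dec.mul b (dec.mul a a)) := by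
  have h := dec.dJ_cyclic h2 hι a a a
  have h0 : dec.dJ (dec.mul a a) a = 0 := by
    apply smul_right_injective D h3
    simp only [smul_zero]
    linear_combination (norm := module) h
  have h := dec.actJ_dJ h2 hι (dec.mul a a) a b
  rw [h0, map_zero, LinearMap.zero_apply, eq_comm, sub_eq_zero] at h
  rw [dec.mul_comm' h2 hι _ (dec.mul a a), h, dec.mul_comm' h2 hι b]

theorem one_bul' (x : T) : dec.bul (dec.one ι) x = x := by
  have h := dec.lie_adj_H_nat_vec0 h2 h3 hι (dec.one ι) x
  rw [← dec.inner_eq h2 h3 hι, dec.lie_nat hι, natL_H_vec0] at h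
  exact (dec.nat_injective vec0_ne_zero h).symm

/-- The Jacobi identity for `H ⊗ a`, `E ⊗ b`, `e₁ ⊗ x`: here `[H ⊗ a, E ⊗ b] = 2 E ⊗ (a·b)`, and `H`
acts by `1` on `e₀` and by `-1` on `e₁`, which turns the commutator into an anticommutator. -/
theorem special (a b : J) (x : T) : dec.bul (dec.mul a b) x =
    (2⁻¹ : F) • (dec.bul a (dec.bul b x) + dec.bul b (dec.bul a x)) := by
  have h := leibniz_lie (dec.adj (sl2.elH F) a) (dec.adj (sl2.elE F) b) (dec.nat (vec1 F) x)
  simp only [(dec.lie_adj_adj_table h2 hι _ _).2.2.1, smul_lie, dec.lie_adj_nat h2 h3 hι,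
    ← sl2.natL_apply, natL_H_vec0, natL_H_vec1, natL_E_vec1, map_smul, LinearMap.smul_apply,
    lie_smul] at h
  have h := congrArg (dec.coordT 0) h
  simp at h
  rw [eq_inv_smul_iff₀ h2]
  linear_combination (norm := module) -h

/-- `4 D_{a,b}` acts on `T` as the commutator of the actions of `a` and `b`. -/
theorem actT_dJ (a b : J) (x : T) : (4 : F) • dec.actT (dec.dJ a b) x =
    dec.bul a (dec.bul b x) - dec.bul b (dec.bul a x) := by
  have h := leibniz_lie (dec.adj (sl2.elH F) a) (dec.adj (sl2.elH F) b) (dec.nat (vec0 F) x)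
  simp only [(dec.lie_adj_adj_table h2 hι _ _).2.2.2.1, smul_lie, dec.lie_adj_nat h2 h3 hι,
    ← sl2.natL_apply, natL_H_vec0, dec.lie_triv_nat h2 h3 hι] at h
  have h := congrArg (dec.coordT 0) h
  simp at h
  linear_combination (norm := module) -h

omit h3 in
theorem lie_nat_vec0_vec0 (x y : T) : ⁅dec.nat (vec0 F) x, dec.nat (vec0 F) y⁆ =
    (2 : F) • dec.adj (sl2.elE F) (dec.ang x y) := by
  have : gam (vec0 F) (vec0 F) = (2 : F) • sl2.elE F := by
    apply sl2.ext; ext i j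
    fin_cases i <;> fin_cases j <;> norm_num [gam, sl2.elE, Matrix.vecMulVec_apply]
  rw [dec.lie_nat_nat h2 hι, this, show form (vec0 F) (vec0 F) = 0 by simp [form]]
  simp

omit h3 in
theorem lie_nat_vec0_vec1 (x y : T) : ⁅dec.nat (vec0 F) x, dec.nat (vec1 F) y⁆ =
    (-1 : F) • dec.adj (sl2.elH F) (dec.ang x y) + dec.triv (dec.dT x y) := by
  have : gam (vec0 F) (vec1 F) = (-1 : F) • sl2.elH F := by
    apply sl2.ext; ext i j
    fin_cases i <;> fin_cases j <;> norm_num [gam, sl2.elH, Matrix.vecMulVec_apply]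
  rw [dec.lie_nat_nat h2 hι, this, show form (vec0 F) (vec1 F) = 1 by simp [form]]
  simp

omit h3 in
-- Since `γ_{u,v}` is symmetric and `(u|v)` is skew in `u, v`, skewness of the bracket makes `ang`
-- skew and, in `dT_symm`, `dT` symmetric.
theorem ang_skew (x y : T) : dec.ang x y = -dec.ang y x := by
  have h := dec.lie_nat_vec0_vec0 h2 hι x y
  rw [← lie_skew, dec.lie_nat_vec0_vec0 h2 hι, ← smul_neg, ← map_neg] at h
  exact (dec.adj_injective elE_ne_zero (smul_right_injective L h2 h)).symm

omit h3 in
theorem dT_symm (x y : T) : dec.dT x y = dec.dT y x := by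
  have h := congrArg dec.projD (lie_skew (dec.nat (vec0 F) x) (dec.nat (vec1 F) y))
  simp only [dec.lie_nat_nat h2 hι, map_add, map_neg, projD_adj, projD_triv] at h
  simpa [form] using h.symm

theorem mul_ang (a : J) (x y : T) : dec.mul a (dec.ang x y) =
    (2⁻¹ : F) • (dec.ang (dec.bul a x) y + dec.ang x (dec.bul a y)) := by
  have h := leibniz_lie (dec.adj (sl2.elH F) a) (dec.nat (vec0 F) x) (dec.nat (vec0 F) y)
  simp only [(dec.lie_adj_adj_table h2 hι _ _).2.2.1, lie_smul, dec.lie_adj_nat h2 h3 hι,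
    ← sl2.natL_apply, natL_H_vec0, dec.lie_nat_vec0_vec0 h2 hι, ← smul_add, ← map_add] at h
  have h := congrArg (dec.coordJ 0 1) (smul_right_injective L h2 h)
  simp [sl2.elE] at h
  rw [eq_inv_smul_iff₀ h2, h]

/-- These are the `H ⊗ J` and `D` components of a single Jacobi identity, for `H ⊗ a`, `e₀ ⊗ x`, `e₁
⊗ y`. -/
theorem actJ_dT_and (a : J) (x y : T) :
    dec.actJ (dec.dT x y) a = dec.ang (dec.bul a x) y - dec.ang x (dec.bul a y) ∧
    dec.dT (dec.bul a x) y - dec.dT x (dec.bul a y) = (-4 : F) • dec.dJ a (dec.ang x y) := by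
  have h := leibniz_lie (dec.adj (sl2.elH F) a) (dec.nat (vec0 F) x) (dec.nat (vec1 F) y)
  simp only [(dec.lie_adj_adj_table h2 hι _ _).2.2.2.1, lie_smul, dec.lie_adj_nat h2 h3 hι,
    ← sl2.natL_apply, natL_H_vec0, natL_H_vec1, dec.lie_nat_vec0_vec1 h2 hι, lie_add,
    map_smul, LinearMap.smul_apply, ← lie_skew _ (dec.triv _), dec.lie_triv_adj h2 hι] at h
  constructor
  · have := congrArg (dec.coordJ 0 0) h
    simp [sl2.elH] at this
    linear_combination (norm := module) -this
  · have := congrArg dec.projD h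
    simp at this
    linear_combination (norm := module) -this

theorem actJ_dT (a : J) (x y : T) :
    dec.actJ (dec.dT x y) a = dec.ang (dec.bul a x) y - dec.ang x (dec.bul a y) :=
  (dec.actJ_dT_and h2 h3 hι a x y).1

/-- The `D`-component in `actJ_dT_and`, made to act on `T`; by `actT_dJ` the term `4 D_{a,⟨x|y⟩}`
becomes a commutator of actions. -/
theorem actT_dT_bul (a : J) (x y z : T) :
    dec.actT (dec.dT (dec.bul a x) y) z - dec.actT (dec.dT x (dec.bul a y)) z =
      dec.bul (dec.ang x y) (dec.bul a z) - dec.bul a (dec.bul (dec.ang x y) z) := by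
  have h := congrArg (fun d => dec.actT d z) (dec.actJ_dT_and h2 h3 hι a x y).2
  simp only [map_sub, map_smul, LinearMap.sub_apply, LinearMap.smul_apply] at h
  linear_combination (norm := module) h - dec.actT_dJ h2 h3 hι a (dec.ang x y) z

/-- Elements of `D` act as derivations. -/
theorem actT_bul (d : D) (a : J) (x : T) : dec.actT d (dec.bul a x) =
    dec.bul (dec.actJ d a) x + dec.bul a (dec.actT d x) := by
  have h := leibniz_lie (dec.triv d) (dec.adj (sl2.elH F) a) (dec.nat (vec0 F) x)
  simp only [dec.lie_adj_nat h2 h3 hι, ← sl2.natL_apply, natL_H_vec0, dec.lie_triv_nat h2 h3 hι,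
    dec.lie_triv_adj h2 hι, ← map_add] at h
  exact dec.nat_injective vec0_ne_zero h

omit h3 in
theorem actJ_mul (d : D) (a b : J) : dec.actJ d (dec.mul a b) =
    dec.mul (dec.actJ d a) b + dec.mul a (dec.actJ d b) := by
  have h := leibniz_lie (dec.triv d) (dec.adj (sl2.elH F) a) (dec.adj (sl2.elE F) b)
  simp only [(dec.lie_adj_adj_table h2 hι _ _).2.2.1, dec.lie_triv_adj h2 hι, lie_smul, ← map_add,
    ← smul_add] at h
  exact dec.adj_injective elE_ne_zero (smul_right_injective L h2 h)

theorem actJ_ang (d : D) (x y : T) : dec.actJ d (dec.ang x y) =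
    dec.ang (dec.actT d x) y + dec.ang x (dec.actT d y) := by
  have h := leibniz_lie (dec.triv d) (dec.nat (vec0 F) x) (dec.nat (vec0 F) y)
  simp only [dec.lie_nat_vec0_vec0 h2 hι, dec.lie_triv_adj h2 hι, dec.lie_triv_nat h2 h3 hι,
    lie_smul, ← map_add, ← smul_add] at h
  exact dec.adj_injective elE_ne_zero (smul_right_injective L h2 h)

/-- By `actJ_ang` the `J`-components of the Jacobi identity cancel, leaving `[d, d_{x,y}] = d_{dx,y}
+ d_{x,dy}` in `L`; this is then applied to `e₀ ⊗ z`. -/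
theorem actT_actT_dT (d : D) (x y z : T) : dec.actT d (dec.actT (dec.dT x y) z) =
    dec.actT (dec.dT x y) (dec.actT d z) + dec.actT (dec.dT (dec.actT d x) y) z +
      dec.actT (dec.dT x (dec.actT d y)) z := by
  have h := leibniz_lie (dec.triv d) (dec.nat (vec0 F) x) (dec.nat (vec1 F) y)
  simp only [dec.lie_nat_vec0_vec1 h2 hι, dec.lie_triv_nat h2 h3 hι, lie_add, lie_smul,
    dec.lie_triv_adj h2 hι, dec.actJ_ang h2 h3 hι, map_add, smul_add] at h
  have h' : ⁅dec.triv d, dec.triv (dec.dT x y)⁆ =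
      dec.triv (dec.dT (dec.actT d x) y) + dec.triv (dec.dT x (dec.actT d y)) := by
    linear_combination (norm := module) h
  have := leibniz_lie (dec.triv d) (dec.triv (dec.dT x y)) (dec.nat (vec0 F) z)
  simp only [h', add_lie, dec.lie_triv_nat h2 h3 hι, ← map_add] at this
  rw [dec.nat_injective vec0_ne_zero this, map_add, LinearMap.add_apply]
  abel

/-- The Jacobi identity for `e₀ ⊗ z`, `e₀ ⊗ x`, `e₁ ⊗ y`. The coefficient 2 comes from `γ_{e₀,e₀} =
2E`. It becomes the axiom `jt3`. -/
theorem actT_dT_cyclic (x y z : T) : dec.actT (dec.dT x y) z - dec.bul (dec.ang x y) z =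
    dec.actT (dec.dT z y) x - dec.bul (dec.ang z y) x + (2 : F) • dec.bul (dec.ang x z) y := by
  have h := leibniz_lie (dec.nat (vec0 F) z) (dec.nat (vec0 F) x) (dec.nat (vec1 F) y)
  simp only [dec.lie_nat_vec0_vec0 h2 hι, dec.lie_nat_vec0_vec1 h2 hι, lie_add, lie_smul, smul_lie,
    ← lie_skew _ (dec.triv _), ← lie_skew _ (dec.adj _ _), dec.lie_adj_nat h2 h3 hι,
    dec.lie_triv_nat h2 h3 hι, ← sl2.natL_apply, natL_H_vec0, natL_E_vec1] at h
  have h := congrArg (dec.coordT 0) h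
  simp only [map_smul, map_add, map_neg, coordT_nat, vec0_zero, one_smul,
    dec.ang_skew h2 hι z x, LinearMap.neg_apply] at h
  linear_combination (norm := module) -h

omit h2 h3 hι in
theorem trip_apply (x y z : T) : dec.trip x y z =
    (2⁻¹ : F) • (-dec.actT (dec.dT x y) z + dec.bul (dec.ang x y) z) := rfl

theorem isJTernary : IsJTernary dec.mul (dec.one ι) dec.bul dec.ang dec.trip where
  mul_comm := dec.mul_comm' h2 hι
  one_mul := dec.one_mul' h2 h3 hι
  jordan := dec.jordan h2 h3 hι
  one_bul := dec.one_bul' h2 h3 hι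
  special := dec.special h2 h3 hι
  ang_skew := dec.ang_skew h2 hι
  jt1 := dec.mul_ang h2 h3 hι
  jt2 a x y z := by
    simp only [trip_apply, map_smul, map_add, map_neg, dec.actT_bul h2 h3 hι,
      dec.actJ_dT h2 h3 hι, map_sub, LinearMap.sub_apply]
    linear_combination (norm := module) (2⁻¹ : F) • dec.actT_dT_bul h2 h3 hι a x y z
  jt3 x y z := by
    simp only [trip_apply]
    apply smul_right_injective T h2
    simp only [smul_sub, smul_smul, mul_inv_cancel₀ h2]
    linear_combination (norm := module) -dec.actT_dT_cyclic h2 h3 hι x y z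
  jt4 x y z := by
    simp only [trip_apply, dec.dT_symm h2 hι y x, dec.ang_skew h2 hι y x, map_neg,
      LinearMap.neg_apply]
    match_scalars <;> field_simp <;> ring
  -- The derivation `d_{x,y}` is applied to `⟨z|w⟩`, and `jt1` is used twice: to multiply `⟨z|w⟩` by
  -- `⟨x|y⟩` and `⟨x|y⟩` by `⟨z|w⟩`. The two products agree by commutativity.
  jt5 x y z w := by
    simp only [trip_apply, map_smul, map_add, map_neg, LinearMap.smul_apply, LinearMap.add_apply,
      LinearMap.neg_apply]
    have h₁ := dec.actJ_ang h2 h3 hι (dec.dT x y) z w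
    rw [dec.actJ_dT h2 h3 hι] at h₁
    have h₂ := dec.mul_ang h2 h3 hι (dec.ang x y) z w
    have h₃ := dec.mul_ang h2 h3 hι (dec.ang z w) x y
    rw [dec.mul_comm' h2 hι] at h₃
    have : dec.ang x (dec.bul (dec.ang z w) y) =
        (2⁻¹ : F) • ((2 : F) • dec.ang x (dec.bul (dec.ang z w) y)) := by
      rw [smul_smul, inv_mul_cancel₀ h2, one_smul]
    rw [this]
    linear_combination (norm := module) (2⁻¹ : F) • h₁ - h₂ + h₃
  -- In `{x,y,·} = ½(-d_{x,y} + ⟨x|y⟩•)` the first term acts as a derivation of the triple product.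
  -- The second is controlled by `actT_dT_bul` and `actJ_dT` with `a = ⟨x|y⟩`, and swapping `x` and
  -- `y` reverses only its sign.
  jt6 x y z w v := by
    simp only [trip_apply, map_smul, map_add, map_neg, LinearMap.smul_apply, LinearMap.add_apply,
      LinearMap.neg_apply, dec.dT_symm h2 hι y x, dec.ang_skew h2 hι y x,
      dec.actT_actT_dT h2 h3 hι (dec.dT x y) z w v, dec.actT_bul h2 h3 hι,
      dec.actJ_ang h2 h3 hι (dec.dT x y) z w]
    have h₁ := dec.actT_dT_bul h2 h3 hι (dec.ang x y) z w v
    have h₂ := congrArg (fun a => dec.bul a v) (dec.actJ_dT h2 h3 hι (dec.ang x y) z w)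
    simp only [map_sub, LinearMap.sub_apply] at h₂
    linear_combination (norm := module) (2⁻¹ : F) • (2⁻¹ : F) • h₁ + (2⁻¹ : F) • (2⁻¹ : F) • h₂

theorem isCoordinatization : dec.IsCoordinatization ι where
  inner := dec.inner_eq h2 h3 hι
  adj_adj := dec.lie_adj_adj h2 hι
  adj_nat := dec.lie_adj_nat h2 h3 hι
  nat_nat := dec.lie_nat_nat h2 hι
  triv_adj := dec.lie_triv_adj h2 hι
  triv_nat := dec.lie_triv_nat h2 h3 hι
  jternary := dec.isJTernary h2 h3 hι

end ShortDecomposition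

/-! ### The tensor square of the natural module -/

section Square

variable {F : Type u} [Field F]

/-- The restriction of a representation of `SL₂ × SL₂` to the diagonal. -/
def GroupRep.diag {M : Type v} [AddCommGroup M] [Module F M] (ρ : GroupRep (SL2SL2 F) M) :
    GroupRep (SL2 F) M where
  act R _ _ := (ρ.act R).comp
    ((MonoidHom.id ((SL2 F).pts R)).prod (MonoidHom.id ((SL2 F).pts R)))
  natural φ g x := ρ.natural φ (g, g) x

theorem Equivariant.diag {M : Type v} [AddCommGroup M] [Module F M] {N : Type w} [AddCommGroup N]
    [Module F N] {σ : GroupRep (SL2SL2 F) M} {ρ : GroupRep (SL2SL2 F) N} {φ : M →ₗ[F] N}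
    (h : Equivariant σ ρ φ) : Equivariant σ.diag ρ.diag φ :=
  fun R _ _ g x => h R (g, g) x

variable (F) in
/-- Twice the equivariant section of `u ⊗ v ↦ ½ γ_{u,v}`. -/
def sqAdj : sl2 F →ₗ[F] nat2 F ⊗[F] nat2 F :=
  (sl2.entry F 0 1).smulRight (vec0 F ⊗ₜ vec0 F) - (sl2.entry F 1 0).smulRight (vec1 F ⊗ₜ vec1 F) -
    (sl2.entry F 0 0).smulRight (vec0 F ⊗ₜ vec1 F + vec1 F ⊗ₜ vec0 F)

variable (F) in
/-- The invariant of the tensor square of the natural module. -/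
def sqInv : nat2 F ⊗[F] nat2 F := vec0 F ⊗ₜ vec1 F - vec1 F ⊗ₜ vec0 F

theorem sqAdj_apply (f : sl2 F) : sqAdj F f = f.val 0 1 • (vec0 F ⊗ₜ vec0 F) -
    f.val 1 0 • (vec1 F ⊗ₜ vec1 F) - f.val 0 0 • (vec0 F ⊗ₜ vec1 F + vec1 F ⊗ₜ vec0 F) := rfl

variable (F) in
/-- The map `u ⊗ v ↦ γ_{u,v}`. -/
def sqGam : nat2 F ⊗[F] nat2 F →ₗ[F] sl2 F :=
  TensorProduct.lift (LinearMap.mk₂ F gam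
    (fun _ _ _ => sl2.ext (by ext i j; fin_cases i <;> fin_cases j <;> simp [gam] <;> ring))
    (fun _ _ _ => sl2.ext (by ext i j; fin_cases i <;> fin_cases j <;> simp [gam] <;> ring))
    (fun _ _ _ => sl2.ext (by ext i j; fin_cases i <;> fin_cases j <;> simp [gam] <;> ring))
    (fun _ _ _ => sl2.ext (by ext i j; fin_cases i <;> fin_cases j <;> simp [gam] <;> ring)))

variable (F) in
/-- The map `u ⊗ v ↦ (u | v)`. -/
def sqForm : nat2 F ⊗[F] nat2 F →ₗ[F] F :=
  TensorProduct.lift (LinearMap.mk₂ F form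
    (fun _ _ _ => by simp [form]; ring) (fun _ _ _ => by simp [form]; ring)
    (fun _ _ _ => by simp [form]; ring) (fun _ _ _ => by simp [form]; ring))

@[simp] theorem sqGam_tmul (u v : nat2 F) : sqGam F (u ⊗ₜ v) = gam u v := rfl
@[simp] theorem sqForm_tmul (u v : nat2 F) : sqForm F (u ⊗ₜ v) = form u v := rfl

theorem sqGam_sqAdj (f : sl2 F) : sqGam F (sqAdj F f) = (2 : F) • f := by
  apply sl2.ext
  ext i j
  fin_cases i <;> fin_cases j <;> simp [sqAdj_apply, gam, f.val_one_one] <;> ring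

theorem sqForm_sqAdj (f : sl2 F) : sqForm F (sqAdj F f) = 0 := by
  simp [sqAdj_apply, form]

theorem sqGam_sqInv : sqGam F (sqInv F) = 0 := by
  apply sl2.ext
  ext i j
  fin_cases i <;> fin_cases j <;> simp [sqInv, gam]

theorem sqForm_sqInv : sqForm F (sqInv F) = 2 := by
  simp [sqInv, form]; norm_num

/-- The splitting of `V ⊗ V` into symmetric and alternating tensors: on `u ⊗ v` the two terms are `u
⊗ v + v ⊗ u` and `u ⊗ v - v ⊗ u`. -/
theorem sqAdj_sqGam (z : nat2 F ⊗[F] nat2 F) :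
    sqAdj F (sqGam F z) + sqForm F z • sqInv F = (2 : F) • z := by
  induction z with
  | zero => simp
  | add a b ha hb => simp only [map_add, add_smul, smul_add, ← ha, ← hb]; abel
  | tmul u v =>
    conv_rhs => rw [nat2_eq_combination u, nat2_eq_combination v]
    simp only [sqAdj_apply, sqGam_tmul, sqForm_tmul, sqInv, form, gam, sl2.val_mk,
      Matrix.add_apply, Matrix.vecMulVec_apply, Matrix.cons_val_zero, Matrix.cons_val_one,
      TensorProduct.add_tmul, TensorProduct.tmul_add, ← TensorProduct.smul_tmul',
      TensorProduct.tmul_smul]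
    module

/-- The tensor square of the natural module is the sum of the adjoint and the trivial module. -/
def sqEquiv (h2 : (2 : F) ≠ 0) : (sl2 F × F) ≃ₗ[F] nat2 F ⊗[F] nat2 F :=
  LinearEquiv.ofLinearMap
    (LinearMap.coprod (sqAdj F) (LinearMap.toSpanSingleton F _ (sqInv F)))
    ((2⁻¹ : F) • LinearMap.prod (sqGam F) (sqForm F))
    (by
      refine LinearMap.ext fun z => ?_
      have := sqAdj_sqGam z
      simp only [LinearMap.comp_apply, LinearMap.smul_apply, map_smul, LinearMap.prod_apply,
        Function.prod, LinearMap.coprod_apply, LinearMap.toSpanSingleton_apply, this]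
      rw [LinearMap.id_apply, smul_smul, inv_mul_cancel₀ h2, one_smul])
    (by
      refine LinearMap.ext fun p => ?_
      obtain ⟨f, c⟩ := p
      ext : 1 <;>
      simp [sqGam_sqAdj, sqForm_sqAdj, sqGam_sqInv, sqForm_sqInv, smul_smul, h2, mul_comm c])

theorem natAct_one_tmul_single (R : Type u) [CommRing R] [Algebra F R]
    (g : Matrix.SpecialLinearGroup (Fin 2) R) (u : nat2 F) :
    natAct F R g (1 ⊗ₜ u) =
      (g.1 0 0 * algebraMap F R (u 0) + g.1 0 1 * algebraMap F R (u 1)) ⊗ₜ vec0 F +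
      (g.1 1 0 * algebraMap F R (u 0) + g.1 1 1 * algebraMap F R (u 1)) ⊗ₜ vec1 F := by
  apply (TensorProduct.piScalarRight F R R (Fin 2)).injective
  rw [piScalarRight_natAct, map_add]
  simp only [piScalarRight_one_tmul]
  ext i
  fin_cases i <;> simp [Matrix.mulVec, dotProduct, Fin.sum_univ_two]

theorem natRep₁₀_act (R : Type u) [CommRing R] [Algebra F R]
    (g h : Matrix.SpecialLinearGroup (Fin 2) R) (u v : nat2 F) (a b c d : R)
    (hu : natAct F R g (1 ⊗ₜ u) = a ⊗ₜ vec0 F + b ⊗ₜ vec1 F)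
    (hv : natAct F R h (1 ⊗ₜ v) = c ⊗ₜ vec0 F + d ⊗ₜ vec1 F) :
    (natRep₁₀ F).act R (g, h) (1 ⊗ₜ (u ⊗ₜ v)) =
      (a * c) • (1 ⊗ₜ (vec0 F ⊗ₜ vec0 F)) + (a * d) • (1 ⊗ₜ (vec0 F ⊗ₜ vec1 F)) +
      (b * c) • (1 ⊗ₜ (vec1 F ⊗ₜ vec0 F)) + (b * d) • (1 ⊗ₜ (vec1 F ⊗ₜ vec1 F)) := by
  have hD : ∀ (a b : R) (m n : nat2 F),
      (TensorProduct.AlgebraTensorModule.distribBaseChange F R (nat2 F) (nat2 F)).symm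
        ((a ⊗ₜ m) ⊗ₜ (b ⊗ₜ n)) = (a * b) • (1 ⊗ₜ (m ⊗ₜ n)) := by
    intro a b m n
    simp [TensorProduct.smul_tmul']
  unfold natRep₁₀
  rw [tensor_act_one_tmul]
  change (TensorProduct.AlgebraTensorModule.distribBaseChange F R (nat2 F) (nat2 F)).symm
    (natAct F R g (1 ⊗ₜ u) ⊗ₜ natAct F R h (1 ⊗ₜ v)) = _
  rw [hu, hv, TensorProduct.tmul_add, TensorProduct.add_tmul, TensorProduct.add_tmul,
    LinearEquiv.map_add, LinearEquiv.map_add, LinearEquiv.map_add, hD, hD, hD, hD]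
  abel

theorem natAct_vec0 (R : Type u) [CommRing R] [Algebra F R]
    (g : Matrix.SpecialLinearGroup (Fin 2) R) :
    natAct F R g (1 ⊗ₜ vec0 F) = g.1 0 0 ⊗ₜ vec0 F + g.1 1 0 ⊗ₜ vec1 F := by
  simp [natAct_one_tmul_single]

theorem natAct_vec1 (R : Type u) [CommRing R] [Algebra F R]
    (g : Matrix.SpecialLinearGroup (Fin 2) R) :
    natAct F R g (1 ⊗ₜ vec1 F) = g.1 0 1 ⊗ₜ vec0 F + g.1 1 1 ⊗ₜ vec1 F := by
  simp [natAct_one_tmul_single]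

/-- A matrix acts on the alternating part of `V ⊗ V` by its determinant. -/
theorem sqInv_mem_fixed : sqInv F ∈ (natRep₁₀ F).diag.fixed := by
  intro R _ _ g
  change (natRep₁₀ F).act R (g, g) _ = _
  have hd := g.det_coe
  rw [Matrix.det_fin_two] at hd
  unfold sqInv
  rw [TensorProduct.tmul_sub, map_sub,
    natRep₁₀_act R g g _ _ _ _ _ _ (natAct_vec0 R g) (natAct_vec1 R g),
    natRep₁₀_act R g g _ _ _ _ _ _ (natAct_vec1 R g) (natAct_vec0 R g)]
  match_scalars
  · ring
  · linear_combination hd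
  · linear_combination -hd
  · ring

theorem baseChange_tmul' {M N : Type*} [AddCommGroup M] [Module F M] [AddCommGroup N] [Module F N]
    (φ : M →ₗ[F] N) (R : Type u) [CommRing R] [Algebra F R] (r : R) (m : M) :
    φ.baseChange R (r ⊗ₜ m) = r • (1 ⊗ₜ φ m) := by
  rw [LinearMap.baseChange_tmul, TensorProduct.smul_tmul', smul_eq_mul, mul_one]

/-- With the inverse written as the adjugate, both sides are polynomial in the entries of `g` and
can be compared on the basis of `V ⊗ V`, uniformly in `R`. -/
theorem sqAdj_equivariant : Equivariant (adjRep F) (natRep₁₀ F).diag (sqAdj F) := by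
  apply equivariant_of_one_tmul
  intro R _ _ g f
  change (natRep₁₀ F).act R (g, g) _ = (sqAdj F).baseChange R (sl2.ofMatrix F R
    ((g : Matrix (Fin 2) (Fin 2) R) * (sl2.toMatrix F R _ *
        ((g⁻¹ : Matrix.SpecialLinearGroup (Fin 2) R) : Matrix (Fin 2) (Fin 2) R))))
  rw [Matrix.SpecialLinearGroup.coe_inv, Matrix.adjugate_fin_two]
  have h00 := natRep₁₀_act R g g _ _ _ _ _ _ (natAct_vec0 R g) (natAct_vec0 (F := F) R g)
  have h01 := natRep₁₀_act R g g _ _ _ _ _ _ (natAct_vec0 R g) (natAct_vec1 (F := F) R g)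
  have h10 := natRep₁₀_act R g g _ _ _ _ _ _ (natAct_vec1 R g) (natAct_vec0 (F := F) R g)
  have h11 := natRep₁₀_act R g g _ _ _ _ _ _ (natAct_vec1 R g) (natAct_vec1 (F := F) R g)
  simp only [sqAdj_apply f, sl2.ofMatrix, LinearMap.coe_mk, AddHom.coe_mk, map_add,
    baseChange_tmul']
  have hs : ∀ (c : F) (z : nat2 F ⊗[F] nat2 F),
      (1 : R) ⊗ₜ[F] (c • z) = algebraMap F R c • (1 ⊗ₜ[F] z) := fun c z => by
    rw [TensorProduct.tmul_smul, algebraMap_smul]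
  have hE : sqAdj F (sl2.elE F) = vec0 F ⊗ₜ vec0 F := by simp [sqAdj_apply, sl2.elE]
  have hF : sqAdj F (sl2.elF F) = - vec1 F ⊗ₜ vec1 F := by simp [sqAdj_apply, sl2.elF]
  have hH : sqAdj F (sl2.elH F) = - (vec0 F ⊗ₜ vec1 F + vec1 F ⊗ₜ vec0 F) := by
    simp [sqAdj_apply, sl2.elH]
  simp only [hE, hF, hH, TensorProduct.tmul_sub, TensorProduct.tmul_add, TensorProduct.tmul_neg,
    TensorProduct.neg_tmul, hs, map_sub, map_add, map_smul, h00, h01, h10, h11]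
  simp [Matrix.mul_apply, Fin.sum_univ_two, sl2.toMatrix, f.val_one_one]
  match_scalars <;> ring

end Square

/-! ### Restriction to the diagonal -/

section Diagonal

variable {F : Type u} [Field F] {L : Type v} [LieRing L] [LieAlgebra F L]

theorem isInner_diag {Φ : GStructure (SL2SL2 F) L} {ι : sl2 F × sl2 F →ₗ⁅F⁆ L}
    (h : IsInnerSL2SL2 Φ ι) : IsInnerSL2 Φ.diag (ι.comp (diagLie F)) :=
  ⟨fun _ _ hXY => congrArg Prod.fst (h.1 hXY), fun X l => h.2 (X, X) l⟩

end Diagonal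

section Diagonal

variable {F : Type u} [Field F] {L : Type v} [LieRing L] [LieAlgebra F L]

/-- `(V ⊗ V) ⊗ A` is the sum of `𝔰𝔩(V) ⊗ A` and `A`. -/
def sqTensorEquiv (h2 : (2 : F) ≠ 0) (A : Type*) [AddCommGroup A] [Module F A] :
    ((sl2 F ⊗[F] A) × A) ≃ₗ[F] (nat2 F ⊗[F] nat2 F) ⊗[F] A :=
  ((TensorProduct.congr (sqEquiv h2).symm (LinearEquiv.refl F A)) ≪≫ₗ
    TensorProduct.prodLeft F F (sl2 F) F A ≪≫ₗ
    (LinearEquiv.prodCongr (LinearEquiv.refl F _) (TensorProduct.lid F A))).symm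

theorem sqTensorEquiv_left (h2 : (2 : F) ≠ 0) {A : Type*} [AddCommGroup A] [Module F A]
    (f : sl2 F) (a : A) : sqTensorEquiv h2 A (f ⊗ₜ a, 0) = sqAdj F f ⊗ₜ a := by
  unfold sqTensorEquiv
  rw [LinearEquiv.symm_apply_eq]
  have : (sqEquiv h2).symm (sqAdj F f) = (f, 0) := by
    rw [LinearEquiv.symm_apply_eq]; simp [sqEquiv]
  simp [this]

theorem sqTensorEquiv_right (h2 : (2 : F) ≠ 0) {A : Type*} [AddCommGroup A] [Module F A]
    (a : A) : sqTensorEquiv h2 A (0, a) = sqInv F ⊗ₜ a := by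
  unfold sqTensorEquiv
  rw [LinearEquiv.symm_apply_eq]
  have : (sqEquiv h2).symm (sqInv F) = (0, 1) := by
    rw [LinearEquiv.symm_apply_eq]; simp [sqEquiv]
  simp [this]

/-- Reordering of direct summands. -/
def prodShuffle (A B C D E G H : Type*) [AddCommGroup A] [Module F A] [AddCommGroup B]
    [Module F B] [AddCommGroup C] [Module F C] [AddCommGroup D] [Module F D] [AddCommGroup E]
    [Module F E] [AddCommGroup G] [Module F G] [AddCommGroup H] [Module F H] :
    ((A × B × C) × (D × E) × (G × H)) ≃ₗ[F] (A × B × (C × H) × D × E × G) where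
  toFun p := (p.1.1, p.1.2.1, (p.1.2.2, p.2.2.2), p.2.1.1, p.2.1.2, p.2.2.1)
  invFun q := ((q.1, q.2.1, q.2.2.1.1), (q.2.2.2.1, q.2.2.2.2.1), (q.2.2.2.2.2, q.2.2.1.2))
  map_add' _ _ := rfl
  map_smul' _ _ := rfl
  left_inv _ := rfl
  right_inv _ := rfl

variable {Φ : GStructure (SL2SL2 F) L} {J₁ J₀ Jh T₁ T₀ S : Type*}
  [AddCommGroup J₁] [Module F J₁] [AddCommGroup J₀] [Module F J₀]
  [AddCommGroup Jh] [Module F Jh] [AddCommGroup T₁] [Module F T₁]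
  [AddCommGroup T₀] [Module F T₀] [AddCommGroup S] [Module F S]

variable (J₁ J₀ Jh T₁ T₀ S) in
/-- The direct sum of copies of the modules in a short `(SL₂ × SL₂)`-structure, as a direct sum of
copies of the modules in a short `SL₂`-structure. -/
def diagEquiv (h2 : (2 : F) ≠ 0) :
    ((sl2 F ⊗[F] (J₁ × J₀ × Jh)) × (nat2 F ⊗[F] (T₁ × T₀)) × (S × Jh)) ≃ₗ[F]
    ((sl2 F ⊗[F] J₁) × (sl2 F ⊗[F] J₀) × ((nat2 F ⊗[F] nat2 F) ⊗[F] Jh) ×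
      (nat2 F ⊗[F] T₁) × (nat2 F ⊗[F] T₀) × S) :=
  (LinearEquiv.prodCongr
    (TensorProduct.prodRight F F (sl2 F) J₁ (J₀ × Jh) ≪≫ₗ
      LinearEquiv.prodCongr (LinearEquiv.refl F _) (TensorProduct.prodRight F F (sl2 F) J₀ Jh))
    (LinearEquiv.prodCongr (TensorProduct.prodRight F F (nat2 F) T₁ T₀)
      (LinearEquiv.refl F (S × Jh)))) ≪≫ₗ
  prodShuffle _ _ _ _ _ _ _ ≪≫ₗ
  (LinearEquiv.prodCongr (LinearEquiv.refl F _) (LinearEquiv.prodCongr (LinearEquiv.refl F _)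
    (LinearEquiv.prodCongr (sqTensorEquiv h2 Jh) (LinearEquiv.refl F _))))

theorem diagEquiv_adj (h2 : (2 : F) ≠ 0) (f : sl2 F) (a₁ : J₁) (a₀ : J₀) (ah : Jh) :
    diagEquiv J₁ J₀ Jh T₁ T₀ S h2 (f ⊗ₜ (a₁, a₀, ah), 0, 0) =
      (f ⊗ₜ a₁, f ⊗ₜ a₀, sqAdj F f ⊗ₜ ah, 0, 0, 0) := by
  simp [diagEquiv, prodShuffle, sqTensorEquiv_left]

theorem diagEquiv_nat (h2 : (2 : F) ≠ 0) (u : nat2 F) (x₁ : T₁) (x₀ : T₀) :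
    diagEquiv J₁ J₀ Jh T₁ T₀ S h2 (0, u ⊗ₜ (x₁, x₀), 0) = (0, 0, 0, u ⊗ₜ x₁, u ⊗ₜ x₀, 0) := by
  simp [diagEquiv, prodShuffle]

theorem diagEquiv_triv (h2 : (2 : F) ≠ 0) (s : S) (a : Jh) :
    diagEquiv J₁ J₀ Jh T₁ T₀ S h2 (0, 0, s, a) = (0, 0, sqInv F ⊗ₜ a, 0, 0, s) := by
  simp [diagEquiv, prodShuffle, sqTensorEquiv_right]

/-- The restriction to the diagonal of a short `(SL₂ × SL₂)`-decomposition. -/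
def ShortDecomposition₂.diag (h2 : (2 : F) ≠ 0) (dec : ShortDecomposition₂ Φ J₁ J₀ Jh T₁ T₀ S) :
    ShortDecomposition Φ.diag (J₁ × J₀ × Jh) (T₁ × T₀) (S × Jh) where
  equiv := diagEquiv J₁ J₀ Jh T₁ T₀ S h2 ≪≫ₗ dec.equiv
  adj_equivariant a := by
    obtain ⟨a₁, a₀, ah⟩ := a
    have h₁ : Equivariant (adjRep F) Φ.diag.toGroupRep _ := (dec.adj₁_equivariant a₁).diag
    have h₀ : Equivariant (adjRep F) Φ.diag.toGroupRep _ := (dec.adj₀_equivariant a₀).diag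
    -- On the diagonal each copy of `V₁ ⊗ V₀` breaks into an adjoint copy, through `sqAdj`, and a
    -- trivial one, through `sqInv`. This is why `Jh` occurs in the multiplicity spaces of both
    -- types.
    have hh : Equivariant (adjRep F) Φ.diag.toGroupRep _ :=
      (dec.nat₁₀_equivariant ah).diag.comp sqAdj_equivariant
    convert (h₁.add h₀).add hh using 1
    refine LinearMap.ext fun f => ?_
    simp [← map_add]
    exact diagEquiv_adj h2 f a₁ a₀ ah
  nat_equivariant x := by
    obtain ⟨x₁, x₀⟩ := x
    have h₁ : Equivariant (natRep F) Φ.diag.toGroupRep _ := (dec.nat₁_equivariant x₁).diag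
    have h₀ : Equivariant (natRep F) Φ.diag.toGroupRep _ := (dec.nat₀_equivariant x₀).diag
    convert h₁.add h₀ using 1
    refine LinearMap.ext fun f => ?_
    simp [diagEquiv_nat, ← map_add]
  triv_fixed d := by
    obtain ⟨s, a⟩ := d
    have h₁ : dec.equiv (0, 0, 0, 0, 0, s) ∈ Φ.diag.fixed := fun R _ _ g =>
      dec.triv_fixed s R (g, g)
    have h₂ : _ ∈ Φ.diag.fixed := Equivariant.map_mem_fixed (ρ := Φ.diag.toGroupRep)
      (dec.nat₁₀_equivariant a).diag sqInv_mem_fixed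
    convert add_mem h₁ h₂ using 1
    simp [diagEquiv_triv, ← map_add]

theorem isShort_diag (h2 : (2 : F) ≠ 0) {Φ : GStructure (SL2SL2 F) L} (h : IsShortSL2SL2 Φ) :
    IsShortSL2 Φ.diag := by
  obtain ⟨J₁, J₀, Jh, T₁, T₀, S, _, _, _, _, _, _, _, _, _, _, _, _, ⟨dec⟩⟩ := h
  exact ⟨_, _, _, _, _, _, _, _, _, ⟨dec.diag h2⟩⟩

/-! ### The idempotent of an inner `(SL₂ × SL₂)`-structure -/

section Span

variable {Ψ : GStructure (SL2 F) L} {J T D : Type*}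
  [AddCommGroup J] [Module F J] [AddCommGroup T] [Module F T] [AddCommGroup D] [Module F D]
  (dec : ShortDecomposition Ψ J T D)

theorem ShortDecomposition.adjSub_span (a : J) :
    dec.adjSub (Submodule.span F {a}) = LinearMap.range (dec.adj.flip a) := by
  rw [adjSub, Submodule.map₂_span_singleton_eq_map_flip, Submodule.map_top]

theorem ShortDecomposition.natSub_span (x : T) :
    dec.natSub (Submodule.span F {x}) = LinearMap.range (dec.nat.flip x) := by
  rw [natSub, Submodule.map₂_span_singleton_eq_map_flip, Submodule.map_top]

theorem ShortDecomposition.mem_adjSub_span {a : J} {l : L} :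
    l ∈ dec.adjSub (Submodule.span F {a}) ↔ ∃ f, l = dec.adj f a := by
  rw [dec.adjSub_span]
  exact ⟨fun ⟨f, hf⟩ => ⟨f, hf.symm⟩, fun ⟨f, hf⟩ => ⟨f, hf.symm⟩⟩

end Span

/-- Since `[ι(X,X), ι(Y,0)] = ι([X,Y],0)`, the map `f ↦ ι(f,0)` is a homomorphism for the diagonal
𝔰𝔩₂, so it equals `f ↦ f ⊗ e`; subtracting from the diagonal gives `1 - e` for the second factor.
Idempotency is `[ι(E,0), ι(F,0)] = ι(H,0)`. Injectivity of `ι` excludes `e = 0` and `e = 1` and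
makes the two images disjoint. -/
theorem exists_idempotent (h2 : (2 : F) ≠ 0) (h3 : (3 : F) ≠ 0) {J T D : Type*}
    [AddCommGroup J] [Module F J] [AddCommGroup T] [Module F T] [AddCommGroup D] [Module F D]
    {Φ : GStructure (SL2SL2 F) L} {ι : sl2 F × sl2 F →ₗ⁅F⁆ L} (hΦ : IsInnerSL2SL2 Φ ι)
    (dec : ShortDecomposition Φ.diag J T D) :
    ∃ e : J, dec.mul e e = e ∧ e ≠ 0 ∧ e ≠ dec.one (ι.comp (diagLie F)) ∧
      (∀ f₁ f₀ : sl2 F, ι (f₁, f₀) =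
        dec.adj f₁ e + dec.adj f₀ (dec.one (ι.comp (diagLie F)) - e)) ∧
      Disjoint (dec.adjSub (Submodule.span F {e}))
        (dec.adjSub (Submodule.span F {dec.one (ι.comp (diagLie F)) - e})) ∧
      LinearMap.range (ι : sl2 F × sl2 F →ₗ[F] L) =
        dec.adjSub (Submodule.span F {e}) ⊔
          dec.adjSub (Submodule.span F {dec.one (ι.comp (diagLie F)) - e}) := by
  have hι := isInner_diag hΦ
  set ι' := ι.comp (diagLie F) with hι'
  set e := dec.coordJ 0 0 (ι (sl2.elH F, 0)) with he
  have hl : ∀ f, ι (f, 0) = dec.adj f e := fun f =>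
    dec.eq_adj_of_lie_hom h2 h3 hι ((ι : sl2 F × sl2 F →ₗ[F] L) ∘ₗ LinearMap.inl F _ _)
      (fun X Y => by
        change ⁅ι (X, X), ι (Y, 0)⁆ = ι (⁅X, Y⁆, 0)
        rw [← LieHom.map_lie]
        congr 1
        exact Prod.ext rfl (lie_zero X)) f
  have hr : ∀ f, ι (0, f) = dec.adj f (dec.one ι' - e) := fun f => by
    have h : ι (f, f) = dec.adj f (dec.one ι') := dec.inner_eq h2 h3 hι f
    have : ι (0, f) = ι (f, f) - ι (f, 0) := by rw [← map_sub]; congr 1; simp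
    rw [this, h, hl, map_sub]
  have hs : ∀ f₁ f₀, ι (f₁, f₀) = dec.adj f₁ e + dec.adj f₀ (dec.one ι' - e) := fun f₁ f₀ => by
    rw [← hl, ← hr, ← map_add]; simp
  refine ⟨e, ?_, ?_, ?_, hs, ?_, ?_⟩
  · change dec.coordJ 0 0 ⁅dec.adj (sl2.elE F) e, dec.adj (sl2.elF F) e⁆ = e
    rw [← hl, ← hl, ← LieHom.map_lie, he]
    congr 2
    exact Prod.ext sl2.lie_E_F (lie_zero 0)
  · intro h0
    have := hl (sl2.elE F)
    rw [h0, map_zero] at this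
    have := hΦ.1 (this.trans (map_zero ι).symm)
    exact ShortDecomposition.elE_ne_zero (congrArg Prod.fst this)
  · intro h0
    have := hr (sl2.elE F)
    rw [← h0, sub_self, map_zero] at this
    have := hΦ.1 (this.trans (map_zero ι).symm)
    exact ShortDecomposition.elE_ne_zero (congrArg Prod.snd this)
  · rw [Submodule.disjoint_def]
    intro l h₁ h₀
    obtain ⟨f, rfl⟩ := dec.mem_adjSub_span.mp h₁
    obtain ⟨g, hg⟩ := dec.mem_adjSub_span.mp h₀
    rw [← hl, ← hr] at hg
    have := congrArg Prod.fst (hΦ.1 hg)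
    simp only at this
    rw [this]; simp
  · ext l
    rw [Submodule.mem_sup]
    constructor
    · rintro ⟨⟨f, g⟩, rfl⟩
      exact ⟨_, dec.mem_adjSub_span.mpr ⟨f, rfl⟩, _, dec.mem_adjSub_span.mpr ⟨g, rfl⟩,
        (hs f g).symm⟩
    · rintro ⟨_, h₁, _, h₀, rfl⟩
      obtain ⟨f, rfl⟩ := dec.mem_adjSub_span.mp h₁
      obtain ⟨g, rfl⟩ := dec.mem_adjSub_span.mp h₀
      exact ⟨(f, g), hs f g⟩

end Diagonal

section Constructions

variable {F : Type u} [Field F] {G : GroupFunctor F}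
variable {M : Type v} [AddCommGroup M] [Module F M] {N : Type w} [AddCommGroup N] [Module F N]

/-! ### Constructions of representations -/

variable (G M) in
/-- The trivial representation. -/
def GroupRep.trivial : GroupRep G M where
  act _ _ _ := 1
  natural _ _ _ := rfl

theorem GroupRep.trivial_fixed (m : M) : m ∈ (GroupRep.trivial G M).fixed := fun _ _ _ _ => rfl

/-- The direct sum of two representations. -/
def GroupRep.prod (ρ : GroupRep G M) (σ : GroupRep G N) : GroupRep G (M × N) where
  act R _ _ :=
    { toFun := fun g => (TensorProduct.prodRight F R R M N).symm.toLinearMap ∘ₗ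
        LinearMap.prodMap (ρ.act R g) (σ.act R g) ∘ₗ
        (TensorProduct.prodRight F R R M N).toLinearMap
      map_one' := by
        refine LinearMap.ext fun x => ?_
        simp
      map_mul' := fun g h => by
        refine LinearMap.ext fun x => ?_
        simp }
  natural {R S} _ _ _ _ φ g x := by
    have key' : ∀ w : R ⊗[F] (M × N),
        TensorProduct.prodRight F S S M N (φ.toLinearMap.rTensor (M × N) w) =
          (φ.toLinearMap.rTensor M (TensorProduct.prodRight F R R M N w).1,
            φ.toLinearMap.rTensor N (TensorProduct.prodRight F R R M N w).2) := by
      intro w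
      induction w with
      | zero => simp; rfl
      | tmul r m => simp
      | add a b ha hb => simp only [map_add, ha, hb, Prod.fst_add, Prod.snd_add, Prod.mk_add_mk]
    have key : ∀ (y : R ⊗[F] M) (z : R ⊗[F] N),
        (TensorProduct.prodRight F S S M N).symm
          (φ.toLinearMap.rTensor M y, φ.toLinearMap.rTensor N z) =
        φ.toLinearMap.rTensor (M × N) ((TensorProduct.prodRight F R R M N).symm (y, z)) := by
      intro y z
      rw [LinearEquiv.symm_apply_eq, key', LinearEquiv.apply_symm_apply]
    change (TensorProduct.prodRight F S S M N).symm (LinearMap.prodMap _ _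
      (TensorProduct.prodRight F S S M N (φ.toLinearMap.rTensor (M × N) x))) = _
    rw [key', LinearMap.prodMap_apply, ρ.natural, σ.natural, key]
    rfl

theorem inl_equivariant (ρ : GroupRep G M) (σ : GroupRep G N) :
    Equivariant ρ (ρ.prod σ) (LinearMap.inl F M N) := by
  have key : ∀ (R : Type u) [CommRing R] [Algebra F R] (x : R ⊗[F] M),
      TensorProduct.prodRight F R R M N ((LinearMap.inl F M N).baseChange R x) = (x, 0) := by
    intro R _ _ x
    induction x with
    | zero => simp; rfl
    | tmul r m => simp
    | add a b ha hb => simp only [map_add, ha, hb, Prod.mk_add_mk, add_zero]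
  intro R _ _ g x
  change (TensorProduct.prodRight F R R M N).symm (LinearMap.prodMap _ _
    (TensorProduct.prodRight F R R M N _)) = _
  rw [LinearEquiv.symm_apply_eq, key, key]
  simp

theorem inr_equivariant (ρ : GroupRep G M) (σ : GroupRep G N) :
    Equivariant σ (ρ.prod σ) (LinearMap.inr F M N) := by
  have key : ∀ (R : Type u) [CommRing R] [Algebra F R] (x : R ⊗[F] N),
      TensorProduct.prodRight F R R M N ((LinearMap.inr F M N).baseChange R x) = (0, x) := by
    intro R _ _ x
    induction x with
    | zero => simp; rfl
    | tmul r m => simp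
    | add a b ha hb => simp only [map_add, ha, hb, Prod.mk_add_mk, add_zero]
  intro R _ _ g x
  change (TensorProduct.prodRight F R R M N).symm (LinearMap.prodMap _ _
    (TensorProduct.prodRight F R R M N _)) = _
  rw [LinearEquiv.symm_apply_eq, key, key]
  simp

theorem mk_flip_equivariant (ρ : GroupRep G M) (n : N) :
    Equivariant ρ (ρ.tensor (GroupRep.trivial G N)) ((TensorProduct.mk F M N).flip n) := by
  apply equivariant_of_one_tmul
  intro R _ _ g m
  rw [LinearMap.flip_apply, TensorProduct.mk_apply, tensor_act_one_tmul, LinearEquiv.symm_apply_eq]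
  change ρ.act R g (1 ⊗ₜ m) ⊗ₜ (1 ⊗ₜ n) = _
  induction ρ.act R g (1 ⊗ₜ m) with
  | zero => simp
  | tmul r m => simp
  | add a b ha hb => rw [TensorProduct.add_tmul, map_add, LinearEquiv.map_add, ha, hb]

/-- Transport of a representation along a linear isomorphism. -/
def GroupRep.congr (ρ : GroupRep G M) (e : M ≃ₗ[F] N) : GroupRep G N where
  act R _ _ :=
    { toFun := fun g => e.toLinearMap.baseChange R ∘ₗ ρ.act R g ∘ₗ
        e.symm.toLinearMap.baseChange R
      map_one' := by
        rw [map_one, Module.End.one_eq_id, LinearMap.id_comp, ← LinearMap.baseChange_comp]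
        simp
        rfl
      map_mul' := fun g h => by
        refine LinearMap.ext fun x => ?_
        have : ∀ y, e.symm.toLinearMap.baseChange R (e.toLinearMap.baseChange R y) = y :=
            fun y => by
              rw [← LinearMap.comp_apply, ← LinearMap.baseChange_comp]
              simp
        simp [this] }
  natural {R S} _ _ _ _ φ g x := by
    change e.toLinearMap.baseChange S (ρ.act S _ (e.symm.toLinearMap.baseChange S _)) =
      φ.toLinearMap.rTensor N (e.toLinearMap.baseChange R
        (ρ.act R g (e.symm.toLinearMap.baseChange R x)))
    have h₁ : e.symm.toLinearMap.baseChange S (φ.toLinearMap.rTensor N x) =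
        φ.toLinearMap.rTensor M (e.symm.toLinearMap.baseChange R x) := by
      induction x with
      | zero => simp
      | tmul r m => simp
      | add a b ha hb => simp only [map_add, ha, hb]
    rw [h₁, ρ.natural]
    induction ρ.act R g (e.symm.toLinearMap.baseChange R x) with
    | zero => simp
    | tmul r m => simp
    | add a b ha hb => simp only [map_add, ha, hb]

theorem congr_equivariant (ρ : GroupRep G M) (e : M ≃ₗ[F] N) :
    Equivariant ρ (ρ.congr e) e.toLinearMap := by
  intro R _ _ g x
  change e.toLinearMap.baseChange R (ρ.act R g (e.symm.toLinearMap.baseChange R _)) = _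
  rw [← LinearMap.comp_apply (e.symm.toLinearMap.baseChange R), ← LinearMap.baseChange_comp]
  simp

end Constructions

/-! ### Automorphisms -/

section Automorphisms

variable {F : Type u} [Field F]

/-- A basis of `M` over the field reduces this to coordinates in `R`. A coordinate vanishing in both
localizations is killed by a power of `a` and by a power of `b`; these powers are again coprime, so
it is zero. -/
theorem rTensor_eq_zero_of_coprime {M : Type v} [AddCommGroup M] [Module F M] {R : Type u}
    [CommRing R] [Algebra F R] {a b : R} (hab : IsCoprime a b) {z : R ⊗[F] M}
    (ha : (IsScalarTower.toAlgHom F R (Localization.Away a)).toLinearMap.rTensor M z = 0)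
    (hb : (IsScalarTower.toAlgHom F R (Localization.Away b)).toLinearMap.rTensor M z = 0) :
    z = 0 := by
  let B := Module.Basis.ofVectorSpace F M
  have key : ∀ (S : Type u) [CommRing S] [Algebra F S] (φ : R →ₐ[F] S) (y : R ⊗[F] M) (i),
      (Algebra.TensorProduct.basis S B).repr (φ.toLinearMap.rTensor M y) i =
        φ ((Algebra.TensorProduct.basis R B).repr y i) := by
    intro S _ _ φ y i
    induction y with
    | zero => simp
    | tmul r m => simp
    | add x y hx hy => simp only [map_add, Finsupp.add_apply, hx, hy]
  have loc : ∀ c : R,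
      (IsScalarTower.toAlgHom F R (Localization.Away c)).toLinearMap.rTensor M z = 0 →
      ∀ i, ∃ n : ℕ, c ^ n * (Algebra.TensorProduct.basis R B).repr z i = 0 := by
    intro c hc i
    have h := key _ (IsScalarTower.toAlgHom F R (Localization.Away c)) z i
    rw [hc, map_zero, Finsupp.zero_apply, eq_comm, IsScalarTower.toAlgHom_apply,
      IsLocalization.map_eq_zero_iff (Submonoid.powers c)] at h
    obtain ⟨⟨_, n, rfl⟩, hn⟩ := h
    exact ⟨n, hn⟩
  apply (Algebra.TensorProduct.basis R B).repr.injective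
  ext i
  obtain ⟨n, hn⟩ := loc a ha i
  obtain ⟨m, hm⟩ := loc b hb i
  obtain ⟨x, y, hxy⟩ := IsCoprime.pow (m := n) (n := m) hab
  rw [map_zero, Finsupp.zero_apply]
  linear_combination x * hn + y * hm -
    ((Algebra.TensorProduct.basis R B).repr z i) * hxy

/-- Elementary upper triangular matrices. -/
def upper {R : Type u} [CommRing R] (t : R) : Matrix.SpecialLinearGroup (Fin 2) R :=
  ⟨!![1, t; 0, 1], by simp [Matrix.det_fin_two]⟩

/-- Elementary lower triangular matrices. -/
def lower {R : Type u} [CommRing R] (t : R) : Matrix.SpecialLinearGroup (Fin 2) R :=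
  ⟨!![1, 0; t, 1], by simp [Matrix.det_fin_two]⟩

theorem coe_upper {R : Type u} [CommRing R] (t : R) :
    (upper t : Matrix (Fin 2) (Fin 2) R) = !![1, t; 0, 1] := rfl

theorem coe_lower {R : Type u} [CommRing R] (t : R) :
    (lower t : Matrix (Fin 2) (Fin 2) R) = !![1, 0; t, 1] := rfl

theorem mem_of_isUnit_zero_zero {R : Type u} [CommRing R]
    (P : Submonoid (Matrix.SpecialLinearGroup (Fin 2) R))
    (hu : ∀ t, upper t ∈ P) (hl : ∀ t, lower t ∈ P) (g : Matrix.SpecialLinearGroup (Fin 2) R)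
    (h : IsUnit (g.1 0 0)) : g ∈ P := by
  obtain ⟨u, hu0⟩ := h
  have hd := g.det_coe
  rw [Matrix.det_fin_two] at hd
  have huu : (u : R) * (u⁻¹ : Rˣ) = 1 := u.mul_inv
  -- Write `w(u) = upper u * lower (-u⁻¹) * upper u`. Then `w(u) w(-1)` is the diagonal matrix `(u,
  -- u⁻¹)`, and the identity is the decomposition of `g` as lower times diagonal times upper.
  have e : g =
      lower (g.1 1 0 * (u⁻¹ : Rˣ)) * (upper (u : R) * lower (-(u⁻¹ : Rˣ) : R) * upper (u : R) *
      (upper (-1) * lower 1 * upper (-1))) * upper ((u⁻¹ : Rˣ) * g.1 0 1) := by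
    generalize ((u⁻¹ : Rˣ) : R) = u' at *
    generalize (u : R) = u at *
    apply Subtype.ext
    simp only [Matrix.SpecialLinearGroup.coe_mul, coe_upper, coe_lower]
    ext i j
    fin_cases i <;> fin_cases j <;> simp [Matrix.mul_apply, Fin.sum_univ_two]
    · linear_combination -hu0 + u * huu
    · linear_combination ((u * u' - 1) * g.1 0 1 - 1) * huu
    · linear_combination (g.1 1 0 * (u * u' - 1) + 1) * huu
    · linear_combination u' * hd + u' * g.1 1 1 * hu0 + (-g.1 1 1 +
        g.1 1 0 * (u * u' - 1) * u' * g.1 0 1 + u' * g.1 0 1 - g.1 1 0 * u') * huu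
  rw [e]
  exact P.mul_mem (P.mul_mem (hl _) (P.mul_mem (P.mul_mem (P.mul_mem (hu _) (hl _)) (hu _))
    (P.mul_mem (P.mul_mem (hu _) (hl _)) (hu _)))) (hu _)

theorem mem_of_isUnit_zero_one {R : Type u} [CommRing R]
    (P : Submonoid (Matrix.SpecialLinearGroup (Fin 2) R))
    (hu : ∀ t, upper t ∈ P) (hl : ∀ t, lower t ∈ P) (g : Matrix.SpecialLinearGroup (Fin 2) R)
    (h : IsUnit (g.1 0 1)) : g ∈ P := by
  -- The first elementary product is the Weyl element `w(-1)`, which moves the entry `(0, 1)` of `g`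
  -- to `(0, 0)` and so reduces to the previous case; the second is its inverse.
  have e : g = (g * (upper (-1) * lower 1 * upper (-1))) * (upper 1 * lower (-1) * upper 1) := by
    apply Subtype.ext
    simp only [Matrix.SpecialLinearGroup.coe_mul, coe_upper, coe_lower]
    ext i j
    fin_cases i <;> fin_cases j <;> simp [Matrix.mul_apply, Fin.sum_univ_two]
  rw [e]
  refine P.mul_mem (mem_of_isUnit_zero_zero P hu hl _ ?_) (P.mul_mem (P.mul_mem (hu _) (hl _)) (hu _))
  simpa only [Matrix.SpecialLinearGroup.coe_mul, coe_upper, coe_lower] using (by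
    simpa [Matrix.mul_apply, Fin.sum_univ_two] using h)

variable {L : Type v} [LieRing L] [LieAlgebra F L]

/-- The elements of `G(R)` acting on `R ⊗ L` by automorphisms. -/
def GroupRep.lieStabilizer {G : GroupFunctor F} (ρ : GroupRep G L) (R : Type u) [CommRing R]
    [Algebra F R] : Submonoid (G.pts R) where
  carrier := {g | ∀ x y : R ⊗[F] L, ρ.act R g ⁅x, y⁆ = ⁅ρ.act R g x, ρ.act R g y⁆}
  one_mem' x y := by simp
  mul_mem' {g h} hg hh x y := by
    rw [map_mul, Module.End.mul_apply, hh, hg]; rfl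

theorem rTensor_lie {R S : Type u} [CommRing R] [Algebra F R] [CommRing S] [Algebra F S]
    (φ : R →ₐ[F] S) (x y : R ⊗[F] L) : φ.toLinearMap.rTensor L ⁅x, y⁆ =
      ⁅φ.toLinearMap.rTensor L x, φ.toLinearMap.rTensor L y⁆ := by
  induction x with
  | zero => simp
  | add a b ha hb => simp only [add_lie, map_add, ha, hb]
  | tmul r l =>
    induction y with
    | zero => simp
    | add a b ha hb => simp only [lie_add, map_add, ha, hb]
    | tmul s m => simp [LieAlgebra.ExtendScalars.bracket_tmul]

/-- A representation of `SL₂` on a Lie algebra is by automorphisms as soon as the elementary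
matrices act by automorphisms: locally, the elementary matrices generate. -/
theorem map_lie_of_elementary (ρ : GroupRep (SL2 F) L)
    (hu : ∀ (R : Type u) [CommRing R] [Algebra F R] (t : R), upper t ∈ ρ.lieStabilizer R)
    (hl : ∀ (R : Type u) [CommRing R] [Algebra F R] (t : R), lower t ∈ ρ.lieStabilizer R)
    (R : Type u) [CommRing R] [Algebra F R] (g : Matrix.SpecialLinearGroup (Fin 2) R) :
    g ∈ ρ.lieStabilizer R := by
  intro x y
  have hd := g.det_coe
  rw [Matrix.det_fin_two] at hd
  -- The determinant is a Bézout relation for the first row.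
  have hab : IsCoprime (g.1 0 0) (g.1 0 1) :=
    ⟨g.1 1 1, -g.1 1 0, by linear_combination hd⟩
  -- By naturality, the failure of `g` to preserve the bracket maps to the corresponding failure for
  -- the image of `g` over `S`.
  have key : ∀ (S : Type u) [CommRing S] [Algebra F S] (φ : R →ₐ[F] S),
      (SL2 F).map φ g ∈ ρ.lieStabilizer S → φ.toLinearMap.rTensor L
        (ρ.act R g ⁅x, y⁆ - ⁅ρ.act R g x, ρ.act R g y⁆) = 0 := by
    intro S _ _ φ h
    rw [map_sub, rTensor_lie, ← ρ.natural, ← ρ.natural, ← ρ.natural, rTensor_lie, h, sub_self]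
  rw [← sub_eq_zero]
  refine rTensor_eq_zero_of_coprime hab (key _ _ ?_) (key _ _ ?_)
  · refine mem_of_isUnit_zero_zero _ (hu _) (hl _) _ ?_
    exact IsLocalization.Away.algebraMap_isUnit (S := Localization.Away (g.1 0 0)) (g.1 0 0)
  · refine mem_of_isUnit_zero_one _ (hu _) (hl _) _ ?_
    exact IsLocalization.Away.algebraMap_isUnit (S := Localization.Away (g.1 0 1)) (g.1 0 1)

/-- Exponentials of derivations of cube zero are automorphisms. -/
theorem mem_lieStabilizer_of_expAct (h2 : (2 : F) ≠ 0) (h3 : (3 : F) ≠ 0) {G : GroupFunctor F}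
    (ρ : GroupRep G L) {R : Type u} [CommRing R] [Algebra F R] {g : G.pts R} {t : R} {n : L}
    (h : ∀ l : L, ρ.act R g (1 ⊗ₜ l) = 1 ⊗ₜ l + t ⊗ₜ ⁅n, l⁆ + (t ^ 2) ⊗ₜ ((2⁻¹ : F) • ⁅n, ⁅n, l⁆⁆))
    (hn : ∀ l : L, ⁅n, ⁅n, ⁅n, l⁆⁆⁆ = 0) : g ∈ ρ.lieStabilizer R := by
  have h₁ : ∀ l m : L, ρ.act R g ⁅(1 : R) ⊗ₜ[F] l, (1 : R) ⊗ₜ[F] m⁆ =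
      ⁅ρ.act R g (1 ⊗ₜ l), ρ.act R g (1 ⊗ₜ m)⁆ := by
    intro l m
    obtain ⟨d, hd⟩ : ∃ d : L → L, ∀ l, ⁅n, l⁆ = d l := ⟨_, fun _ => rfl⟩
    have dl : ∀ y z, d ⁅y, z⁆ = ⁅d y, z⁆ + ⁅y, d z⁆ := fun y z => by
      rw [← hd, leibniz_lie, hd, hd]
    have da : ∀ y z, d (y + z) = d y + d z := fun y z => by simp only [← hd, lie_add]
    have ds : ∀ (c : F) y, d (c • y) = c • d y := fun c y => by simp only [← hd, lie_smul]
    have d0 : d 0 = 0 := by rw [← hd, lie_zero]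
    simp only [hd] at h hn
    have e₂ : d (d ⁅l, m⁆) = ⁅d (d l), m⁆ + (2 : F) • ⁅d l, d m⁆ + ⁅l, d (d m)⁆ := by
      simp only [dl, da]; module
    -- The coefficients of `t³` and `t⁴` in the bracket of the two exponentials must vanish. With
    -- `d³ = 0`, Leibniz for `d³[l,m]` gives three times this sum; one more `d` gives twice the
    -- expression in `e₄`.
    have e₃ : ⁅d (d l), d m⁆ + ⁅d l, d (d m)⁆ = 0 := by
      have := hn ⁅l, m⁆
      rw [e₂] at this
      simp only [dl, da, ds, hn, zero_lie, lie_zero] at this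
      apply smul_right_injective L h3
      simp only [smul_zero]
      linear_combination (norm := module) this
    have e₄ : ⁅d (d l), d (d m)⁆ = 0 := by
      have := congrArg d e₃
      simp only [dl, da, hn, zero_lie, lie_zero, d0] at this
      apply smul_right_injective L h2
      simp only [smul_zero]
      linear_combination (norm := module) this
    rw [LieAlgebra.ExtendScalars.bracket_tmul, mul_one, h, h, h, e₂, dl]
    simp only [add_lie, lie_add, LieAlgebra.ExtendScalars.bracket_tmul, smul_lie, lie_smul, e₄,
      eq_neg_of_add_eq_zero_left e₃]
    simp only [TensorProduct.tmul_add, smul_add, TensorProduct.tmul_smul, smul_zero,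
      TensorProduct.tmul_zero, TensorProduct.tmul_neg, smul_smul, inv_mul_cancel₀ h2, one_smul,
      ← pow_two, ← pow_succ, ← pow_succ', one_mul, mul_one, smul_neg, one_pow]
    abel
  intro x y
  induction x with
  | zero => simp
  | add a b ha hb => simp only [add_lie, map_add, ha, hb]
  | tmul r l =>
    induction y with
    | zero => simp
    | add a b ha hb => simp only [lie_add, map_add, ha, hb]
    | tmul s m =>
      have e : ∀ (c : R) (k : L), c ⊗ₜ[F] k = c • (1 ⊗ₜ k) := fun c k => by
        simp [TensorProduct.smul_tmul']
      rw [e r l, e s m]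
      simp only [smul_lie, lie_smul, map_smul, h₁]

end Automorphisms

theorem isInternal_of_fin {F : Type*} [Field F] {M : Type*} [AddCommGroup M] [Module F M] {n : ℕ}
    (p : Fin n → Submodule F M) (htop : ∀ m, m ∈ ⨆ i, p i)
    (h : ∀ v : Fin n → M, (∀ i, v i ∈ p i) → ∑ i, v i = 0 → ∀ i, v i = 0) :
    DirectSum.IsInternal p := by
  refine DirectSum.isInternal_submodule_of_iSupIndep_of_iSup_eq_top ?_
    (Submodule.eq_top_iff'.mpr htop)
  rw [iSupIndep_iff_finsetSum_eq_zero_imp_eq_zero]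
  intro s v hv hs i hi
  have := h (fun j => if j ∈ s then v j else 0) (fun j => by
    by_cases hj : j ∈ s
    · simpa [hj] using hv j hj
    · simp [hj]) (by rw [Finset.sum_ite_mem, Finset.univ_inter, hs]) i
  simpa [hi] using this

namespace ShortDecomposition

variable {F : Type u} [Field F] {L : Type v} [LieRing L] [LieAlgebra F L]
variable {Ψ : GStructure (SL2 F) L} {J T D : Type*}
  [AddCommGroup J] [Module F J] [AddCommGroup T] [Module F T] [AddCommGroup D] [Module F D]
  (dec : ShortDecomposition Ψ J T D) {ι : sl2 F →ₗ⁅F⁆ L}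

/-! ### The Peirce decomposition -/

theorem mem_peirceJ {e a : J} {c : F} : a ∈ dec.peirceJ e c ↔ dec.mul e a = c • a := by
  rw [peirceJ, LinearMap.mem_ker, LinearMap.sub_apply, sub_eq_zero]; rfl

theorem mem_peirceT {e : J} {x : T} {c : F} : x ∈ dec.peirceT e c ↔ dec.bul e x = c • x := by
  rw [peirceT, LinearMap.mem_ker, LinearMap.sub_apply, sub_eq_zero]; rfl

/-- The elements of `D` annihilating `e`. -/
def annD (e : J) : Submodule F D := LinearMap.ker (dec.actJ.flip e)

theorem mem_annD {e : J} {d : D} : d ∈ dec.annD e ↔ dec.actJ d e = 0 := Iff.rfl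

variable (h2 : (2 : F) ≠ 0) (h3 : (3 : F) ≠ 0) (hι : IsInnerSL2 Ψ ι) {e : J}
  (he : dec.mul e e = e)

include h2 hι

include he

/-- The case `e, e, a` of the cyclic identity. It shows at once that `D_{e,a}` vanishes for `a` in
`J₁` and in `J₀`. -/
theorem dJ_idempotent (a : J) : dec.dJ e a = (2 : F) • dec.dJ e (dec.mul e a) := by
  have h := dec.dJ_cyclic h2 hι e e a
  rw [he, dec.mul_comm' h2 hι a e, dec.dJ_skew h2 hι _ e] at h
  linear_combination (norm := module) h

theorem dJ_eq_zero_of_mem_one {a : J} (ha : a ∈ dec.peirceJ e 1) : dec.dJ e a = 0 := by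
  have h := dec.dJ_idempotent h2 hι he a
  rw [dec.mem_peirceJ.mp ha, one_smul] at h
  linear_combination (norm := module) -h

theorem dJ_eq_zero_of_mem_zero {a : J} (ha : a ∈ dec.peirceJ e 0) : dec.dJ e a = 0 := by
  have h := dec.dJ_idempotent h2 hι he a
  rwa [dec.mem_peirceJ.mp ha, zero_smul, map_zero, smul_zero] at h

theorem actJ_dJ_idempotent (a : J) :
    dec.actJ (dec.dJ e a) e = dec.mul e (dec.mul e a) - dec.mul e a := by
  rw [dec.actJ_dJ h2 hι, he, dec.mul_comm' h2 hι a e]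

/-- On `J_{1/2}` the operator `L_e² - L_e` is `¼ - ½ = -¼`. So evaluation at `e` inverts `a ↦
D_{e,a}` up to the factor `-4`, which is what splits `D`. -/
theorem actJ_dJ_of_mem_half {a : J} (ha : a ∈ dec.peirceJ e 2⁻¹) :
    (4 : F) • dec.actJ (dec.dJ e a) e = -a := by
  rw [dec.actJ_dJ_idempotent h2 hι he, dec.mem_peirceJ.mp ha, map_smul, dec.mem_peirceJ.mp ha]
  match_scalars
  field_simp
  norm_num

/-- Evaluating `D_{e,a} = 2 D_{e,e·a}` at `e` gives `L² - L = 2(L³ - L²)` for the multiplication `L`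
by `e`, that is, `L(L - 1)(2L - 1) = 0`. -/
theorem peirce_polynomial (a : J) : (2 : F) • dec.mul e (dec.mul e (dec.mul e a)) =
    (3 : F) • dec.mul e (dec.mul e a) - dec.mul e a := by
  have h := congrArg (fun d => dec.actJ d e) (dec.dJ_idempotent h2 hι he a)
  simp only [map_smul, LinearMap.smul_apply, dec.actJ_dJ_idempotent h2 hι he] at h
  linear_combination (norm := module) -h

/-- The vectors in this lemma and the next two are the Lagrange projections `2L² - L`, `2L² - 3L +
1` and `4L - 4L²` for the roots `1`, `0`, `½` of the Peirce polynomial; they sum to the identity. -/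
theorem peirce_one_mem (a : J) : (2 : F) • dec.mul e (dec.mul e a) - dec.mul e a ∈
    dec.peirceJ e 1 := by
  rw [mem_peirceJ]
  simp only [map_sub, map_smul]
  linear_combination (norm := module) dec.peirce_polynomial h2 hι he a

theorem peirce_zero_mem (a : J) : (2 : F) • dec.mul e (dec.mul e a) - (3 : F) • dec.mul e a + a ∈
    dec.peirceJ e 0 := by
  rw [mem_peirceJ]
  simp only [map_sub, map_smul, map_add]
  linear_combination (norm := module) dec.peirce_polynomial h2 hι he a

theorem peirce_half_mem (a : J) : (4 : F) • dec.mul e a - (4 : F) • dec.mul e (dec.mul e a) ∈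
    dec.peirceJ e 2⁻¹ := by
  rw [mem_peirceJ, eq_inv_smul_iff₀ h2]
  simp only [map_sub, map_smul]
  linear_combination (norm := module) (-4 : F) • dec.peirce_polynomial h2 hι he a

omit hι he in
theorem peirce_independent {a₁ a₀ ah : J} (h₁ : a₁ ∈ dec.peirceJ e 1) (h₀ : a₀ ∈ dec.peirceJ e 0)
    (hh : ah ∈ dec.peirceJ e 2⁻¹) (h : a₁ + a₀ + ah = 0) : a₁ = 0 ∧ a₀ = 0 ∧ ah = 0 := by
  rw [mem_peirceJ] at h₁ h₀ hh
  have e₁ := congrArg (dec.mul e) h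
  have e₂ := congrArg (dec.mul e) e₁
  simp only [map_add, map_smul, h₁, h₀, hh, map_zero, one_smul, zero_smul, add_zero] at e₁ e₂
  have ha : ah = 0 := by
    have : ((2⁻¹ : F) - 2⁻¹ * 2⁻¹) • ah = 0 := by linear_combination (norm := module) e₁ - e₂
    refine (smul_eq_zero.mp this).resolve_left ?_
    have : (2⁻¹ : F) - 2⁻¹ * 2⁻¹ = 2⁻¹ * 2⁻¹ := by field_simp; norm_num
    rw [this]
    exact mul_ne_zero (inv_ne_zero h2) (inv_ne_zero h2)
  rw [ha, smul_zero, add_zero] at e₁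
  rw [e₁, ha, zero_add, add_zero] at h
  exact ⟨e₁, h, ha⟩

theorem peirceJ_isInternal :
    DirectSum.IsInternal ![dec.peirceJ e 1, dec.peirceJ e 2⁻¹, dec.peirceJ e 0] := by
  refine isInternal_of_fin _ (fun a => ?_) (fun v hv hs => ?_)
  · have : a = ((2 : F) • dec.mul e (dec.mul e a) - dec.mul e a) +
        ((4 : F) • dec.mul e a - (4 : F) • dec.mul e (dec.mul e a)) +
        ((2 : F) • dec.mul e (dec.mul e a) - (3 : F) • dec.mul e a + a) := by module
    rw [this]
    exact add_mem (add_mem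
      (Submodule.mem_iSup_of_mem (0 : Fin 3) (dec.peirce_one_mem h2 hι he a))
      (Submodule.mem_iSup_of_mem (1 : Fin 3) (dec.peirce_half_mem h2 hι he a)))
      (Submodule.mem_iSup_of_mem (2 : Fin 3) (dec.peirce_zero_mem h2 hι he a))
  · have hs' : v 0 + v 2 + v 1 = 0 := by rw [← hs, Fin.sum_univ_three]; abel
    obtain ⟨h₀, h₁, h₃⟩ := dec.peirce_independent h2 (hv 0) (hv 2) (hv 1) hs'
    intro i
    fin_cases i <;> assumption

/-- The Peirce decomposition of `J`, with the half component scaled by `2`. -/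
def peirceJEquiv : (dec.peirceJ e 1 × dec.peirceJ e 0 × dec.peirceJ e 2⁻¹) ≃ₗ[F] J :=
  LinearEquiv.ofBijective
    -- The factor 2 here and the factor -8 in `annDEquiv` are the values of `sqMap` in `sqMap_sqAdj`
    -- and `sqMap_sqInv`; with them the copies of `V ⊗ V` assemble without further scaling.
    (LinearMap.coprod (dec.peirceJ e 1).subtype (LinearMap.coprod (dec.peirceJ e 0).subtype
      ((2 : F) • (dec.peirceJ e 2⁻¹).subtype))) (by
    constructor
    · rw [injective_iff_map_eq_zero]
      rintro ⟨⟨a₁, h₁⟩, ⟨a₀, h₀⟩, ⟨ah, hh⟩⟩ h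
      simp only [LinearMap.coprod_apply, Submodule.subtype_apply, LinearMap.smul_apply,
        ← add_assoc] at h
      obtain ⟨rfl, rfl, h⟩ := dec.peirce_independent h2 h₁ h₀ (Submodule.smul_mem _ _ hh) h
      simp only [zero_add] at h
      obtain rfl := (smul_eq_zero.mp h).resolve_left h2
      rfl
    · intro a
      refine ⟨(⟨_, dec.peirce_one_mem h2 hι he a⟩, ⟨_, dec.peirce_zero_mem h2 hι he a⟩,
        (2⁻¹ : F) • ⟨_, dec.peirce_half_mem h2 hι he a⟩), ?_⟩
      simp only [LinearMap.coprod_apply, Submodule.subtype_apply, LinearMap.smul_apply,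
        Submodule.coe_smul, smul_smul, mul_inv_cancel₀ h2]
      module)

theorem peirceJEquiv_apply (a₁ : dec.peirceJ e 1) (a₀ : dec.peirceJ e 0)
    (ah : dec.peirceJ e 2⁻¹) : dec.peirceJEquiv h2 hι he (a₁, a₀, ah) =
      (a₁ : J) + ((a₀ : J) + (2 : F) • (ah : J)) := rfl

/-- A derivation applied to `e · e = e` gives `2 e · d(e) = d(e)`. -/
theorem actJ_idempotent (d : D) : dec.actJ d e ∈ dec.peirceJ e 2⁻¹ := by
  have h := dec.actJ_mul h2 hι d e e
  rw [he, dec.mul_comm' h2 hι _ e] at h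
  rw [mem_peirceJ, eq_inv_smul_iff₀ h2, two_smul]
  exact h.symm

theorem dJ_actJ_idempotent_mem (d : D) : d + (4 : F) • dec.dJ e (dec.actJ d e) ∈ dec.annD e := by
  rw [mem_annD, map_add, map_smul, LinearMap.add_apply, LinearMap.smul_apply,
    dec.actJ_dJ_of_mem_half h2 hι he (dec.actJ_idempotent h2 hι he d), add_neg_cancel]

theorem eq_zero_of_dJ_mem_annD {a : J} (ha : a ∈ dec.peirceJ e 2⁻¹)
    (h : dec.dJ e a ∈ dec.annD e) : a = 0 := by
  have := dec.actJ_dJ_of_mem_half h2 hι he ha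
  rw [dec.mem_annD.mp h, smul_zero] at this
  exact neg_eq_zero.mp this.symm

theorem eq_zero_of_dJ_eq_zero {a : J} (ha : a ∈ dec.peirceJ e 2⁻¹)
    (h : dec.dJ e a = 0) : a = 0 :=
  dec.eq_zero_of_dJ_mem_annD h2 hι he ha (by rw [h]; exact zero_mem _)

/-- The decomposition of `D` into the annihilator of `e` and `D_{e,J_{1/2}}`, suitably scaled. -/
def annDEquiv : (dec.annD e × dec.peirceJ e 2⁻¹) ≃ₗ[F] D :=
  LinearEquiv.ofBijective
    (LinearMap.coprod (dec.annD e).subtype ((-8 : F) • dec.dJ e ∘ₗ (dec.peirceJ e 2⁻¹).subtype))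
    (by
    have h8 : (-8 : F) ≠ 0 := by
      rw [show (-8 : F) = -(2 * 2 * 2) by norm_num]
      exact neg_ne_zero.mpr (mul_ne_zero (mul_ne_zero h2 h2) h2)
    constructor
    · rw [injective_iff_map_eq_zero]
      rintro ⟨⟨d, hd⟩, ⟨a, ha⟩⟩ h
      simp only [LinearMap.coprod_apply, Submodule.subtype_apply, LinearMap.smul_apply,
        LinearMap.comp_apply] at h
      have h' : (-8 : F) • dec.dJ e a ∈ dec.annD e := by
        rw [eq_neg_of_add_eq_zero_right h]
        exact neg_mem hd
      obtain rfl := dec.eq_zero_of_dJ_mem_annD h2 hι he ha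
        ((Submodule.smul_mem_iff _ h8).mp h')
      simp only [map_zero, smul_zero, add_zero] at h
      subst h
      rfl
    · intro d
      -- The decomposition is `d = (d + 4 D_{e,d(e)}) - 8 D_{e,d(e)/2}`.
      refine ⟨(⟨_, dec.dJ_actJ_idempotent_mem h2 hι he d⟩,
        (2⁻¹ : F) • ⟨_, dec.actJ_idempotent h2 hι he d⟩), ?_⟩
      simp only [LinearMap.coprod_apply, Submodule.subtype_apply, LinearMap.smul_apply,
        Submodule.coe_smul, LinearMap.comp_apply, map_smul]
      match_scalars
      · norm_num
      · field_simp
        norm_num)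

theorem annDEquiv_apply (d : dec.annD e) (a : dec.peirceJ e 2⁻¹) :
    dec.annDEquiv h2 hι he (d, a) = (d : D) + (-8 : F) • dec.dJ e a := rfl

include h3

/-- For `a = b = e` the special module identity makes `e` act on `T` as a projection, so no half
component appears there. -/
theorem bul_bul_idempotent (x : T) : dec.bul e (dec.bul e x) = dec.bul e x := by
  have h := dec.special h2 h3 hι e e x
  rw [he, ← two_smul F, smul_smul, inv_mul_cancel₀ h2, one_smul] at h
  exact h.symm

theorem bul_mem (x : T) : dec.bul e x ∈ dec.peirceT e 1 := by
  rw [mem_peirceT, one_smul, dec.bul_bul_idempotent h2 h3 hι he]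

theorem sub_bul_mem (x : T) : x - dec.bul e x ∈ dec.peirceT e 0 := by
  rw [mem_peirceT, map_sub, dec.bul_bul_idempotent h2 h3 hι he, sub_self, zero_smul]

theorem peirceT_isCompl : IsCompl (dec.peirceT e 1) (dec.peirceT e 0) := by
  constructor
  · rw [Submodule.disjoint_def]
    intro x h₁ h₀
    rw [mem_peirceT] at h₁ h₀
    rw [h₁, zero_smul, one_smul] at h₀
    exact h₀
  · rw [codisjoint_iff, Submodule.eq_top_iff']
    intro x
    rw [← add_sub_cancel (dec.bul e x) x]
    exact add_mem (Submodule.mem_sup_left (dec.bul_mem h2 h3 hι he x))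
      (Submodule.mem_sup_right (dec.sub_bul_mem h2 h3 hι he x))

/-- The Peirce decomposition of `T`. -/
def peirceTEquiv : (dec.peirceT e 1 × dec.peirceT e 0) ≃ₗ[F] T :=
  Submodule.prodEquivOfIsCompl _ _ (dec.peirceT_isCompl h2 h3 hι he)

theorem peirceTEquiv_apply (x₁ : dec.peirceT e 1) (x₀ : dec.peirceT e 0) :
    dec.peirceTEquiv h2 h3 hι he (x₁, x₀) = (x₁ : T) + (x₀ : T) := rfl

/-! ### The isotypic decomposition -/

/-- The isomorphism of `L` with the direct sum of copies of the six modules. -/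
def peirceEquiv : ((sl2 F ⊗[F] dec.peirceJ e 1) × (sl2 F ⊗[F] dec.peirceJ e 0) ×
    ((nat2 F ⊗[F] nat2 F) ⊗[F] dec.peirceJ e 2⁻¹) × (nat2 F ⊗[F] dec.peirceT e 1) ×
    (nat2 F ⊗[F] dec.peirceT e 0) × dec.annD e) ≃ₗ[F] L :=
  (diagEquiv _ _ _ _ _ _ h2).symm ≪≫ₗ
  (LinearEquiv.prodCongr (TensorProduct.congr (LinearEquiv.refl F _) (dec.peirceJEquiv h2 hι he))
    (LinearEquiv.prodCongr
      (TensorProduct.congr (LinearEquiv.refl F _) (dec.peirceTEquiv h2 h3 hι he))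
      (dec.annDEquiv h2 hι he))) ≪≫ₗ dec.equiv

omit h2 h3 hι he in
/-- The map `u ⊗ v ↦ γ_{u,v} ⊗ a - 4 (u | v) D_{e,a}`. -/
def sqMap (e : J) (a : J) : nat2 F ⊗[F] nat2 F →ₗ[F] L :=
  dec.adj.flip a ∘ₗ sqGam F - (4 : F) • (sqForm F).smulRight (dec.triv (dec.dJ e a))

omit h2 h3 hι he in
theorem sqMap_apply (a : J) (z : nat2 F ⊗[F] nat2 F) : dec.sqMap e a z =
    dec.adj (sqGam F z) a - (4 : F) • sqForm F z • dec.triv (dec.dJ e a) := rfl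

omit h2 h3 hι he in
theorem sqMap_sqAdj (a : J) (f : sl2 F) :
    dec.sqMap e a (sqAdj F f) = (2 : F) • dec.adj f a := by
  rw [sqMap_apply, sqGam_sqAdj, sqForm_sqAdj]
  simp

omit h2 h3 hι he in
theorem sqMap_sqInv (a : J) :
    dec.sqMap e a (sqInv F) = (-8 : F) • dec.triv (dec.dJ e a) := by
  rw [sqMap_apply, sqGam_sqInv, sqForm_sqInv, map_zero, LinearMap.zero_apply]
  module

theorem peirceEquiv_adj (f : sl2 F) (a₁ : dec.peirceJ e 1) (a₀ : dec.peirceJ e 0)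
    (ah : dec.peirceJ e 2⁻¹) :
    dec.peirceEquiv h2 h3 hι he (f ⊗ₜ a₁, f ⊗ₜ a₀, sqAdj F f ⊗ₜ ah, 0, 0, 0) =
      dec.adj f (a₁ + (a₀ + (2 : F) • ah)) := by
  rw [peirceEquiv, LinearEquiv.trans_apply, LinearEquiv.trans_apply, ← diagEquiv_adj h2,
    LinearEquiv.symm_apply_apply]
  simp [adj_apply, peirceJEquiv_apply]

theorem peirceEquiv_nat (u : nat2 F) (x₁ : dec.peirceT e 1) (x₀ : dec.peirceT e 0) :
    dec.peirceEquiv h2 h3 hι he (0, 0, 0, u ⊗ₜ x₁, u ⊗ₜ x₀, 0) = dec.nat u (x₁ + x₀) := by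
  rw [peirceEquiv, LinearEquiv.trans_apply, LinearEquiv.trans_apply, ← diagEquiv_nat h2,
    LinearEquiv.symm_apply_apply]
  simp [nat_apply, peirceTEquiv_apply]

theorem peirceEquiv_triv (d : dec.annD e) (ah : dec.peirceJ e 2⁻¹) :
    dec.peirceEquiv h2 h3 hι he (0, 0, sqInv F ⊗ₜ ah, 0, 0, d) =
      dec.triv (d + (-8 : F) • dec.dJ e ah) := by
  rw [peirceEquiv, LinearEquiv.trans_apply, LinearEquiv.trans_apply, ← diagEquiv_triv h2,
    LinearEquiv.symm_apply_apply]
  simp [triv_apply, annDEquiv_apply]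

theorem peirceEquiv_adj₁ (f : sl2 F) (a : dec.peirceJ e 1) :
    dec.peirceEquiv h2 h3 hι he (f ⊗ₜ a, 0, 0, 0, 0, 0) = dec.adj f a := by
  simpa using dec.peirceEquiv_adj h2 h3 hι he f a 0 0

theorem peirceEquiv_adj₀ (f : sl2 F) (a : dec.peirceJ e 0) :
    dec.peirceEquiv h2 h3 hι he (0, f ⊗ₜ a, 0, 0, 0, 0) = dec.adj f a := by
  simpa using dec.peirceEquiv_adj h2 h3 hι he f 0 a 0

theorem peirceEquiv_nat₁ (u : nat2 F) (x : dec.peirceT e 1) :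
    dec.peirceEquiv h2 h3 hι he (0, 0, 0, u ⊗ₜ x, 0, 0) = dec.nat u x := by
  simpa using dec.peirceEquiv_nat h2 h3 hι he u x 0

theorem peirceEquiv_nat₀ (u : nat2 F) (x : dec.peirceT e 0) :
    dec.peirceEquiv h2 h3 hι he (0, 0, 0, 0, u ⊗ₜ x, 0) = dec.nat u x := by
  simpa using dec.peirceEquiv_nat h2 h3 hι he u 0 x

theorem peirceEquiv_annD (d : dec.annD e) :
    dec.peirceEquiv h2 h3 hι he (0, 0, 0, 0, 0, d) = dec.triv d := by
  simpa using dec.peirceEquiv_triv h2 h3 hι he d 0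

/-- Both sides are linear in `z` and agree on the images of `sqAdj` and on `sqInv`, which by
`sqAdj_sqGam` span `V ⊗ V` once 2 is invertible. -/
theorem peirceEquiv_sq (z : nat2 F ⊗[F] nat2 F) (a : dec.peirceJ e 2⁻¹) :
    dec.peirceEquiv h2 h3 hι he (0, 0, z ⊗ₜ a, 0, 0, 0) = dec.sqMap e a z := by
  have hA : ∀ f, dec.peirceEquiv h2 h3 hι he (0, 0, sqAdj F f ⊗ₜ a, 0, 0, 0) =
      dec.sqMap e a (sqAdj F f) := fun f => by
    have := dec.peirceEquiv_adj h2 h3 hι he f 0 0 a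
    rw [sqMap_sqAdj]
    simpa using this
  have hI : dec.peirceEquiv h2 h3 hι he (0, 0, sqInv F ⊗ₜ a, 0, 0, 0) =
      dec.sqMap e a (sqInv F) := by
    have := dec.peirceEquiv_triv h2 h3 hι he 0 a
    rw [sqMap_sqInv]
    simpa using this
  let κ : nat2 F ⊗[F] nat2 F →ₗ[F] L := (dec.peirceEquiv h2 h3 hι he).toLinearMap ∘ₗ
    LinearMap.inr F _ _ ∘ₗ LinearMap.inr F _ _ ∘ₗ LinearMap.inl F _ _ ∘ₗ
      (TensorProduct.mk F (nat2 F ⊗[F] nat2 F) (dec.peirceJ e 2⁻¹)).flip a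
  change κ z = _
  apply smul_right_injective L h2
  simp only [← map_smul]
  rw [← sqAdj_sqGam z, map_add, map_add, map_smul, map_smul]
  exact congrArg₂ (· + ·) (hA _) (congrArg _ hI)

/-- Elements of `L` are spanned by pure elements of the six kinds. -/
theorem peirce_induction {p : L → Prop} (l : L) (hadd : ∀ l l', p l → p l' → p (l + l'))
    (hadj₁ : ∀ f, ∀ a ∈ dec.peirceJ e 1, p (dec.adj f a))
    (hadj₀ : ∀ f, ∀ a ∈ dec.peirceJ e 0, p (dec.adj f a))
    (hsq : ∀ z, ∀ a ∈ dec.peirceJ e 2⁻¹, p (dec.sqMap e a z))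
    (hnat₁ : ∀ u, ∀ x ∈ dec.peirceT e 1, p (dec.nat u x))
    (hnat₀ : ∀ u, ∀ x ∈ dec.peirceT e 0, p (dec.nat u x))
    (htriv : ∀ d ∈ dec.annD e, p (dec.triv d)) : p l := by
  have e8 : (-8 : F) ≠ 0 := by
    rw [show (-8 : F) = -(2 * 2 * 2) by norm_num]
    exact neg_ne_zero.mpr (mul_ne_zero (mul_ne_zero h2 h2) h2)
  induction l using dec.induction_on with
  | hadd l l' h h' => exact hadd _ _ h h'
  | hadj f a =>
    obtain ⟨⟨a₁, a₀, ah⟩, rfl⟩ := (dec.peirceJEquiv h2 hι he).surjective a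
    rw [peirceJEquiv_apply, map_add, map_add, map_smul, ← dec.sqMap_sqAdj (e := e)]
    exact hadd _ _ (hadj₁ f _ a₁.2) (hadd _ _ (hadj₀ f _ a₀.2) (hsq _ _ ah.2))
  | hnat u x =>
    obtain ⟨⟨x₁, x₀⟩, rfl⟩ := (dec.peirceTEquiv h2 h3 hι he).surjective x
    rw [peirceTEquiv_apply, map_add]
    exact hadd _ _ (hnat₁ u _ x₁.2) (hnat₀ u _ x₀.2)
  | htriv d =>
    obtain ⟨⟨s, a⟩, rfl⟩ := (dec.annDEquiv h2 hι he).surjective d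
    rw [annDEquiv_apply, map_add, map_smul, ← dec.sqMap_sqInv (e := e)]
    exact hadd _ _ (htriv _ s.2) (hsq _ _ a.2)

end ShortDecomposition

/-! ### One-sided identities for `γ`, and square-zero matrices -/

section SquareZero

variable {F : Type u} [Field F]

/-- The symmetric formula `[X, γ_{u,v}] = γ_{Xu,v} + γ_{u,Xv}` does not suffice on `V₁ ⊗ V₀`, where
each factor acts on one slot. This version and `lie_gam_right` involve a single slot, at the cost of
a multiple of `(u|v) X`. -/
theorem lie_gam_left (X : sl2 F) (u v : nat2 F) :
    ⁅X, gam u v⁆ = (2 : F) • gam (X.natL u) v + (2 * form u v) • X := by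
  apply sl2.ext
  ext i j
  fin_cases i <;> fin_cases j <;>
    simp [sl2.val_lie, gam, form, Matrix.mul_apply, Fin.sum_univ_two, Matrix.mulVec, dotProduct,
      Matrix.vecMulVec_apply, X.val_one_one] <;> ring

theorem lie_gam_right (X : sl2 F) (u v : nat2 F) :
    ⁅X, gam u v⁆ = (2 : F) • gam u (X.natL v) - (2 * form u v) • X := by
  apply sl2.ext
  ext i j
  fin_cases i <;> fin_cases j <;>
    simp [sl2.val_lie, gam, form, Matrix.mul_apply, Fin.sum_univ_two, Matrix.mulVec, dotProduct,
      Matrix.vecMulVec_apply, X.val_one_one] <;> ring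

theorem trace_mul_gam_left (X : sl2 F) (u v : nat2 F) :
    (X.val * (gam u v).val).trace = -2 * form (X.natL u) v := by
  simp [Matrix.trace_fin_two, gam, form, Matrix.mul_apply, Fin.sum_univ_two, Matrix.mulVec,
    dotProduct, Matrix.vecMulVec_apply, X.val_one_one]
  ring

theorem trace_mul_gam_right (X : sl2 F) (u v : nat2 F) :
    (X.val * (gam u v).val).trace = 2 * form u (X.natL v) := by
  simp [Matrix.trace_fin_two, gam, form, Matrix.mul_apply, Fin.sum_univ_two, Matrix.mulVec,
    dotProduct, Matrix.vecMulVec_apply, X.val_one_one]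
  ring

/-- Every term of the cubed commutator has at least two adjacent factors `N` on one side of `f`. -/
theorem lie_lie_lie_of_mul_self {N : sl2 F} (hN : N.val * N.val = 0) (f : sl2 F) :
    ⁅N, ⁅N, ⁅N, f⁆⁆⁆ = 0 := by
  apply sl2.ext
  simp only [sl2.val_lie, mul_sub, sub_mul, mul_assoc, hN, mul_zero, zero_mul]
  simp only [← mul_assoc, hN, zero_mul, mul_zero, sub_self, map_zero]

theorem natL_natL_of_mul_self {N : sl2 F} (hN : N.val * N.val = 0) (u : nat2 F) :
    N.natL (N.natL u) = 0 := by
  rw [sl2.natL_apply, sl2.natL_apply, Matrix.mulVec_mulVec, hN, Matrix.zero_mulVec]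

theorem natL₂_natL₂_of_mul_self {N : sl2 F} (hN : N.val * N.val = 0) (z : nat2 F ⊗[F] nat2 F) :
    natL₂ (N, 0) (natL₂ (N, 0) z) = 0 ∧ natL₂ (0, N) (natL₂ (0, N) z) = 0 := by
  have h0 : ∀ u, (0 : sl2 F).natL u = 0 := fun u => by simp
  induction z with
  | zero => simp
  | tmul u v =>
    simp only [natL₂_tmul, map_add, natL_natL_of_mul_self hN, h0, TensorProduct.zero_tmul,
      TensorProduct.tmul_zero, add_zero, zero_add, map_zero, and_self]
  | add a b ha hb => simp only [map_add, ha.1, ha.2, hb.1, hb.2, add_zero, and_self]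

end SquareZero

/-! ### Restriction to one factor, and elementary matrices as points `1 + t X` -/

section Restriction

variable {F : Type u} [Field F] {M : Type v} [AddCommGroup M] [Module F M]

/-- The restriction of a representation of `SL₂ × SL₂` to the first factor. -/
def GroupRep.restrictFst (ρ : GroupRep (SL2SL2 F) M) : GroupRep (SL2 F) M where
  act R _ _ := (ρ.act R).comp (MonoidHom.inl ((SL2 F).pts R) ((SL2 F).pts R))
  natural φ g x := by
    have h := ρ.natural φ (g, 1) x
    simpa using h

/-- The restriction of a representation of `SL₂ × SL₂` to the second factor. -/
def GroupRep.restrictSnd (ρ : GroupRep (SL2SL2 F) M) : GroupRep (SL2 F) M where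
  act R _ _ := (ρ.act R).comp (MonoidHom.inr ((SL2 F).pts R) ((SL2 F).pts R))
  natural φ g x := by
    have h := ρ.natural φ (1, g) x
    simpa using h

theorem isOneAdd_upper {R : Type u} [CommRing R] [Algebra F R] (t : R) :
    IsOneAdd (sl2.elE F) t (upper t) := by
  unfold IsOneAdd
  rw [coe_upper]
  ext i j
  fin_cases i <;> fin_cases j <;> simp [sl2.elE]

theorem isOneAdd_lower {R : Type u} [CommRing R] [Algebra F R] (t : R) :
    IsOneAdd (sl2.elF F) t (lower t) := by
  unfold IsOneAdd
  rw [coe_lower]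
  ext i j
  fin_cases i <;> fin_cases j <;> simp [sl2.elF]

theorem elE_mul_self : (sl2.elE F).val * (sl2.elE F).val = 0 := by
  ext i j
  fin_cases i <;> fin_cases j <;> simp [sl2.elE, Matrix.mul_apply, Fin.sum_univ_two]

theorem elF_mul_self : (sl2.elF F).val * (sl2.elF F).val = 0 := by
  ext i j
  fin_cases i <;> fin_cases j <;> simp [sl2.elF, Matrix.mul_apply, Fin.sum_univ_two]

end Restriction

theorem GStructure.ext_toGroupRep {F : Type u} [Field F] {G : GroupFunctor F} {L : Type v}
    [LieRing L] [LieAlgebra F L] {Φ Ψ : GStructure G L} (h : Φ.toGroupRep = Ψ.toGroupRep) :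
    Φ = Ψ := by
  cases Φ; cases Ψ; cases h; rfl

namespace ShortDecomposition

variable {F : Type u} [Field F] {L : Type v} [LieRing L] [LieAlgebra F L]
variable {Ψ : GStructure (SL2 F) L} {J T D : Type*}
  [AddCommGroup J] [Module F J] [AddCommGroup T] [Module F T] [AddCommGroup D] [Module F D]
  (dec : ShortDecomposition Ψ J T D) {ι : sl2 F →ₗ⁅F⁆ L}

variable (ι) in
/-- The map `(f₁, f₀) ↦ f₁ ⊗ e + f₀ ⊗ (1 - e)`. -/
def splitMap (e : J) : sl2 F × sl2 F →ₗ[F] L :=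
  LinearMap.coprod (dec.adj.flip e) (dec.adj.flip (dec.one ι - e))

theorem splitMap_apply (e : J) (X : sl2 F × sl2 F) :
    dec.splitMap ι e X = dec.adj X.1 e + dec.adj X.2 (dec.one ι - e) := rfl

variable (h2 : (2 : F) ≠ 0) (h3 : (3 : F) ≠ 0) (hι : IsInnerSL2 Ψ ι) {e : J}

include h2 h3 hι

/-! ### The action of the two copies of `𝔰𝔩₂` -/

/-- Because `1 · a = a` and `D_{1,a} = 0`, the summand `1 - e` contributes `a - e · a` and
`-D_{e,a}`. -/
theorem lie_splitMap_adj (X : sl2 F × sl2 F) (f : sl2 F) (a : J) :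
    ⁅dec.splitMap ι e X, dec.adj f a⁆ = dec.adj ⁅X.1, f⁆ (dec.mul e a) +
      dec.adj ⁅X.2, f⁆ (a - dec.mul e a) +
      (2 * ((X.1.val * f.val).trace - (X.2.val * f.val).trace)) • dec.triv (dec.dJ e a) := by
  rw [splitMap_apply, add_lie, dec.lie_adj_adj h2 hι, dec.lie_adj_adj h2 hι, map_sub, map_sub,
    LinearMap.sub_apply, LinearMap.sub_apply, dec.one_mul' h2 h3 hι, dec.dJ_one h2 h3 hι,
    map_smul, map_smul, map_sub dec.triv, map_zero]
  module

theorem lie_splitMap_adj₁ (X : sl2 F × sl2 F) (f : sl2 F) (he : dec.mul e e = e) {a : J}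
    (ha : a ∈ dec.peirceJ e 1) : ⁅dec.splitMap ι e X, dec.adj f a⁆ = dec.adj ⁅X.1, f⁆ a := by
  rw [dec.lie_splitMap_adj h2 h3 hι, dec.dJ_eq_zero_of_mem_one h2 hι he ha,
    dec.mem_peirceJ.mp ha]
  simp

theorem lie_splitMap_adj₀ (X : sl2 F × sl2 F) (f : sl2 F) (he : dec.mul e e = e) {a : J}
    (ha : a ∈ dec.peirceJ e 0) : ⁅dec.splitMap ι e X, dec.adj f a⁆ = dec.adj ⁅X.2, f⁆ a := by
  rw [dec.lie_splitMap_adj h2 h3 hι, dec.dJ_eq_zero_of_mem_zero h2 hι he ha,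
    dec.mem_peirceJ.mp ha]
  simp

theorem lie_splitMap_nat (X : sl2 F × sl2 F) (u : nat2 F) (x : T) :
    ⁅dec.splitMap ι e X, dec.nat u x⁆ = dec.nat (X.1.natL u) (dec.bul e x) +
      dec.nat (X.2.natL u) (x - dec.bul e x) := by
  rw [splitMap_apply, add_lie, dec.lie_adj_nat h2 h3 hι, dec.lie_adj_nat h2 h3 hι, map_sub,
    LinearMap.sub_apply, dec.one_bul' h2 h3 hι]
  rfl

theorem lie_splitMap_nat₁ (X : sl2 F × sl2 F) (u : nat2 F) {x : T} (hx : x ∈ dec.peirceT e 1) :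
    ⁅dec.splitMap ι e X, dec.nat u x⁆ = dec.nat (X.1.natL u) x := by
  rw [dec.lie_splitMap_nat h2 h3 hι, dec.mem_peirceT.mp hx]
  simp

theorem lie_splitMap_nat₀ (X : sl2 F × sl2 F) (u : nat2 F) {x : T} (hx : x ∈ dec.peirceT e 0) :
    ⁅dec.splitMap ι e X, dec.nat u x⁆ = dec.nat (X.2.natL u) x := by
  rw [dec.lie_splitMap_nat h2 h3 hι, dec.mem_peirceT.mp hx]
  simp

/-- Elements of `D` commute with `ι(f) = f ⊗ 1`, so they annihilate `1`, and only `d(e)` remains. -/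
theorem lie_splitMap_triv (X : sl2 F × sl2 F) (d : D) :
    ⁅dec.splitMap ι e X, dec.triv d⁆ = dec.adj (X.2 - X.1) (dec.actJ d e) := by
  have h1 : dec.adj X.2 (dec.actJ d (dec.one ι)) = 0 := by
    rw [← dec.lie_triv_adj h2 hι, ← dec.inner_eq h2 h3 hι, ← lie_skew, dec.lie_triv hι, neg_zero]
  rw [← lie_skew, splitMap_apply, lie_add, dec.lie_triv_adj h2 hι, dec.lie_triv_adj h2 hι, map_sub,
    map_sub, h1, map_sub, LinearMap.sub_apply]
  abel

theorem lie_splitMap_annD (X : sl2 F × sl2 F) {d : D} (hd : d ∈ dec.annD e) :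
    ⁅dec.splitMap ι e X, dec.triv d⁆ = 0 := by
  rw [dec.lie_splitMap_triv h2 h3 hι, dec.mem_annD.mp hd, map_zero]

/-- The coefficient `-4` in `sqMap` is what makes this work. As `e · a = ½ a`, the one-sided
formulas give `γ_{X₁u,v} ⊗ a + γ_{u,X₀v} ⊗ a` with an error `(u|v)(X₁ - X₀) ⊗ a`. This is cancelled
by the bracket with `-4 (u|v) D_{e,a}`, since `4 D_{e,a}(e) = -a`, and the traces produce the new
`D`-component. -/
theorem lie_splitMap_sqMap (X : sl2 F × sl2 F) (z : nat2 F ⊗[F] nat2 F) (he : dec.mul e e = e)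
    {a : J} (ha : a ∈ dec.peirceJ e 2⁻¹) :
    ⁅dec.splitMap ι e X, dec.sqMap e a z⁆ = dec.sqMap e a (natL₂ X z) := by
  induction z with
  | zero => simp
  | add z w hz hw => simp only [map_add, lie_add, hz, hw]
  | tmul u v =>
    have hD := dec.actJ_dJ_of_mem_half h2 hι he ha
    have hD' : dec.adj (X.2 - X.1) ((4 : F) • dec.actJ (dec.dJ e a) e) =
        -dec.adj (X.2 - X.1) a := by
      rw [hD, map_neg]
    rw [map_smul] at hD'
    have hm : dec.mul e a = (2⁻¹ : F) • a := dec.mem_peirceJ.mp ha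
    have hm' : a - (2⁻¹ : F) • a = (2⁻¹ : F) • a := by
      match_scalars
      field_simp
      norm_num
    have hc : ∀ b : L, (2⁻¹ : F) • (2 : F) • b = b := fun b => by
      rw [smul_smul, inv_mul_cancel₀ h2, one_smul]
    simp only [sqMap_apply, natL₂_tmul, map_add, sqGam_tmul, sqForm_tmul, lie_sub, lie_smul,
      dec.lie_splitMap_adj h2 h3 hι, dec.lie_splitMap_triv h2 h3 hι, hm, hm']
    rw [lie_gam_left X.1, lie_gam_right X.2, trace_mul_gam_left, trace_mul_gam_right]
    rw [smul_comm (4 : F) (form u v), hD']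
    simp only [map_add, map_sub, map_smul, LinearMap.add_apply, LinearMap.sub_apply,
      LinearMap.smul_apply, smul_add, smul_sub, hc, mul_smul]
    module

/-- Here `e ∈ J₁` and `1 - e ∈ J₀`, so the image itself consists of one adjoint copy for each
factor. -/
theorem splitMap_lie (he : dec.mul e e = e) (X Y : sl2 F × sl2 F) :
    dec.splitMap ι e ⁅X, Y⁆ = ⁅dec.splitMap ι e X, dec.splitMap ι e Y⁆ := by
  have h₁ : e ∈ dec.peirceJ e 1 := by rw [mem_peirceJ, he, one_smul]
  have h₀ : dec.one ι - e ∈ dec.peirceJ e 0 := by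
    rw [mem_peirceJ, map_sub, he, dec.mul_comm' h2 hι, dec.one_mul' h2 h3 hι, sub_self, zero_smul]
  rw [dec.splitMap_apply e Y, lie_add, dec.lie_splitMap_adj₁ h2 h3 hι X _ he h₁,
    dec.lie_splitMap_adj₀ h2 h3 hι X _ he h₀]
  rfl

theorem splitMap_injective (he : dec.mul e e = e) (h0 : e ≠ 0) (h1 : e ≠ dec.one ι) :
    Function.Injective (dec.splitMap ι e) := by
  rw [injective_iff_map_eq_zero]
  rintro ⟨X₁, X₀⟩ h
  rw [splitMap_apply] at h
  have key : ∀ i j, X₁.val i j • e + X₀.val i j • (dec.one ι - e) = 0 := fun i j => by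
    have := congrArg (dec.coordJ i j) h
    simpa only [map_add, coordJ_adj, map_zero] using this
  have key' : ∀ i j, X₁.val i j = 0 := fun i j => by
    have := congrArg (dec.mul e) (key i j)
    simp only [map_add, map_smul, map_sub, he, dec.mul_comm' h2 hι e (dec.one ι),
      dec.one_mul' h2 h3 hι, sub_self, smul_zero, add_zero, map_zero] at this
    exact (smul_eq_zero.mp this).resolve_right h0
  have key'' : ∀ i j, X₀.val i j = 0 := fun i j => by
    have := key i j
    rw [key', zero_smul, zero_add] at this
    exact (smul_eq_zero.mp this).resolve_right (sub_ne_zero.mpr h1.symm)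
  refine Prod.ext (sl2.ext ?_) (sl2.ext ?_)
  · ext i j; exact key' i j
  · ext i j; exact key'' i j

/-- The homomorphism `(f₁, f₀) ↦ f₁ ⊗ e + f₀ ⊗ (1 - e)` of Lie algebras. -/
def splitLie (he : dec.mul e e = e) : sl2 F × sl2 F →ₗ⁅F⁆ L where
  toLinearMap := dec.splitMap ι e
  map_lie' {X Y} := dec.splitMap_lie h2 h3 hι he X Y

variable (he : dec.mul e e = e)

include he

/-- A square-zero matrix acts with cube zero on the adjoint module and with square zero on the
natural modules. On `V₁ ⊗ V₀` the square vanishes because `X` acts on one slot only. -/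
theorem lie_lie_lie_splitMap {N : sl2 F} (hN : N.val * N.val = 0) {X : sl2 F × sl2 F}
    (hX : X = (N, 0) ∨ X = (0, N)) (l : L) :
    ⁅dec.splitMap ι e X, ⁅dec.splitMap ι e X, ⁅dec.splitMap ι e X, l⁆⁆⁆ = 0 := by
  have hX₁ : X.1.val * X.1.val = 0 := by rcases hX with rfl | rfl <;> simp [hN]
  have hX₀ : X.2.val * X.2.val = 0 := by rcases hX with rfl | rfl <;> simp [hN]
  have hX₂ : ∀ z, natL₂ X (natL₂ X z) = 0 := by
    intro z
    rcases hX with rfl | rfl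
    · exact (natL₂_natL₂_of_mul_self hN z).1
    · exact (natL₂_natL₂_of_mul_self hN z).2
  induction l using dec.peirce_induction h2 h3 hι he with
  | hadd l l' h h' => simp only [lie_add, h, h', add_zero]
  | hadj₁ f a ha =>
    simp only [dec.lie_splitMap_adj₁ h2 h3 hι X _ he ha, lie_lie_lie_of_mul_self hX₁, map_zero,
      LinearMap.zero_apply]
  | hadj₀ f a ha =>
    simp only [dec.lie_splitMap_adj₀ h2 h3 hι X _ he ha, lie_lie_lie_of_mul_self hX₀, map_zero,
      LinearMap.zero_apply]
  | hsq z a ha => simp only [dec.lie_splitMap_sqMap h2 h3 hι X _ he ha, hX₂, map_zero, lie_zero]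
  | hnat₁ u x hx =>
    simp only [dec.lie_splitMap_nat₁ h2 h3 hι X _ hx, natL_natL_of_mul_self hX₁, map_zero,
      LinearMap.zero_apply, lie_zero]
  | hnat₀ u x hx =>
    simp only [dec.lie_splitMap_nat₀ h2 h3 hι X _ hx, natL_natL_of_mul_self hX₀, map_zero,
      LinearMap.zero_apply, lie_zero]
  | htriv d hd => rw [dec.lie_splitMap_annD h2 h3 hι X hd, lie_zero, lie_zero]

end ShortDecomposition

theorem Equivariant.of_eq {F : Type u} [Field F] {G : GroupFunctor F} {M : Type v} [AddCommGroup M]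
    [Module F M] {N : Type w} [AddCommGroup N] [Module F N] {σ : GroupRep G M} {ρ : GroupRep G N}
    {φ ψ : M →ₗ[F] N} (h : Equivariant σ ρ φ) (hψ : ∀ m, ψ m = φ m) : Equivariant σ ρ ψ := by
  obtain rfl : ψ = φ := LinearMap.ext hψ
  exact h

theorem mem_lieStabilizer_of_elementary {F : Type u} [Field F] {L : Type v} [LieRing L]
    [LieAlgebra F L] (ρ : GroupRep (SL2SL2 F) L)
    (hu₁ : ∀ (R : Type u) [CommRing R] [Algebra F R] (t : R), (upper t, 1) ∈ ρ.lieStabilizer R)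
    (hl₁ : ∀ (R : Type u) [CommRing R] [Algebra F R] (t : R), (lower t, 1) ∈ ρ.lieStabilizer R)
    (hu₀ : ∀ (R : Type u) [CommRing R] [Algebra F R] (t : R), (1, upper t) ∈ ρ.lieStabilizer R)
    (hl₀ : ∀ (R : Type u) [CommRing R] [Algebra F R] (t : R), (1, lower t) ∈ ρ.lieStabilizer R)
    (R : Type u) [CommRing R] [Algebra F R] (g : (SL2SL2 F).pts R) : g ∈ ρ.lieStabilizer R := by
  have h₁ : (g.1, 1) ∈ ρ.lieStabilizer R := fun x y =>
    map_lie_of_elementary ρ.restrictFst (fun R _ _ t x y => hu₁ R t x y)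
      (fun R _ _ t x y => hl₁ R t x y) R g.1 x y
  have h₀ : (1, g.2) ∈ ρ.lieStabilizer R := fun x y =>
    map_lie_of_elementary ρ.restrictSnd (fun R _ _ t x y => hu₀ R t x y)
      (fun R _ _ t x y => hl₀ R t x y) R g.2 x y
  have e : g = (g.1, 1) * (1, g.2) := by simp
  rw [e]
  exact Submonoid.mul_mem _ h₁ h₀

namespace ShortDecomposition

variable {F : Type u} [Field F] {L : Type v} [LieRing L] [LieAlgebra F L]
variable {Ψ : GStructure (SL2 F) L} {J T D : Type*}
  [AddCommGroup J] [Module F J] [AddCommGroup T] [Module F T] [AddCommGroup D] [Module F D]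
  (dec : ShortDecomposition Ψ J T D) {ι : sl2 F →ₗ⁅F⁆ L}
  (h2 : (2 : F) ≠ 0) (h3 : (3 : F) ≠ 0) (hι : IsInnerSL2 Ψ ι) {e : J} (he : dec.mul e e = e)

/-! ### The `(SL₂ × SL₂)`-structure of an idempotent -/

/-- The direct sum of copies of the six modules. -/
def peirceRep (e : J) : GroupRep (SL2SL2 F) ((sl2 F ⊗[F] dec.peirceJ e 1) ×
    (sl2 F ⊗[F] dec.peirceJ e 0) × ((nat2 F ⊗[F] nat2 F) ⊗[F] dec.peirceJ e 2⁻¹) ×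
    (nat2 F ⊗[F] dec.peirceT e 1) × (nat2 F ⊗[F] dec.peirceT e 0) × dec.annD e) :=
  ((adjRep₁ F).tensor (GroupRep.trivial (SL2SL2 F) (dec.peirceJ e 1))).prod
    (((adjRep₀ F).tensor (GroupRep.trivial (SL2SL2 F) (dec.peirceJ e 0))).prod
    (((natRep₁₀ F).tensor (GroupRep.trivial (SL2SL2 F) (dec.peirceJ e 2⁻¹))).prod
    (((natRep₁ F).tensor (GroupRep.trivial (SL2SL2 F) (dec.peirceT e 1))).prod
    (((natRep₀ F).tensor (GroupRep.trivial (SL2SL2 F) (dec.peirceT e 0))).prod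
    (GroupRep.trivial (SL2SL2 F) (dec.annD e))))))

/-- The representation of `SL₂ × SL₂` on `L` defined by an idempotent. -/
def splitRep : GroupRep (SL2SL2 F) L := (dec.peirceRep e).congr (dec.peirceEquiv h2 h3 hι he)

theorem splitRep_adj₁ {a : J} (ha : a ∈ dec.peirceJ e 1) :
    Equivariant (adjRep₁ F) (dec.splitRep h2 h3 hι he) (dec.adj.flip a) := by
  have h := (congr_equivariant (dec.peirceRep e) (dec.peirceEquiv h2 h3 hι he)).comp

    ((inl_equivariant _ _).comp (mk_flip_equivariant (adjRep₁ F) (⟨a, ha⟩ : dec.peirceJ e 1)))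
  exact h.of_eq fun f => (dec.peirceEquiv_adj₁ h2 h3 hι he f ⟨a, ha⟩).symm

theorem splitRep_adj₀ {a : J} (ha : a ∈ dec.peirceJ e 0) :
    Equivariant (adjRep₀ F) (dec.splitRep h2 h3 hι he) (dec.adj.flip a) := by
  have h := (congr_equivariant (dec.peirceRep e) (dec.peirceEquiv h2 h3 hι he)).comp
    ((inr_equivariant _ _).comp
    ((inl_equivariant _ _).comp (mk_flip_equivariant (adjRep₀ F) (⟨a, ha⟩ : dec.peirceJ e 0))))
  exact h.of_eq fun f => (dec.peirceEquiv_adj₀ h2 h3 hι he f ⟨a, ha⟩).symm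

theorem splitRep_sqMap {a : J} (ha : a ∈ dec.peirceJ e 2⁻¹) :
    Equivariant (natRep₁₀ F) (dec.splitRep h2 h3 hι he) (dec.sqMap e a) := by
  have h := (congr_equivariant (dec.peirceRep e) (dec.peirceEquiv h2 h3 hι he)).comp
    ((inr_equivariant _ _).comp
    ((inr_equivariant _ _).comp ((inl_equivariant _ _).comp
      (mk_flip_equivariant (natRep₁₀ F) (⟨a, ha⟩ : dec.peirceJ e 2⁻¹)))))
  exact h.of_eq fun z => (dec.peirceEquiv_sq h2 h3 hι he z ⟨a, ha⟩).symm

theorem splitRep_nat₁ {x : T} (hx : x ∈ dec.peirceT e 1) :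
    Equivariant (natRep₁ F) (dec.splitRep h2 h3 hι he) (dec.nat.flip x) := by
  have h := (congr_equivariant (dec.peirceRep e) (dec.peirceEquiv h2 h3 hι he)).comp
    ((inr_equivariant _ _).comp
    ((inr_equivariant _ _).comp ((inr_equivariant _ _).comp ((inl_equivariant _ _).comp
      (mk_flip_equivariant (natRep₁ F) (⟨x, hx⟩ : dec.peirceT e 1))))))
  exact h.of_eq fun u => (dec.peirceEquiv_nat₁ h2 h3 hι he u ⟨x, hx⟩).symm

theorem splitRep_nat₀ {x : T} (hx : x ∈ dec.peirceT e 0) :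
    Equivariant (natRep₀ F) (dec.splitRep h2 h3 hι he) (dec.nat.flip x) := by
  have h := (congr_equivariant (dec.peirceRep e) (dec.peirceEquiv h2 h3 hι he)).comp
    ((inr_equivariant _ _).comp
    ((inr_equivariant _ _).comp ((inr_equivariant _ _).comp ((inr_equivariant _ _).comp
      ((inl_equivariant _ _).comp
        (mk_flip_equivariant (natRep₀ F) (⟨x, hx⟩ : dec.peirceT e 0)))))))
  exact h.of_eq fun u => (dec.peirceEquiv_nat₀ h2 h3 hι he u ⟨x, hx⟩).symm

theorem splitRep_annD {d : D} (hd : d ∈ dec.annD e) :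
    dec.triv d ∈ (dec.splitRep h2 h3 hι he).fixed := by
  have h := (congr_equivariant (dec.peirceRep e) (dec.peirceEquiv h2 h3 hι he)).comp
    ((inr_equivariant _ _).comp
    ((inr_equivariant _ _).comp ((inr_equivariant _ _).comp ((inr_equivariant _ _).comp
      (inr_equivariant _ _)))))
  rw [← dec.peirceEquiv_annD h2 h3 hι he ⟨d, hd⟩]
  exact h.map_mem_fixed (GroupRep.trivial_fixed _)

/-- Each kind of pure element spans an equivariant copy of a module on which `ExpAct` is known, and
the bracket with `splitMap` is the Lie algebra action on that copy. At dual number points this gives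
innerness; at elementary matrices it gives automorphisms. -/
theorem splitRep_act {X : sl2 F × sl2 F} {R : Type u} [CommRing R] [Algebra F R] {r : R}
    {g : (SL2SL2 F).pts R} (h₁ : IsOneAdd X.1 r g.1) (h₀ : IsOneAdd X.2 r g.2) (l : L) :
    (dec.splitRep h2 h3 hι he).act R g (1 ⊗ₜ l) = 1 ⊗ₜ l + r ⊗ₜ ⁅dec.splitMap ι e X, l⁆ +
      (r ^ 2) ⊗ₜ ((2⁻¹ : F) • ⁅dec.splitMap ι e X, ⁅dec.splitMap ι e X, l⁆⁆) := by
  have e₁ : ExpAct (adjRep₁ F) R g r X.1.adL := expAct_adj h2 h₁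
  have e₀ : ExpAct (adjRep₀ F) R g r X.2.adL := expAct_adj h2 h₀
  have n₁ : ExpAct (natRep₁ F) R g r X.1.natL := expAct_nat h₁
  have n₀ : ExpAct (natRep₀ F) R g r X.2.natL := expAct_nat h₀
  induction l using dec.peirce_induction h2 h3 hι he with
  | hadd l l' h h' =>
    simp only [TensorProduct.tmul_add, map_add, h, h', lie_add, smul_add]
    abel
  | hadj₁ f a ha =>
    simp only [dec.lie_splitMap_adj₁ h2 h3 hι X _ he ha]
    exact (dec.splitRep_adj₁ h2 h3 hι he ha).expAct_apply e₁ f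
  | hadj₀ f a ha =>
    simp only [dec.lie_splitMap_adj₀ h2 h3 hι X _ he ha]
    exact (dec.splitRep_adj₀ h2 h3 hι he ha).expAct_apply e₀ f
  | hsq z a ha =>
    simp only [dec.lie_splitMap_sqMap h2 h3 hι X _ he ha]
    exact (dec.splitRep_sqMap h2 h3 hι he ha).expAct_apply (expAct_nat₁₀ h2 h₁ h₀) z
  | hnat₁ u x hx =>
    simp only [dec.lie_splitMap_nat₁ h2 h3 hι X _ hx]
    exact (dec.splitRep_nat₁ h2 h3 hι he hx).expAct_apply n₁ u
  | hnat₀ u x hx =>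
    simp only [dec.lie_splitMap_nat₀ h2 h3 hι X _ hx]
    exact (dec.splitRep_nat₀ h2 h3 hι he hx).expAct_apply n₀ u
  | htriv d hd =>
    rw [dec.lie_splitMap_annD h2 h3 hι X hd, dec.splitRep_annD h2 h3 hι he hd R g]
    simp

theorem splitRep_mem_lieStabilizer (R : Type u) [CommRing R] [Algebra F R]
    (g : (SL2SL2 F).pts R) : g ∈ (dec.splitRep h2 h3 hι he).lieStabilizer R := by
  have hE := elE_mul_self (F := F)
  have hF := elF_mul_self (F := F)
  refine mem_lieStabilizer_of_elementary _ (fun R _ _ t => ?_) (fun R _ _ t => ?_)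
    (fun R _ _ t => ?_) (fun R _ _ t => ?_) R g
  · exact mem_lieStabilizer_of_expAct h2 h3 _
      (dec.splitRep_act h2 h3 hι he (X := (sl2.elE F, 0)) (isOneAdd_upper t) (isOneAdd_zero t))
      (dec.lie_lie_lie_splitMap h2 h3 hι he hE (Or.inl rfl))
  · exact mem_lieStabilizer_of_expAct h2 h3 _
      (dec.splitRep_act h2 h3 hι he (X := (sl2.elF F, 0)) (isOneAdd_lower t) (isOneAdd_zero t))
      (dec.lie_lie_lie_splitMap h2 h3 hι he hF (Or.inl rfl))
  · exact mem_lieStabilizer_of_expAct h2 h3 _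
      (dec.splitRep_act h2 h3 hι he (X := (0, sl2.elE F)) (isOneAdd_zero t) (isOneAdd_upper t))
      (dec.lie_lie_lie_splitMap h2 h3 hι he hE (Or.inr rfl))
  · exact mem_lieStabilizer_of_expAct h2 h3 _
      (dec.splitRep_act h2 h3 hι he (X := (0, sl2.elF F)) (isOneAdd_zero t) (isOneAdd_lower t))
      (dec.lie_lie_lie_splitMap h2 h3 hι he hF (Or.inr rfl))

/-- The `(SL₂ × SL₂)`-structure on `L` defined by an idempotent. -/
def splitStructure : GStructure (SL2SL2 F) L where
  toGroupRep := dec.splitRep h2 h3 hι he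
  map_lie R _ _ g := dec.splitRep_mem_lieStabilizer h2 h3 hι he R g

theorem splitStructure_inner (h0 : e ≠ 0) (h1 : e ≠ dec.one ι) :
    IsInnerSL2SL2 (dec.splitStructure h2 h3 hι he) (dec.splitLie h2 h3 hι he) :=
  ⟨dec.splitMap_injective h2 h3 hι he h0 h1, fun X l =>
    ((dec.splitStructure h2 h3 hι he).differential_eq (dec.splitRep_act h2 h3 hι he
      (g := (epsPoint X.1, epsPoint X.2)) (isOneAdd_epsPoint X.1) (isOneAdd_epsPoint X.2) l)).symm⟩

theorem splitStructure_diag : (dec.splitStructure h2 h3 hι he).diag = Ψ := by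
  apply GStructure.ext_toGroupRep
  apply GroupRep.ext_one_tmul
  intro R _ _ g l
  change (dec.splitRep h2 h3 hι he).diag.act R g _ = _
  have key : ∀ {M : Type u} [AddCommGroup M] [Module F M] {σ : GroupRep (SL2 F) M} {φ : M →ₗ[F] L},
      Equivariant σ (dec.splitRep h2 h3 hι he).diag φ → Equivariant σ Ψ.toGroupRep φ → ∀ m,
      (dec.splitRep h2 h3 hι he).diag.act R g (1 ⊗ₜ φ m) = Ψ.act R g (1 ⊗ₜ φ m) := by
    intro M _ _ σ φ h h' m
    rw [h.one_tmul, h'.one_tmul]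
  have key0 : ∀ {l : L}, l ∈ (dec.splitRep h2 h3 hι he).diag.fixed → l ∈ Ψ.fixed →
      (dec.splitRep h2 h3 hι he).diag.act R g (1 ⊗ₜ l) = Ψ.act R g (1 ⊗ₜ l) := by
    intro l h h'
    rw [h R g, h' R g]
  induction l using dec.peirce_induction h2 h3 hι he with
  | hadd l l' h h' => simp only [TensorProduct.tmul_add, map_add, h, h']
  | hadj₁ f a ha =>
    exact key (dec.splitRep_adj₁ h2 h3 hι he ha).diag (dec.adj_flip_equivariant a) f
  | hadj₀ f a ha =>
    exact key (dec.splitRep_adj₀ h2 h3 hι he ha).diag (dec.adj_flip_equivariant a) f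
  | hnat₁ u x hx =>
    exact key (dec.splitRep_nat₁ h2 h3 hι he hx).diag (dec.nat_flip_equivariant x) u
  | hnat₀ u x hx =>
    exact key (dec.splitRep_nat₀ h2 h3 hι he hx).diag (dec.nat_flip_equivariant x) u
  | htriv d hd =>
    exact key0 (fun R _ _ g => dec.splitRep_annD h2 h3 hι he hd R (g, g)) (dec.triv_fixed d)
  | hsq z a ha =>
    -- On a copy of `V₁ ⊗ V₀` the two actions are compared separately on the image of `sqAdj`, which
    -- lies in `𝔰𝔩(V) ⊗ a`, and on that of `sqInv`, which lies in `D`.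
    have hs := (dec.splitRep_sqMap h2 h3 hι he ha).diag
    have hA : dec.sqMap e a ∘ₗ sqAdj F = dec.adj.flip ((2 : F) • a) :=
      LinearMap.ext fun f => by
        rw [LinearMap.comp_apply, sqMap_sqAdj, LinearMap.flip_apply, map_smul]
    have h₁ : ∀ f, (dec.splitRep h2 h3 hι he).diag.act R g (1 ⊗ₜ dec.sqMap e a (sqAdj F f)) =
        Ψ.act R g (1 ⊗ₜ dec.sqMap e a (sqAdj F f)) :=
      key (φ := dec.sqMap e a ∘ₗ sqAdj F) (hs.comp sqAdj_equivariant)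
        (hA ▸ dec.adj_flip_equivariant _)
    have h₂ : (dec.splitRep h2 h3 hι he).diag.act R g (1 ⊗ₜ dec.sqMap e a (sqInv F)) =
        Ψ.act R g (1 ⊗ₜ dec.sqMap e a (sqInv F)) := by
      refine key0 (hs.map_mem_fixed sqInv_mem_fixed) ?_
      rw [sqMap_sqInv]
      exact Submodule.smul_mem _ _ (dec.triv_fixed _)
    obtain ⟨⟨f, c⟩, rfl⟩ := (sqEquiv h2).surjective z
    have hz : sqEquiv h2 (f, c) = sqAdj F f + c • sqInv F := rfl
    have hc : ∀ m : L, (1 : R) ⊗ₜ[F] (c • m) = algebraMap F R c • (1 ⊗ₜ[F] m) := fun m => by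
      rw [algebraMap_smul, TensorProduct.tmul_smul]
    rw [hz, map_add, map_smul, TensorProduct.tmul_add, map_add, map_add, h₁, hc, map_smul, h₂,
      map_smul]

/-- The decomposition of `L` for the `(SL₂ × SL₂)`-structure defined by an idempotent. -/
def splitDecomposition : ShortDecomposition₂ (dec.splitStructure h2 h3 hι he) (dec.peirceJ e 1)
    (dec.peirceJ e 0) (dec.peirceJ e 2⁻¹) (dec.peirceT e 1) (dec.peirceT e 0) (dec.annD e) where
  equiv := dec.peirceEquiv h2 h3 hι he
  adj₁_equivariant a :=
    (dec.splitRep_adj₁ h2 h3 hι he a.2).of_eq fun f => dec.peirceEquiv_adj₁ h2 h3 hι he f a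
  adj₀_equivariant a :=
    (dec.splitRep_adj₀ h2 h3 hι he a.2).of_eq fun f => dec.peirceEquiv_adj₀ h2 h3 hι he f a
  nat₁₀_equivariant a :=
    (dec.splitRep_sqMap h2 h3 hι he a.2).of_eq fun f => dec.peirceEquiv_sq h2 h3 hι he f a
  nat₁_equivariant a :=
    (dec.splitRep_nat₁ h2 h3 hι he a.2).of_eq fun f => dec.peirceEquiv_nat₁ h2 h3 hι he f a
  nat₀_equivariant a :=
    (dec.splitRep_nat₀ h2 h3 hι he a.2).of_eq fun f => dec.peirceEquiv_nat₀ h2 h3 hι he f a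
  triv_fixed s := by
    rw [dec.peirceEquiv_annD]
    exact dec.splitRep_annD h2 h3 hι he s.2

end ShortDecomposition

/-- Replacing the multiplicity spaces of a decomposition by isomorphic ones. -/
def ShortDecomposition₂.congr {F : Type u} [Field F] {L : Type v} [LieRing L] [LieAlgebra F L]
    {Φ : GStructure (SL2SL2 F) L} {J₁ J₀ Jh T₁ T₀ S J₁' J₀' Jh' T₁' T₀' S' : Type*}
    [AddCommGroup J₁] [Module F J₁] [AddCommGroup J₀] [Module F J₀]
    [AddCommGroup Jh] [Module F Jh] [AddCommGroup T₁] [Module F T₁]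
    [AddCommGroup T₀] [Module F T₀] [AddCommGroup S] [Module F S]
    [AddCommGroup J₁'] [Module F J₁'] [AddCommGroup J₀'] [Module F J₀']
    [AddCommGroup Jh'] [Module F Jh'] [AddCommGroup T₁'] [Module F T₁']
    [AddCommGroup T₀'] [Module F T₀'] [AddCommGroup S'] [Module F S']
    (dec : ShortDecomposition₂ Φ J₁ J₀ Jh T₁ T₀ S) (e₁ : J₁' ≃ₗ[F] J₁) (e₀ : J₀' ≃ₗ[F] J₀)
    (eh : Jh' ≃ₗ[F] Jh) (f₁ : T₁' ≃ₗ[F] T₁) (f₀ : T₀' ≃ₗ[F] T₀) (s : S' ≃ₗ[F] S) :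
    ShortDecomposition₂ Φ J₁' J₀' Jh' T₁' T₀' S' where
  equiv := (LinearEquiv.prodCongr (TensorProduct.congr (LinearEquiv.refl F _) e₁)
    (LinearEquiv.prodCongr (TensorProduct.congr (LinearEquiv.refl F _) e₀)
    (LinearEquiv.prodCongr (TensorProduct.congr (LinearEquiv.refl F _) eh)
    (LinearEquiv.prodCongr (TensorProduct.congr (LinearEquiv.refl F _) f₁)
    (LinearEquiv.prodCongr (TensorProduct.congr (LinearEquiv.refl F _) f₀) s))))) ≪≫ₗ dec.equiv
  adj₁_equivariant a :=
    (dec.adj₁_equivariant (e₁ a)).of_eq fun f => by simp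
  adj₀_equivariant a :=
    (dec.adj₀_equivariant (e₀ a)).of_eq fun f => by simp
  nat₁₀_equivariant a :=
    (dec.nat₁₀_equivariant (eh a)).of_eq fun f => by simp
  nat₁_equivariant a :=
    (dec.nat₁_equivariant (f₁ a)).of_eq fun f => by simp
  nat₀_equivariant a :=
    (dec.nat₀_equivariant (f₀ a)).of_eq fun f => by simp
  triv_fixed d := by
    convert dec.triv_fixed (s d) using 1
    simp

namespace ShortDecomposition

variable {F : Type u} [Field F] {L : Type v} [LieRing L] [LieAlgebra F L]
variable {Ψ : GStructure (SL2 F) L} {J T D : Type*}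
  [AddCommGroup J] [Module F J] [AddCommGroup T] [Module F T] [AddCommGroup D] [Module F D]
  (dec : ShortDecomposition Ψ J T D) {ι : sl2 F →ₗ⁅F⁆ L}
  (h2 : (2 : F) ≠ 0) (h3 : (3 : F) ≠ 0) (hι : IsInnerSL2 Ψ ι) {e : J} (he : dec.mul e e = e)

/-- Shortness requires multiplicity spaces in the universe of `L`, whereas `J`, `T` and `D` live in
arbitrary universes. They are replaced by their images in `L` under `E ⊗ ·`, `e₀ ⊗ ·` and the
inclusion of `D`. -/
theorem splitStructure_short : IsShortSL2SL2 (dec.splitStructure h2 h3 hι he) := by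
  have hJ := dec.adj_injective (elE_ne_zero (F := F))
  have hT := dec.nat_injective (vec0_ne_zero (F := F))
  have hD := dec.triv_injective
  refine ⟨_, _, _, _, _, _, _, _, _, _, _, _, _, _, _, _, _, _,
    ⟨(dec.splitDecomposition h2 h3 hι he).congr
      (LinearEquiv.ofInjective (dec.adj (sl2.elE F) ∘ₗ (dec.peirceJ e 1).subtype) ?_).symm
      (LinearEquiv.ofInjective (dec.adj (sl2.elE F) ∘ₗ (dec.peirceJ e 0).subtype) ?_).symm
      (LinearEquiv.ofInjective (dec.adj (sl2.elE F) ∘ₗ (dec.peirceJ e 2⁻¹).subtype) ?_).symm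
      (LinearEquiv.ofInjective (dec.nat (vec0 F) ∘ₗ (dec.peirceT e 1).subtype) ?_).symm
      (LinearEquiv.ofInjective (dec.nat (vec0 F) ∘ₗ (dec.peirceT e 0).subtype) ?_).symm
      (LinearEquiv.ofInjective (dec.triv ∘ₗ (dec.annD e).subtype) ?_).symm⟩⟩
  · exact hJ.comp Subtype.val_injective
  · exact hJ.comp Subtype.val_injective
  · exact hJ.comp Subtype.val_injective
  · exact hT.comp Subtype.val_injective
  · exact hT.comp Subtype.val_injective
  · exact hD.comp Subtype.val_injective

end ShortDecomposition

/-- The first factor alone mixes the adjoint and trivial parts of `V ⊗ V`. This value and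
`natL₂_H_sqAdj_H` tie the two parts of an equivariant map together in `exists_eq_sqMap`. -/
theorem natL₂_E_sqInv {F : Type u} [Field F] :
    natL₂ (sl2.elE F, 0) (sqInv F) = -sqAdj F (sl2.elE F) := by
  have h0 : ∀ u, (0 : sl2 F).natL u = 0 := fun u => by simp
  have e : sqAdj F (sl2.elE F) = vec0 F ⊗ₜ vec0 F := by
    simp [sqAdj_apply, sl2.elE]
  rw [e]
  simp only [sqInv, map_sub, natL₂_tmul, natL_E_vec0, natL_E_vec1, h0, TensorProduct.tmul_zero,
    TensorProduct.zero_tmul, add_zero, zero_sub]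

theorem natL₂_H_sqAdj_H {F : Type u} [Field F] :
    natL₂ (sl2.elH F, 0) (sqAdj F (sl2.elH F)) = -sqInv F := by
  have h0 : ∀ u, (0 : sl2 F).natL u = 0 := fun u => by simp
  have e : sqAdj F (sl2.elH F) = -(vec0 F ⊗ₜ vec1 F + vec1 F ⊗ₜ vec0 F) := by
    simp [sqAdj_apply, sl2.elH]
  rw [e]
  simp only [sqInv, map_neg, map_add, natL₂_tmul, natL_H_vec0, natL_H_vec1, h0,
    TensorProduct.tmul_zero, add_zero, TensorProduct.neg_tmul, neg_smul, one_smul, sub_eq_add_neg]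

namespace ShortDecomposition

variable {F : Type u} [Field F] {L : Type v} [LieRing L] [LieAlgebra F L]
variable {Ψ : GStructure (SL2 F) L} {J T D : Type*}
  [AddCommGroup J] [Module F J] [AddCommGroup T] [Module F T] [AddCommGroup D] [Module F D]
  (dec : ShortDecomposition Ψ J T D) {ι : sl2 F →ₗ⁅F⁆ L}

/-! ### Coordinates of the summands -/

theorem eq_zero_of_coords {l : L} (hJ : ∀ i j, dec.coordJ i j l = 0) (hT : ∀ i, dec.coordT i l = 0)
    (hD : dec.projD l = 0) : l = 0 := by
  rw [dec.eq_coords l]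
  simp [hJ, hT, hD]

theorem coords_of_mem_adjSub {A : Submodule F J} {l : L} (hl : l ∈ dec.adjSub A) :
    (∀ i j, dec.coordJ i j l ∈ A) ∧ (∀ i, dec.coordT i l = 0) ∧ dec.projD l = 0 := by
  refine ⟨fun i j => ?_, fun i => ?_, ?_⟩
  · have h : dec.adjSub A ≤ A.comap (dec.coordJ i j) := Submodule.map₂_le.mpr fun f _ a ha => by
      rw [Submodule.mem_comap, coordJ_adj]
      exact A.smul_mem _ ha
    exact h hl
  · have h : dec.adjSub A ≤ LinearMap.ker (dec.coordT i) := Submodule.map₂_le.mpr fun f _ a ha => by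
      simp
    exact h hl
  · have h : dec.adjSub A ≤ LinearMap.ker dec.projD := Submodule.map₂_le.mpr fun f _ a ha => by
      simp
    exact h hl

theorem coords_of_mem_natSub {A : Submodule F T} {l : L} (hl : l ∈ dec.natSub A) :
    (∀ i j, dec.coordJ i j l = 0) ∧ (∀ i, dec.coordT i l ∈ A) ∧ dec.projD l = 0 := by
  refine ⟨fun i j => ?_, fun i => ?_, ?_⟩
  · have h : dec.natSub A ≤ LinearMap.ker (dec.coordJ i j) :=
      Submodule.map₂_le.mpr fun f _ a ha => by simp
    exact h hl
  · have h : dec.natSub A ≤ A.comap (dec.coordT i) := Submodule.map₂_le.mpr fun f _ a ha => by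
      rw [Submodule.mem_comap, coordT_nat]
      exact A.smul_mem _ ha
    exact h hl
  · have h : dec.natSub A ≤ LinearMap.ker dec.projD := Submodule.map₂_le.mpr fun f _ a ha => by
      simp
    exact h hl

theorem adj_mem_adjSub {A : Submodule F J} (f : sl2 F) {a : J} (ha : a ∈ A) :
    dec.adj f a ∈ dec.adjSub A := Submodule.apply_mem_map₂ _ Submodule.mem_top ha

theorem nat_mem_natSub {A : Submodule F T} (u : nat2 F) {x : T} (hx : x ∈ A) :
    dec.nat u x ∈ dec.natSub A := Submodule.apply_mem_map₂ _ Submodule.mem_top hx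

theorem adj_flip_injective {a : J} (ha : a ≠ 0) : Function.Injective (dec.adj.flip a) := by
  rw [injective_iff_map_eq_zero]
  intro f hf
  apply sl2.ext
  ext i j
  have := congrArg (dec.coordJ i j) hf
  rw [LinearMap.flip_apply, coordJ_adj, map_zero] at this
  exact (smul_eq_zero.mp this).resolve_right ha

theorem nat_flip_injective {x : T} (hx : x ≠ 0) : Function.Injective (dec.nat.flip x) := by
  rw [injective_iff_map_eq_zero]
  intro u hu
  ext i
  have := congrArg (dec.coordT i) hu
  rw [LinearMap.flip_apply, coordT_nat, map_zero] at this
  exact (smul_eq_zero.mp this).resolve_right hx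

theorem disjoint_adjSub_derSub (e : J) (A B : Submodule F J) :
    Disjoint (dec.adjSub A) (dec.derSub e B) := by
  rw [Submodule.disjoint_def]
  rintro _ hl ⟨a, -, rfl⟩
  obtain ⟨-, -, h⟩ := dec.coords_of_mem_adjSub hl
  rw [LinearMap.comp_apply, projD_triv] at h
  rw [LinearMap.comp_apply, h, map_zero]

variable (h2 : (2 : F) ≠ 0) (h3 : (3 : F) ≠ 0) (hι : IsInnerSL2 Ψ ι) {e : J}
  (he : dec.mul e e = e)

include h2 hι

/-- A fixed vector is killed by `ι(𝔰𝔩₂)`, so it has weight zero and equals `H ⊗ a + d`; applying `E`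
gives `-2 E ⊗ a = 0`. -/
theorem range_triv : LinearMap.range dec.triv = Ψ.fixed := by
  apply le_antisymm
  · rintro _ ⟨d, rfl⟩
    exact dec.triv_fixed d
  · intro l hl
    have hX : ∀ X, ⁅ι X, l⁆ = 0 := fun X => by rw [hι.2, Ψ.differential_fixed hl]
    have h := dec.eq_of_weight_zero h2 hι (hX _)
    have hE := hX (sl2.elE F)
    rw [h, lie_add, dec.lie_adj h2 hι, dec.lie_triv hι, sl2.lie_E_H, map_smul,
      LinearMap.smul_apply, add_zero, ← map_smul] at hE
    have h0 := (smul_eq_zero.mp (dec.adj_injective elE_ne_zero (hE.trans (map_zero _).symm)))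
    rw [h0.resolve_left (neg_ne_zero.mpr h2), map_zero, zero_add] at h
    exact ⟨_, h.symm⟩

include h3 in
/-- Homomorphisms of `𝔰𝔩₂`-modules from the natural module to `L`. -/
theorem eq_nat_of_lie_hom (κ : nat2 F →ₗ[F] L) (hκ : ∀ X u, ⁅ι X, κ u⁆ = κ (sl2.natL X u))
    (u : nat2 F) : κ u = dec.nat u (dec.coordT 0 (κ (vec0 F))) := by
  have h₀ := dec.eq_of_weight_one h2 h3 hι (l := κ (vec0 F)) (by rw [hκ, natL_H_vec0])
  have h₁ := hκ (sl2.elF F) (vec0 F)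
  rw [h₀, dec.lie_nat hι, natL_F_vec0] at h₁
  generalize dec.coordT 0 (κ (vec0 F)) = x at h₀ h₁ ⊢
  rw [dec.nat_eq_combination u]
  conv_lhs => rw [nat2_eq_combination u, map_add, map_smul, map_smul, ← h₁, h₀]

omit hι

theorem mem_range_sqMap (a : J) (f : sl2 F) : dec.adj f a ∈ LinearMap.range (dec.sqMap e a) :=
  ⟨(2⁻¹ : F) • sqAdj F f, by rw [map_smul, sqMap_sqAdj, smul_smul, inv_mul_cancel₀ h2, one_smul]⟩

theorem triv_mem_range_sqMap (a : J) :
    dec.triv (dec.dJ e a) ∈ LinearMap.range (dec.sqMap e a) := by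
  have e8 : (-8 : F) ≠ 0 := by
    rw [show (-8 : F) = -(2 * 2 * 2) by norm_num]
    exact neg_ne_zero.mpr (mul_ne_zero (mul_ne_zero h2 h2) h2)
  exact ⟨(-8 : F)⁻¹ • sqInv F, by
    rw [map_smul, sqMap_sqInv, smul_smul, inv_mul_cancel₀ e8, one_smul]⟩

theorem range_sqMap (a : J) : LinearMap.range (dec.sqMap e a) =
    dec.adjSub (Submodule.span F {a}) ⊔ Submodule.span F {dec.triv (dec.dJ e a)} := by
  apply le_antisymm
  · rintro _ ⟨z, rfl⟩
    rw [sqMap_apply]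
    exact sub_mem (Submodule.mem_sup_left
      (dec.adj_mem_adjSub _ (Submodule.mem_span_singleton_self a)))
      (Submodule.smul_mem _ _ (Submodule.smul_mem _ _ (Submodule.mem_sup_right
        (Submodule.mem_span_singleton_self _))))
  · refine sup_le ?_ ?_
    · rw [adjSub_span]
      rintro _ ⟨f, rfl⟩
      exact dec.mem_range_sqMap h2 a f
    · rw [Submodule.span_singleton_le_iff_mem]
      exact dec.triv_mem_range_sqMap h2 a

include hι he

theorem sqMap_injective {a : J} (ha : a ∈ dec.peirceJ e 2⁻¹) (h0 : a ≠ 0) :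
    Function.Injective (dec.sqMap e a) := by
  have h4 : (4 : F) ≠ 0 := by
    rw [show (4 : F) = 2 * 2 by norm_num]; exact mul_ne_zero h2 h2
  rw [injective_iff_map_eq_zero]
  intro z hz
  rw [sqMap_apply] at hz
  have hf : sqGam F z = 0 := by
    apply sl2.ext
    ext i j
    have := congrArg (dec.coordJ i j) hz
    simp only [map_sub, coordJ_adj, map_smul, coordJ_triv, smul_zero, sub_zero, map_zero] at this
    exact (smul_eq_zero.mp this).resolve_right h0
  have hc : sqForm F z = 0 := by
    have := congrArg dec.projD hz
    simp only [map_sub, projD_adj, map_smul, projD_triv, zero_sub, map_zero, neg_eq_zero] at this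
    exact (smul_eq_zero.mp ((smul_eq_zero.mp this).resolve_left h4)).resolve_right
      fun h => h0 (dec.eq_zero_of_dJ_eq_zero h2 hι he ha h)
  have := sqAdj_sqGam z
  rw [hf, hc, map_zero, zero_smul, add_zero] at this
  exact (smul_eq_zero.mp this.symm).resolve_left h2

end ShortDecomposition

/-! ### The isotypic components -/

namespace ShortDecomposition

variable {F : Type u} [Field F] {L : Type v} [LieRing L] [LieAlgebra F L]
variable {Ψ : GStructure (SL2 F) L} {J T D : Type*}
  [AddCommGroup J] [Module F J] [AddCommGroup T] [Module F T] [AddCommGroup D] [Module F D]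
  (dec : ShortDecomposition Ψ J T D) {ι : sl2 F →ₗ⁅F⁆ L}
  (h2 : (2 : F) ≠ 0) (h3 : (3 : F) ≠ 0) (hι : IsInnerSL2 Ψ ι) {e : J} (he : dec.mul e e = e)

theorem splitMap_diag (X : sl2 F) : dec.splitMap ι e (X, X) = dec.adj X (dec.one ι) := by
  rw [splitMap_apply, map_sub]
  abel

theorem splitStructure_differential (X : sl2 F × sl2 F) (l : L) :
    (dec.splitStructure h2 h3 hι he).differential (epsPoint X.1, epsPoint X.2) l =
      ⁅dec.splitMap ι e X, l⁆ :=
  (dec.splitStructure h2 h3 hι he).differential_eq (dec.splitRep_act h2 h3 hι he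
    (g := (epsPoint X.1, epsPoint X.2)) (isOneAdd_epsPoint X.1) (isOneAdd_epsPoint X.2) l)

/-- A vector fixed by both factors is fixed by the diagonal, hence lies in `D`. The bracket with
`(0, E)` is `E ⊗ d(e)`, which must vanish. -/
theorem splitStructure_fixed :
    (dec.splitStructure h2 h3 hι he).fixed = (dec.annD e).map dec.triv := by
  apply le_antisymm
  · intro l hl
    have hl' : l ∈ Ψ.fixed := by
      rw [← dec.splitStructure_diag h2 h3 hι he]
      exact fun R _ _ g => hl R (g, g)
    rw [← dec.range_triv h2 hι] at hl'
    obtain ⟨d, rfl⟩ := hl'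
    refine ⟨d, ?_, rfl⟩
    have h := dec.splitStructure_differential h2 h3 hι he (0, sl2.elE F) (dec.triv d)
    rw [GStructure.differential_fixed _ hl, dec.lie_splitMap_triv h2 h3 hι, sub_zero] at h
    exact dec.adj_injective elE_ne_zero (h.symm.trans (map_zero _).symm)
  · rintro _ ⟨d, hd, rfl⟩
    exact dec.splitRep_annD h2 h3 hι he hd

theorem fixed_sup_derSub : (dec.splitStructure h2 h3 hι he).fixed ⊔
    dec.derSub e (dec.peirceJ e 2⁻¹) = Ψ.fixed := by
  rw [dec.splitStructure_fixed, ← dec.range_triv h2 hι]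
  apply le_antisymm
  · refine sup_le LinearMap.map_le_range ?_
    rintro _ ⟨a, -, rfl⟩
    exact ⟨_, rfl⟩
  · rintro _ ⟨d, rfl⟩
    have hd : d = (d + (4 : F) • dec.dJ e (dec.actJ d e)) +
        dec.dJ e ((-4 : F) • dec.actJ d e) := by
      rw [map_smul]; module
    rw [hd, map_add]
    exact add_mem
      (Submodule.mem_sup_left ⟨_, dec.dJ_actJ_idempotent_mem h2 hι he d, rfl⟩)
      (Submodule.mem_sup_right
        ⟨_, Submodule.smul_mem _ _ (dec.actJ_idempotent h2 hι he d), rfl⟩)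

theorem disjoint_fixed_derSub : Disjoint (dec.splitStructure h2 h3 hι he).fixed
    (dec.derSub e (dec.peirceJ e 2⁻¹)) := by
  rw [dec.splitStructure_fixed, Submodule.disjoint_def]
  rintro _ ⟨d, hd, rfl⟩ ⟨a, ha, h⟩
  obtain rfl : dec.dJ e a = d := dec.triv_injective h
  rw [dec.eq_zero_of_dJ_mem_annD h2 hι he ha hd, map_zero, map_zero]

theorem lie_splitMap_of_equivariant {M : Type w} [AddCommGroup M] [Module F M]
    {σ : GroupRep (SL2SL2 F) M} {φ : M →ₗ[F] L}
    (h : Equivariant σ (dec.splitRep h2 h3 hι he) φ) {X : sl2 F × sl2 F} {d : M →ₗ[F] M}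
    (hd : ExpAct σ (DualNumber F) (epsPoint X.1, epsPoint X.2) DualNumber.eps d) (m : M) :
    ⁅dec.splitMap ι e X, φ m⁆ = φ (d m) := by
  rw [← dec.splitStructure_differential h2 h3 hι he]
  exact (dec.splitStructure h2 h3 hι he).differential_apply h hd m

/-- The diagonal forces the shape `f ↦ f ⊗ a`. Then `(H, 0)` multiplies `E ⊗ a` by 2 in `adjRep₁`,
while its bracket has `E`-coordinate `2 e · a`; so `e · a = a`. The other adjoint and natural cases
differ only in the eigenvalue. -/
theorem exists_eq_adj_one {φ : sl2 F →ₗ[F] L}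
    (h : Equivariant (adjRep₁ F) (dec.splitRep h2 h3 hι he) φ) :
    ∃ a ∈ dec.peirceJ e 1, ∀ f, φ f = dec.adj f a := by
  have hX : ∀ X f, ⁅dec.splitMap ι e X, φ f⁆ = φ ⁅X.1, f⁆ := fun X f =>
    dec.lie_splitMap_of_equivariant h2 h3 hι he h (expAct_adj h2 (isOneAdd_epsPoint X.1)) f
  obtain ⟨a, ha⟩ : ∃ a, ∀ f, φ f = dec.adj f a :=
    ⟨_, dec.eq_adj_of_lie_hom h2 h3 hι φ fun X f => by
      rw [dec.inner_eq h2 h3 hι, ← dec.splitMap_diag (e := e), hX]⟩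
  refine ⟨a, ?_, ha⟩
  have hE : (sl2.elE F).val 0 1 = 1 := by simp [sl2.elE]
  have hH := congrArg (dec.coordJ 0 1) (hX (sl2.elH F, 0) (sl2.elE F))
  rw [ha, ha, dec.lie_splitMap_adj h2 h3 hι] at hH
  simp only [sl2.lie_H_E, zero_lie, map_add, map_smul, LinearMap.smul_apply, coordJ_adj,
    coordJ_triv, map_zero, LinearMap.zero_apply, smul_zero, add_zero, hE, one_smul] at hH
  rw [mem_peirceJ, one_smul]
  exact smul_right_injective J h2 (hH)

theorem exists_eq_adj_zero {φ : sl2 F →ₗ[F] L}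
    (h : Equivariant (adjRep₀ F) (dec.splitRep h2 h3 hι he) φ) :
    ∃ a ∈ dec.peirceJ e 0, ∀ f, φ f = dec.adj f a := by
  have hX : ∀ X f, ⁅dec.splitMap ι e X, φ f⁆ = φ ⁅X.2, f⁆ := fun X f =>
    dec.lie_splitMap_of_equivariant h2 h3 hι he h (expAct_adj h2 (isOneAdd_epsPoint X.2)) f
  obtain ⟨a, ha⟩ : ∃ a, ∀ f, φ f = dec.adj f a :=
    ⟨_, dec.eq_adj_of_lie_hom h2 h3 hι φ fun X f => by
      rw [dec.inner_eq h2 h3 hι, ← dec.splitMap_diag (e := e), hX]⟩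
  refine ⟨a, ?_, ha⟩
  have hE : (sl2.elE F).val 0 1 = 1 := by simp [sl2.elE]
  have hH := congrArg (dec.coordJ 0 1) (hX (sl2.elH F, 0) (sl2.elE F))
  rw [ha, ha, dec.lie_splitMap_adj h2 h3 hι] at hH
  simp only [sl2.lie_H_E, zero_lie, map_add, map_smul, LinearMap.smul_apply, coordJ_adj,
    coordJ_triv, map_zero, LinearMap.zero_apply, smul_zero, add_zero, hE, one_smul] at hH
  rw [mem_peirceJ, zero_smul]
  exact smul_right_injective J h2 (hH.trans (smul_zero _).symm)

theorem exists_eq_nat_one {φ : nat2 F →ₗ[F] L}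
    (h : Equivariant (natRep₁ F) (dec.splitRep h2 h3 hι he) φ) :
    ∃ x ∈ dec.peirceT e 1, ∀ u, φ u = dec.nat u x := by
  have hX : ∀ X u, ⁅dec.splitMap ι e X, φ u⁆ = φ (sl2.natL X.1 u) := fun X u =>
    dec.lie_splitMap_of_equivariant h2 h3 hι he h (expAct_nat (isOneAdd_epsPoint X.1)) u
  have hx := dec.eq_nat_of_lie_hom h2 h3 hι φ fun X u => by
    rw [dec.inner_eq h2 h3 hι, ← dec.splitMap_diag (e := e), hX]
  refine ⟨_, ?_, hx⟩
  have hH := congrArg (dec.coordT 0) (hX (sl2.elH F, 0) (vec0 F))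
  rw [hx, dec.lie_splitMap_nat h2 h3 hι, natL_H_vec0, hx] at hH
  simp at hH
  rw [mem_peirceT, one_smul]
  exact hH

theorem exists_eq_nat_zero {φ : nat2 F →ₗ[F] L}
    (h : Equivariant (natRep₀ F) (dec.splitRep h2 h3 hι he) φ) :
    ∃ x ∈ dec.peirceT e 0, ∀ u, φ u = dec.nat u x := by
  have hX : ∀ X u, ⁅dec.splitMap ι e X, φ u⁆ = φ (sl2.natL X.2 u) := fun X u =>
    dec.lie_splitMap_of_equivariant h2 h3 hι he h (expAct_nat (isOneAdd_epsPoint X.2)) u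
  have hx := dec.eq_nat_of_lie_hom h2 h3 hι φ fun X u => by
    rw [dec.inner_eq h2 h3 hι, ← dec.splitMap_diag (e := e), hX]
  refine ⟨_, ?_, hx⟩
  have hH := congrArg (dec.coordT 0) (hX (sl2.elH F, 0) (vec0 F))
  rw [hx, dec.lie_splitMap_nat h2 h3 hι, natL_H_vec0] at hH
  simp at hH
  rw [mem_peirceT, zero_smul]
  exact hH

/-- On the diagonal, `φ ∘ sqAdj` is `f ↦ f ⊗ b` and `φ(sqInv)` is some `d ∈ D`. Acting by `(E, 0)`
on the invariant gives `d(e) = b`, so `b ∈ J_{1/2}`; acting by `(H, 0)` on `sqAdj H` gives `d = -4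
D_{e,b}`. These are the values of `sqMap` at `b / 2`. -/
theorem exists_eq_sqMap {φ : nat2 F ⊗[F] nat2 F →ₗ[F] L}
    (h : Equivariant (natRep₁₀ F) (dec.splitRep h2 h3 hι he) φ) :
    ∃ a ∈ dec.peirceJ e 2⁻¹, ∀ z, φ z = dec.sqMap e a z := by
  have hX : ∀ X z, ⁅dec.splitMap ι e X, φ z⁆ = φ (natL₂ X z) := fun X z =>
    dec.lie_splitMap_of_equivariant h2 h3 hι he h
      (expAct_nat₁₀ h2 (isOneAdd_epsPoint X.1) (isOneAdd_epsPoint X.2)) z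
  have hΨ : (dec.splitRep h2 h3 hι he).diag = Ψ.toGroupRep :=
    congrArg GStructure.toGroupRep (dec.splitStructure_diag h2 h3 hι he)
  have hA : Equivariant (adjRep F) Ψ.toGroupRep (φ ∘ₗ sqAdj F) := by
    rw [← hΨ]
    exact h.diag.comp sqAdj_equivariant
  have hI : φ (sqInv F) ∈ Ψ.fixed := by
    rw [← hΨ]
    exact h.diag.map_mem_fixed sqInv_mem_fixed
  rw [← dec.range_triv h2 hι] at hI
  obtain ⟨d, hd⟩ := hI
  obtain ⟨b, hb⟩ : ∃ b, ∀ f, φ (sqAdj F f) = dec.adj f b :=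
    ⟨_, dec.eq_adj_of_lie_hom h2 h3 hι (φ ∘ₗ sqAdj F) fun X f => by
      rw [hι.2]
      exact Ψ.differential_apply hA (expAct_adj h2 (isOneAdd_epsPoint X)) f⟩
  have hb' : dec.actJ d e = b := by
    have := hX (sl2.elE F, 0) (sqInv F)
    rw [natL₂_E_sqInv, map_neg, hb, ← hd, dec.lie_splitMap_triv h2 h3 hι] at this
    have := congrArg (dec.coordJ 0 1) this
    simpa [sl2.elE] using this
  have hbm : b ∈ dec.peirceJ e 2⁻¹ := hb' ▸ dec.actJ_idempotent h2 hι he d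
  have hd' : dec.triv d = (-4 : F) • dec.triv (dec.dJ e b) := by
    have := hX (sl2.elH F, 0) (sqAdj F (sl2.elH F))
    rw [natL₂_H_sqAdj_H, map_neg, hb, ← hd, dec.lie_splitMap_adj h2 h3 hι] at this
    have e4 : (2 * (((sl2.elH F).val * (sl2.elH F).val).trace - ((0 : sl2 F).val *
        (sl2.elH F).val).trace) : F) = 4 := by
      simp [sl2.elH, Matrix.trace_fin_two]
      norm_num
    dsimp only at this
    rw [e4] at this
    simp only [lie_self, zero_lie, map_zero, LinearMap.zero_apply, zero_add] at this
    linear_combination (norm := module) this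
  refine ⟨(2⁻¹ : F) • b, Submodule.smul_mem _ _ hbm, fun z => ?_⟩
  apply smul_right_injective L h2
  simp only [← map_smul]
  rw [← sqAdj_sqGam z, map_add, map_add, map_smul, map_smul, hb, sqMap_sqAdj, sqMap_sqInv, ← hd,
    hd', map_smul, map_smul, map_smul]
  match_scalars
  · field_simp
  · field_simp
    ring

theorem adjSub_one_eq_isotypic : dec.adjSub (dec.peirceJ e 1) =
    isotypic (adjRep₁ F) (dec.splitRep h2 h3 hι he) := by
  refine le_antisymm (Submodule.map₂_le.mpr fun f _ a ha => ?_) (iSup_le ?_)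
  · exact Submodule.mem_iSup_of_mem ⟨_, dec.splitRep_adj₁ h2 h3 hι he ha⟩ ⟨f, rfl⟩
  · rintro ⟨φ, hφ⟩ _ ⟨f, rfl⟩
    obtain ⟨a, ha, h⟩ := dec.exists_eq_adj_one h2 h3 hι he hφ
    rw [h]
    exact dec.adj_mem_adjSub f ha

theorem adjSub_zero_eq_isotypic : dec.adjSub (dec.peirceJ e 0) =
    isotypic (adjRep₀ F) (dec.splitRep h2 h3 hι he) := by
  refine le_antisymm (Submodule.map₂_le.mpr fun f _ a ha => ?_) (iSup_le ?_)
  · exact Submodule.mem_iSup_of_mem ⟨_, dec.splitRep_adj₀ h2 h3 hι he ha⟩ ⟨f, rfl⟩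
  · rintro ⟨φ, hφ⟩ _ ⟨f, rfl⟩
    obtain ⟨a, ha, h⟩ := dec.exists_eq_adj_zero h2 h3 hι he hφ
    rw [h]
    exact dec.adj_mem_adjSub f ha

theorem natSub_one_eq_isotypic : dec.natSub (dec.peirceT e 1) =
    isotypic (natRep₁ F) (dec.splitRep h2 h3 hι he) := by
  refine le_antisymm (Submodule.map₂_le.mpr fun u _ x hx => ?_) (iSup_le ?_)
  · exact Submodule.mem_iSup_of_mem ⟨_, dec.splitRep_nat₁ h2 h3 hι he hx⟩ ⟨u, rfl⟩
  · rintro ⟨φ, hφ⟩ _ ⟨u, rfl⟩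
    obtain ⟨x, hx, h⟩ := dec.exists_eq_nat_one h2 h3 hι he hφ
    rw [h]
    exact dec.nat_mem_natSub u hx

theorem natSub_zero_eq_isotypic : dec.natSub (dec.peirceT e 0) =
    isotypic (natRep₀ F) (dec.splitRep h2 h3 hι he) := by
  refine le_antisymm (Submodule.map₂_le.mpr fun u _ x hx => ?_) (iSup_le ?_)
  · exact Submodule.mem_iSup_of_mem ⟨_, dec.splitRep_nat₀ h2 h3 hι he hx⟩ ⟨u, rfl⟩
  · rintro ⟨φ, hφ⟩ _ ⟨u, rfl⟩
    obtain ⟨x, hx, h⟩ := dec.exists_eq_nat_zero h2 h3 hι he hφ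
    rw [h]
    exact dec.nat_mem_natSub u hx

theorem sqMap_mem {a : J} (ha : a ∈ dec.peirceJ e 2⁻¹) (z : nat2 F ⊗[F] nat2 F) :
    dec.sqMap e a z ∈ dec.adjSub (dec.peirceJ e 2⁻¹) ⊔ dec.derSub e (dec.peirceJ e 2⁻¹) := by
  rw [sqMap_apply]
  exact sub_mem (Submodule.mem_sup_left (dec.adj_mem_adjSub _ ha))
    (Submodule.smul_mem _ _ (Submodule.smul_mem _ _ (Submodule.mem_sup_right ⟨a, ha, rfl⟩)))

theorem adjSub_half_sup_derSub_eq_isotypic :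
    dec.adjSub (dec.peirceJ e 2⁻¹) ⊔ dec.derSub e (dec.peirceJ e 2⁻¹) =
      isotypic (natRep₁₀ F) (dec.splitRep h2 h3 hι he) := by
  refine le_antisymm (sup_le (Submodule.map₂_le.mpr fun f _ a ha => ?_) ?_) (iSup_le ?_)
  · exact Submodule.mem_iSup_of_mem ⟨_, dec.splitRep_sqMap h2 h3 hι he ha⟩
      (dec.mem_range_sqMap h2 a f)
  · rintro _ ⟨a, ha, rfl⟩
    exact Submodule.mem_iSup_of_mem ⟨_, dec.splitRep_sqMap h2 h3 hι he ha⟩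
      (dec.triv_mem_range_sqMap h2 a)
  · rintro ⟨φ, hφ⟩ _ ⟨z, rfl⟩
    obtain ⟨a, ha, h⟩ := dec.exists_eq_sqMap h2 h3 hι he hφ
    rw [h]
    exact dec.sqMap_mem ha z

/-- Independence is read off coordinatewise: the `J`-coordinates separate by Peirce independence,
the `T`-coordinates by the splitting of `T`, and in the `D`-coordinate `D_{e,J_{1/2}}` meets the
annihilator of `e` trivially. -/
theorem isotypic_isInternal : DirectSum.IsInternal
    ![dec.adjSub (dec.peirceJ e 1), dec.adjSub (dec.peirceJ e 0),
      dec.adjSub (dec.peirceJ e 2⁻¹) ⊔ dec.derSub e (dec.peirceJ e 2⁻¹),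
      dec.natSub (dec.peirceT e 1), dec.natSub (dec.peirceT e 0),
      (dec.splitStructure h2 h3 hι he).fixed] := by
  refine isInternal_of_fin _ (fun l => ?_) (fun v hv hs => ?_)
  · induction l using dec.peirce_induction h2 h3 hι he with
    | hadd l l' h h' => exact add_mem h h'
    | hadj₁ f a ha => exact Submodule.mem_iSup_of_mem (0 : Fin 6) (dec.adj_mem_adjSub f ha)
    | hadj₀ f a ha => exact Submodule.mem_iSup_of_mem (1 : Fin 6) (dec.adj_mem_adjSub f ha)
    | hsq z a ha => exact Submodule.mem_iSup_of_mem (2 : Fin 6) (dec.sqMap_mem ha z)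
    | hnat₁ u x hx => exact Submodule.mem_iSup_of_mem (3 : Fin 6) (dec.nat_mem_natSub u hx)
    | hnat₀ u x hx => exact Submodule.mem_iSup_of_mem (4 : Fin 6) (dec.nat_mem_natSub u hx)
    | htriv d hd =>
      exact Submodule.mem_iSup_of_mem (5 : Fin 6) (dec.splitRep_annD h2 h3 hι he hd)
  · obtain ⟨J0, T0, D0⟩ := dec.coords_of_mem_adjSub (hv 0)
    obtain ⟨J1, T1, D1⟩ := dec.coords_of_mem_adjSub (hv 1)
    obtain ⟨y, hy, _, ⟨a, ha, rfl⟩, hy2⟩ := Submodule.mem_sup.mp (hv 2)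
    obtain ⟨J2, T2, D2⟩ := dec.coords_of_mem_adjSub hy
    obtain ⟨J3, T3, D3⟩ := dec.coords_of_mem_natSub (hv 3)
    obtain ⟨J4, T4, D4⟩ := dec.coords_of_mem_natSub (hv 4)
    have h5 : v 5 ∈ (dec.splitStructure h2 h3 hι he).fixed := hv 5
    rw [dec.splitStructure_fixed] at h5
    obtain ⟨d, hd, hd5⟩ := h5
    simp only [Fin.sum_univ_six, ← hy2, ← hd5] at hs
    have hJ : ∀ i j, dec.coordJ i j (v 0) = 0 ∧ dec.coordJ i j (v 1) = 0 ∧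
        dec.coordJ i j y = 0 := fun i j => by
      refine dec.peirce_independent h2 (J0 i j) (J1 i j) (J2 i j) ?_
      have := congrArg (dec.coordJ i j) hs
      simpa [J3, J4] using this
    have hT : ∀ i, dec.coordT i (v 3) = 0 ∧ dec.coordT i (v 4) = 0 := fun i => by
      have := congrArg (dec.coordT i) hs
      simp only [map_add, T0, T1, T2, LinearMap.comp_apply, coordT_triv, zero_add, add_zero,
        map_zero] at this
      have h3 : dec.coordT i (v 3) = 0 := by
        refine (Submodule.disjoint_def.mp (dec.peirceT_isCompl h2 h3 hι he).disjoint) _ (T3 i) ?_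
        rw [eq_neg_of_add_eq_zero_left this]
        exact neg_mem (T4 i)
      refine ⟨h3, ?_⟩
      rwa [h3, zero_add] at this
    have hD : dec.dJ e a + d = 0 := by
      have := congrArg dec.projD hs
      simpa [D0, D1, D2, D3, D4] using this
    obtain rfl : a = 0 := dec.eq_zero_of_dJ_mem_annD h2 hι he ha (by
      rw [eq_neg_of_add_eq_zero_left hD]
      exact neg_mem hd)
    obtain rfl : d = 0 := by simpa using hD
    have hy0 : y = 0 := dec.eq_zero_of_coords (fun i j => (hJ i j).2.2) T2 D2
    intro i
    fin_cases i
    · exact dec.eq_zero_of_coords (fun i j => (hJ i j).1) T0 D0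
    · exact dec.eq_zero_of_coords (fun i j => (hJ i j).2.1) T1 D1
    · rw [hy0, map_zero, add_zero] at hy2
      exact hy2.symm
    · exact dec.eq_zero_of_coords J3 (fun i => (hT i).1) D3
    · exact dec.eq_zero_of_coords J4 (fun i => (hT i).2) D4
    · rw [map_zero] at hd5
      exact hd5.symm

end ShortDecomposition

end ShortSL2

end

theorem theorem3p2 {F : Type*} [Field F] (char_ne_two : (2 : F) ≠ 0) (char_ne_three : (3 : F) ≠ 0)
    {L : Type*} [LieRing L] [LieAlgebra F L]
    {J T D : Type*} [AddCommGroup J] [Module F J] [AddCommGroup T] [Module F T]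
    [AddCommGroup D] [Module F D] :
    -- the bracket of a short inner `SL₂`-structure makes `(J, T)` a `J`-ternary algebra
    (∀ (Ψ : GStructure (SL2 F) L) (ι : sl2 F →ₗ⁅F⁆ L), IsInnerSL2 Ψ ι →
      ∀ dec : ShortDecomposition Ψ J T D, dec.IsCoordinatization ι) ∧
    -- the restriction of an inner (resp. short) structure to the diagonal is inner (resp. short)
    (∀ (Φ : GStructure (SL2SL2 F) L) (ι : sl2 F × sl2 F →ₗ⁅F⁆ L), IsInnerSL2SL2 Φ ι →
      IsInnerSL2 Φ.diag (ι.comp (diagLie F))) ∧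
    (∀ Φ : GStructure (SL2SL2 F) L, IsShortSL2SL2 Φ → IsShortSL2 Φ.diag) ∧
    -- from `(SL₂ × SL₂)`-structures to idempotents
    (∀ (Φ : GStructure (SL2SL2 F) L) (ι : sl2 F × sl2 F →ₗ⁅F⁆ L), IsInnerSL2SL2 Φ ι →
      ∀ dec : ShortDecomposition Φ.diag J T D,
        ∃ e : J, dec.mul e e = e ∧ e ≠ 0 ∧ e ≠ dec.one (ι.comp (diagLie F)) ∧
          (∀ f₁ f₀ : sl2 F, ι (f₁, f₀) =
            dec.adj f₁ e + dec.adj f₀ (dec.one (ι.comp (diagLie F)) - e)) ∧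
          Disjoint (dec.adjSub (Submodule.span F {e}))
            (dec.adjSub (Submodule.span F {dec.one (ι.comp (diagLie F)) - e})) ∧
          LinearMap.range (ι : sl2 F × sl2 F →ₗ[F] L) =
            dec.adjSub (Submodule.span F {e}) ⊔
              dec.adjSub (Submodule.span F {dec.one (ι.comp (diagLie F)) - e})) ∧
    -- from idempotents to `(SL₂ × SL₂)`-structures
    (∀ (Ψ : GStructure (SL2 F) L) (ι : sl2 F →ₗ⁅F⁆ L), IsInnerSL2 Ψ ι →
      ∀ (dec : ShortDecomposition Ψ J T D) (e : J),
        dec.mul e e = e → e ≠ 0 → e ≠ dec.one ι →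
        -- the Peirce decomposition of `J` and the induced decomposition of `T`
        DirectSum.IsInternal ![dec.peirceJ e 1, dec.peirceJ e 2⁻¹, dec.peirceJ e 0] ∧
        IsCompl (dec.peirceT e 1) (dec.peirceT e 0) ∧
        ∃ (Φ : GStructure (SL2SL2 F) L) (ι' : sl2 F × sl2 F →ₗ⁅F⁆ L),
          IsInnerSL2SL2 Φ ι' ∧ IsShortSL2SL2 Φ ∧ Φ.diag = Ψ ∧
          (∀ f₁ f₀ : sl2 F, ι' (f₁, f₀) = dec.adj f₁ e + dec.adj f₀ (dec.one ι - e)) ∧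
          -- the isotypic decomposition
          DirectSum.IsInternal
            ![dec.adjSub (dec.peirceJ e 1),
              dec.adjSub (dec.peirceJ e 0),
              dec.adjSub (dec.peirceJ e 2⁻¹) ⊔ dec.derSub e (dec.peirceJ e 2⁻¹),
              dec.natSub (dec.peirceT e 1),
              dec.natSub (dec.peirceT e 0),
              Φ.fixed] ∧
          Disjoint (dec.adjSub (dec.peirceJ e 2⁻¹)) (dec.derSub e (dec.peirceJ e 2⁻¹)) ∧
          dec.adjSub (dec.peirceJ e 1) = isotypic (adjRep₁ F) Φ.toGroupRep ∧
          dec.adjSub (dec.peirceJ e 0) = isotypic (adjRep₀ F) Φ.toGroupRep ∧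
          dec.adjSub (dec.peirceJ e 2⁻¹) ⊔ dec.derSub e (dec.peirceJ e 2⁻¹) =
            isotypic (natRep₁₀ F) Φ.toGroupRep ∧
          dec.natSub (dec.peirceT e 1) = isotypic (natRep₁ F) Φ.toGroupRep ∧
          dec.natSub (dec.peirceT e 0) = isotypic (natRep₀ F) Φ.toGroupRep ∧
          -- the individual copies
          (∀ a ∈ dec.peirceJ e 1, a ≠ 0 →
            IsCopy (adjRep₁ F) Φ.toGroupRep (dec.adjSub (Submodule.span F {a}))) ∧
          (∀ a ∈ dec.peirceJ e 0, a ≠ 0 →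
            IsCopy (adjRep₀ F) Φ.toGroupRep (dec.adjSub (Submodule.span F {a}))) ∧
          (∀ a ∈ dec.peirceJ e 2⁻¹, a ≠ 0 →
            IsCopy (natRep₁₀ F) Φ.toGroupRep
              (dec.adjSub (Submodule.span F {a}) ⊔ Submodule.span F {dec.triv (dec.dJ e a)})) ∧
          (∀ x ∈ dec.peirceT e 1, x ≠ 0 →
            IsCopy (natRep₁ F) Φ.toGroupRep (dec.natSub (Submodule.span F {x}))) ∧
          (∀ x ∈ dec.peirceT e 0, x ≠ 0 →
            IsCopy (natRep₀ F) Φ.toGroupRep (dec.natSub (Submodule.span F {x}))) ∧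
          -- the elements fixed by the diagonal
          LinearMap.range dec.triv = Ψ.fixed ∧
          Φ.fixed ⊔ dec.derSub e (dec.peirceJ e 2⁻¹) = Ψ.fixed ∧
          Disjoint Φ.fixed (dec.derSub e (dec.peirceJ e 2⁻¹))) := by
  refine ⟨fun Ψ ι hι dec => dec.isCoordinatization char_ne_two char_ne_three hι,
    fun Φ ι hΦ => isInner_diag hΦ, fun Φ hΦ => isShort_diag char_ne_two hΦ,
    fun Φ ι hΦ dec => exists_idempotent char_ne_two char_ne_three hΦ dec,
    fun Ψ ι hι dec e he h0 h1 => ?_⟩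
  refine ⟨dec.peirceJ_isInternal char_ne_two hι he,
    dec.peirceT_isCompl char_ne_two char_ne_three hι he,
    dec.splitStructure char_ne_two char_ne_three hι he,
    dec.splitLie char_ne_two char_ne_three hι he,
    dec.splitStructure_inner char_ne_two char_ne_three hι he h0 h1,
    dec.splitStructure_short char_ne_two char_ne_three hι he,
    dec.splitStructure_diag char_ne_two char_ne_three hι he,
    fun _ _ => rfl,
    dec.isotypic_isInternal char_ne_two char_ne_three hι he,
    dec.disjoint_adjSub_derSub _ _ _,
    dec.adjSub_one_eq_isotypic char_ne_two char_ne_three hι he,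
    dec.adjSub_zero_eq_isotypic char_ne_two char_ne_three hι he,
    dec.adjSub_half_sup_derSub_eq_isotypic char_ne_two char_ne_three hι he,
    dec.natSub_one_eq_isotypic char_ne_two char_ne_three hι he,
    dec.natSub_zero_eq_isotypic char_ne_two char_ne_three hι he,
    fun a ha h => ⟨_, dec.splitRep_adj₁ char_ne_two char_ne_three hι he ha,
      dec.adj_flip_injective h, (dec.adjSub_span a).symm⟩,
    fun a ha h => ⟨_, dec.splitRep_adj₀ char_ne_two char_ne_three hι he ha,
      dec.adj_flip_injective h, (dec.adjSub_span a).symm⟩,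
    fun a ha h => ⟨_, dec.splitRep_sqMap char_ne_two char_ne_three hι he ha,
      dec.sqMap_injective char_ne_two hι he ha h, dec.range_sqMap char_ne_two a⟩,
    fun x hx h => ⟨_, dec.splitRep_nat₁ char_ne_two char_ne_three hι he hx,
      dec.nat_flip_injective h, (dec.natSub_span x).symm⟩,
    fun x hx h => ⟨_, dec.splitRep_nat₀ char_ne_two char_ne_three hι he hx,
      dec.nat_flip_injective h, (dec.natSub_span x).symm⟩,
    dec.range_triv char_ne_two hι,
    dec.fixed_sup_derSub char_ne_two char_ne_three hι he,
    dec.disjoint_fixed_derSub char_ne_two char_ne_three hι he⟩
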